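/- **Conventions.** For $n\ge 1$ let $B_n$ be the group of bijections $\sigma$ of $\{\pm1,\dots,\pm n\}$ with $\sigma(-i)=-\sigma(i)$, written in one-line notation $[\sigma(1),\dots,\sigma(n)]$, with product composition from right to left. Put $\sigma(0)=0$ and $\mathrm{Des}(\sigma)=\{i: 0\le i\le n-1,\ \sigma(i)>\sigma(i+1)\}$. Let $D_n\subseteq B_n$ consist of the $\sigma$ with an even number of negative entries among $\sigma(1),\dots,\sigma(n)$. A cycle $(e_1,\dots,e_\ell)$ of nonzero integers with distinct absolute values denotes $|e_i|\mapsto e_{i+1}$, indices cyclic, and every $\sigma\in B_n$ is a product of disjoint such cycles, in whose notation exactly one of $i,-i$ appears for each $i\in\{1,\dots,n\}$; the element *preceding* $e_{i+1}$ is $e_i$. $\sigma$ is *cyclic* if it is a single cycle of length $n$. Let $C_{B,n}$ be the set of cyclic $\sigma\in B_n$, let $C_{D,n}=C_{B,n}\cap D_n$ and $\overline{C_{D,n}}=C_{B,n}\setminus D_n$, and let $C_{S,n}$ be the set of $n$-cycles in $S_n$. Regard $S_n$ as the subgroup of $B_n$ of those $\sigma$ with $\sigma(1),\dots,\sigma(n)>0$.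 **The map $\varphi$.** Let $\pi\in C_{B,n+1}$ have $n+1$ (not $-(n+1)$) in its cycle notation. For $\sigma\in B_n$ and integers $x,y\ge0$ let $P_{\pi,\sigma}(x,y)$ mean that $|x-y|=1$ and that $\min\{x,y\}$ lies in $\{1,\dots,n-1\}$ and in exactly one of $\mathrm{Des}(\pi)$, $\mathrm{Des}(\sigma)$. Write $\pi$ as a cycle with $n+1$ last, cut the cycle immediately before each of its left-to-right maxima, and drop the last piece $(n+1)$; the other pieces are the cycles $\sigma_1,\dots,\sigma_m$ of a signed permutation $\sigma$. For $j=1,\dots,m$ do the following, where $z$ always denotes the current last entry of $\sigma_j$. If $P_{\pi,\sigma}(|z|,|z-1|)$ or $P_{\pi,\sigma}(|z|,|z+1|)$ holds, choose $\epsilon\in\{-1,1\}$ such that $P_{\pi,\sigma}(|z|,|z+\epsilon|)$ holds and $\pi(|z+\epsilon|)$ is largest. While $P_{\pi,\sigma}(|z|,|z+\epsilon|)$ holds, let $x=z$, let $y$ be the one of $\pm(z+\epsilon)$ that appears in $\sigma$, and, while $P_{\pi,\sigma}(|x|,|y|)$ holds, replace $x$ by $\mathrm{sgn}(x)|y|$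 and $y$ by $\mathrm{sgn}(y)|x|$ in the cycle notation of $\sigma$ and, if this did not involve the first element of $\sigma_j$, let $x,y$ be the elements preceding the two new entries, respectively. The final $\sigma$ is $\varphi(\pi)\in B_n$. **The map $\Phi$.** For a signed permutation $\sigma$ let $-\sigma$ be obtained by changing the sign of every entry of the one-line notation, and let $s=[-1,2,\dots,n]\in B_n$. Define $\Phi:C_{B,n+1}\to B_n$ as follows. If $n+1$ appears in the one-line notation of $\pi$, let $\sigma=\varphi(\pi)$, and put $\Phi(\pi)=\sigma$ if $0$ is in both or neither of $\mathrm{Des}(\pi)$ and $\mathrm{Des}(\sigma)$, and $\Phi(\pi)=s\sigma$ otherwise. If $-(n+1)$ appears, let $\sigma=\varphi(-\pi)$, and put $\Phi(\pi)=-\sigma$ if $0$ is in both or neither of $\mathrm{Des}(\pi)$ and $\mathrm{Des}(-\sigma)$, and $\Phi(\pi)=-s\sigma$ otherwise. **Elizalde's map $\varphi_E:C_{S,n+1}\to S_n$.** For $\pi\in C_{S,n+1}$ form $\sigma=\sigma_1\cdots\sigma_m$ as above. For $j=1,\dots,m$, with $z$ always the current last entry of $\sigma_j$: if for some $\epsilon\in\{-1,1\}$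 one has $1\le z+\epsilon\le n$, $\pi(z)>\pi(z+\epsilon)$ and $\sigma(z)<\sigma(z+\epsilon)$, choose such an $\epsilon$ with $\pi(z+\epsilon)$ largest. While these three conditions hold for this $\epsilon$, swap $z$ and $z+\epsilon$ in the cycle notation of $\sigma$, and then, as long as the last swap did not involve the first element of $\sigma_j$ and the elements preceding the two swapped ones differ by exactly $1$, swap those preceding elements too. The final $\sigma$ is $\varphi_E(\pi)$. **Theorem.** For every integer $n\ge1$ the map $\Phi:C_{B,n+1}\to B_n$ has the following properties. (a) $\mathrm{Des}(\pi)\cap\{0,1,\dots,n-1\}=\mathrm{Des}(\Phi(\pi))$ for all $\pi\in C_{B,n+1}$. (b) The restriction of $\Phi$ to $C_{D,n+1}$ is a bijection onto $B_n$, and so is the restriction of $\Phi$ to $\overline{C_{D,n+1}}$. (c) $\Phi$ reduces to Elizalde's bijection: $C_{S,n+1}\subseteq C_{B,n+1}$, $\Phi(\pi)=\varphi_E(\pi)$ for all $\pi\in C_{S,n+1}$, and $\varphi_E:C_{S,n+1}\to S_n$ is a bijection. -/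

import Mathlib

namespace CyclicDescents

/-! ### Signed permutations -/

/-- The signed symmetric group `B_n`, realised inside the permutations of `ℤ`: the bijections `σ`
with `σ (-k) = -σ k` that fix every integer outside `{-n, …, n}`. Such a `σ` fixes `0` and restricts
to a bijection of `{±1, …, ±n}`; every odd bijection of `{±1, …, ±n}` arises from exactly one `σ`.
The group operation is composition, performed from right to left. -/
def SignedPerm (n : ℕ) : Subgroup (Equiv.Perm ℤ) where
  carrier := {σ | (∀ k : ℤ, σ (-k) = -σ k) ∧ ∀ k : ℤ, (n : ℤ) < |k| → σ k = k}
  one_mem' := ⟨fun _ => rfl, fun _ _ => rfl⟩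
  mul_mem' := by
    rintro σ τ ⟨hσ, hσ'⟩ ⟨hτ, hτ'⟩
    refine ⟨fun k => ?_, fun k hk => ?_⟩
    · simp [hτ, hσ]
    · simp [hτ' k hk, hσ' k hk]
  inv_mem' := by
    rintro σ ⟨hσ, hσ'⟩
    refine ⟨fun k => ?_, fun k hk => ?_⟩
    · rw [Equiv.Perm.inv_eq_iff_eq, hσ]; simp
    · rw [Equiv.Perm.inv_eq_iff_eq, hσ' k hk]

/-- A signed permutation as a function on `ℤ`. -/
def values {n : ℕ} (σ : SignedPerm n) : ℤ → ℤ := ⇑(σ : Equiv.Perm ℤ)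

/-- The descent set of `[f 1, …, f n]`: the `i` with `0 ≤ i ≤ n - 1` and `f i > f (i + 1)`
(for a signed permutation, `f 0 = 0`). -/
def Des (n : ℕ) (f : ℤ → ℤ) : Finset ℕ :=
  (Finset.range n).filter fun i => f ((i : ℤ) + 1) < f i

/-- `D_n`: the signed permutations whose one-line notation has an even number of negatives. -/
def typeD (n : ℕ) : Set (SignedPerm n) :=
  {σ | Even ((Finset.Icc 1 n).filter fun i : ℕ => values σ i < 0).card}

/-- `C_{B,n}`: the signed permutations whose cycle notation is a single cycle
`c = (ε₁ a₁, …, ε_n a_n)` of length `n`, where `a₁, …, a_n` are distinct elements of `{1, …, n}`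
and `σ a_i = ε_{i+1} a_{i+1}`, indices being cyclic. -/
def cyclicB (n : ℕ) : Set (SignedPerm n) :=
  {σ | ∃ c : List ℤ, c.length = n ∧ (c.map fun a => |a|).Nodup ∧
    (∀ a ∈ c, 1 ≤ |a| ∧ |a| ≤ (n : ℤ)) ∧ (c.map fun a => values σ |a|) = c.rotate 1}

/-- The function that changes the sign of every `k` with `|k| ∈ s` and `|k| ≤ n`, and fixes the
rest. -/
def signChangeFun (n : ℕ) (s : Finset ℕ) (k : ℤ) : ℤ :=
  if k.natAbs ∈ s ∧ k.natAbs ≤ n then -k else k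

theorem signChangeFun_signChangeFun (n : ℕ) (s : Finset ℕ) (k : ℤ) :
    signChangeFun n s (signChangeFun n s k) = k := by
  by_cases h : k.natAbs ∈ s ∧ k.natAbs ≤ n <;> simp [signChangeFun, h]

/-- The signed permutation that changes the sign of every `k` with `|k| ∈ s`, and fixes the rest. -/
def signChange (n : ℕ) (s : Finset ℕ) : SignedPerm n :=
  ⟨⟨signChangeFun n s, signChangeFun n s, signChangeFun_signChangeFun n s,
      signChangeFun_signChangeFun n s⟩, by
    refine ⟨fun k => ?_, fun k hk => ?_⟩
    · change signChangeFun n s (-k) = -signChangeFun n s k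
      by_cases h : k.natAbs ∈ s ∧ k.natAbs ≤ n <;> simp [signChangeFun, h]
    · change signChangeFun n s k = k
      have h : ¬ k.natAbs ≤ n := by rw [Int.abs_eq_natAbs] at hk; omega
      simp [signChangeFun, h]⟩

/-- `[-1, -2, …, -n]`. -/
def negAll (n : ℕ) : SignedPerm n := signChange n (Finset.Icc 1 n)

/-- `[-1, 2, …, n]`. -/
def negOne (n : ℕ) : SignedPerm n := signChange n {1}

open Classical in
/-- The signed permutation in `B_n` with one-line notation `[f 1, …, f n]`
(the identity if there is none). -/
noncomputable def ofValues (n : ℕ) (f : ℤ → ℤ) : SignedPerm n :=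
  if h : ∃ σ : SignedPerm n, ∀ i : ℤ, 1 ≤ i → i ≤ n → values σ i = f i then h.choose else 1

/-! ### Cycle notations

A cycle notation is a list of cycles, each of which is a list of nonzero integers; the cycle
`[e₁, …, e_l]` sends `|e_i|` to `e_{i+1}` and `|e_l|` to `e₁`. -/

/-- All pairs (element, following element) of a cycle notation, cyclically within each cycle. -/
def arrows (c : List (List ℤ)) : List (ℤ × ℤ) := c.flatMap fun l => l.zip (l.rotate 1)

/-- The function with the given cycle notation, extended oddly to the negative integers;
integers that do not appear are fixed. -/
def cycleVal (c : List (List ℤ)) (x : ℤ) : ℤ :=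
  match (arrows c).find? fun p => p.1.natAbs == x.natAbs with
  | some p => x.sign * p.2
  | none => x

/-- The element preceding the element `y` in a cycle notation. -/
def prec (c : List (List ℤ)) (y : ℤ) : ℤ :=
  match (arrows c).find? fun p => p.2 == y with
  | some p => p.1
  | none => y

/-- Whichever of `y` and `-y` appears in the cycle notation. -/
def appearing (c : List (List ℤ)) (y : ℤ) : ℤ := if y ∈ c.flatten then y else -y

/-- The first element of the `j`-th cycle (counting from `0`). -/
def firstOf (c : List (List ℤ)) (j : ℕ) : ℤ := (c.getD j []).headD 0

/-- The last (rightmost) element of the `j`-th cycle (counting from `0`). -/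
def lastOf (c : List (List ℤ)) (j : ℕ) : ℤ := (c.getD j []).getLastD 0

/-- Cut a list of distinct integers immediately before each of its left-to-right maxima. -/
def cutAtMaxima : List ℤ → List (List ℤ)
  | [] => []
  | a :: l => (a :: l.takeWhile fun b => b < a) :: cutAtMaxima (l.dropWhile fun b => b < a)
termination_by l => l.length
decreasing_by
  have := (List.dropWhile_sublist (l := l) fun b => decide (b < a)).length_le
  simp only [List.length_cons]
  omega

/-- The cycle `(f (n+1), f |f (n+1)|, …)` of length `n + 1` of `f`. If `f` is a cyclic signed
permutation whose cycle notation contains `n + 1`, then it ends in `n + 1`. -/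
def cycleList (n : ℕ) (f : ℤ → ℤ) : List ℤ :=
  List.iterate (fun a => f |a|) (f ((n : ℤ) + 1)) (n + 1)

/-- The cycle notation from which the algorithms start: the cycle with `n + 1` in the final position
is cut before each left-to-right maximum, and the last piece `(n + 1)` is dropped. -/
def startCycles (n : ℕ) (f : ℤ → ℤ) : List (List ℤ) := (cutAtMaxima (cycleList n f)).dropLast

/-! ### The map `Φ` -/

open Classical in
/-- `while cond do s := body s`, started at `s`. The value is `s` if the loop does not terminate. -/
noncomputable def whileLoop {α : Type} (cond : α → Prop) (body : α → α) (s : α) : α :=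
  if h : ∃ k : ℕ, ¬ cond (body^[k] s) then body^[Nat.find h] s else s

/-- The Boolean function `P_{π,σ}(x, y)`: `|x - y| = 1`, and `min x y` is an element of
`{1, …, n-1}` that belongs to exactly one of the descent sets of `π` (in `B_{n+1}`) and `σ`
(in `B_n`). -/
def P (n : ℕ) (π σ : ℤ → ℤ) (x y : ℕ) : Bool :=
  decide ((x + 1 = y ∨ y + 1 = x) ∧
    min x y ∈ symmDiff (Des (n + 1) π) (Des n σ) ∩ Finset.Icc 1 (n - 1))

/-- Replace `x` by `sgn x * |y|` and `y` by `sgn y * |x|` in a cycle notation. -/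
def replaceEntries (c : List (List ℤ)) (x y : ℤ) : List (List ℤ) :=
  c.map fun l => l.map fun a =>
    if a = x then x.sign * |y| else if a = y then y.sign * |x| else a

/-- One pass of the inner `while` loop for the `j`-th cycle, on the triple `(σ, x, y)`: swap `x` and
`y`; if the first element of the `j`-th cycle was not involved, continue with the elements
preceding the replaced ones. -/
def innerBody (j : ℕ) (s : List (List ℤ) × ℤ × ℤ) : List (List ℤ) × ℤ × ℤ :=
  let x := s.2.1
  let y := s.2.2
  let c := replaceEntries s.1 x y
  if firstOf s.1 j = x ∨ firstOf s.1 j = y then (c, x, y)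
  else (c, prec c (x.sign * |y|), prec c (y.sign * |x|))

/-- The inner `while` loop: swap as long as `P_{π,σ}(|x|, |y|)` holds. -/
noncomputable def innerLoop (n : ℕ) (π : ℤ → ℤ) (j : ℕ) (s : List (List ℤ) × ℤ × ℤ) :
    List (List ℤ) × ℤ × ℤ :=
  whileLoop (fun s => P n π (cycleVal s.1) s.2.1.natAbs s.2.2.natAbs = true) (innerBody j) s

/-- The outer `while` loop: as long as `P_{π,σ}(|z|, |z + ε|)` holds for the last element `z` of the
`j`-th cycle, run the inner loop from `x = z` and `y = ±(z + ε)`. -/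
noncomputable def outerLoop (n : ℕ) (π : ℤ → ℤ) (j : ℕ) (ε : ℤ) (c : List (List ℤ)) :
    List (List ℤ) :=
  whileLoop
    (fun c => P n π (cycleVal c) (lastOf c j).natAbs (lastOf c j + ε).natAbs = true)
    (fun c => (innerLoop n π j (c, lastOf c j, appearing c (lastOf c j + ε))).1) c

/-- The `j`-th iteration of the `for` loop: `ε ∈ {-1, 1}` is chosen such that
`P_{π,σ}(|z|, |z + ε|)` holds and, if both signs qualify, `π |z + ε|` is largest. -/
noncomputable def forStep (n : ℕ) (π : ℤ → ℤ) (c : List (List ℤ)) (j : ℕ) : List (List ℤ) :=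
  let z := lastOf c j
  let up := P n π (cycleVal c) z.natAbs (z + 1).natAbs
  let down := P n π (cycleVal c) z.natAbs (z - 1).natAbs
  if up = true ∧ (down = true → π |z - 1| < π |z + 1|) then outerLoop n π j 1 c
  else if down = true then outerLoop n π j (-1) c
  else c

/-- The cycle notation returned by the algorithm on `π`. -/
noncomputable def algorithm (n : ℕ) (π : ℤ → ℤ) : List (List ℤ) :=
  (List.range (startCycles n π).length).foldl (forStep n π) (startCycles n π)

/-- The map `φ`, meant for the cyclic `π ∈ B_{n+1}` in whose notation `n + 1` appears. -/
noncomputable def phi (n : ℕ) (π : SignedPerm (n + 1)) : SignedPerm n :=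
  ofValues n (cycleVal (algorithm n (values π)))

/-- `n + 1`, as opposed to `-(n + 1)`, appears in the one-line notation of `π`. -/
def HasPosTop (n : ℕ) (π : SignedPerm (n + 1)) : Prop :=
  ∃ i : ℤ, 1 ≤ i ∧ i ≤ (n : ℤ) + 1 ∧ values π i = (n : ℤ) + 1

open Classical in
/-- The map `Φ : C_{B,n+1} → B_n`. -/
noncomputable def Phi (n : ℕ) (π : cyclicB (n + 1)) : SignedPerm n :=
  let p : SignedPerm (n + 1) := π
  if HasPosTop n p then
    let σ := phi n p
    if 0 ∈ symmDiff (Des (n + 1) (values p)) (Des n (values σ)) then negOne n * σ else σ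
  else
    let σ := phi n (negAll (n + 1) * p)
    if 0 ∈ symmDiff (Des (n + 1) (values p)) (Des n (values (negAll n * σ))) then
      negAll n * (negOne n * σ)
    else negAll n * σ

/-! ### The symmetric group and Elizalde's map -/

/-- The function on `ℤ` with `k ↦ w k` and `-k ↦ -(w k)` for `1 ≤ k ≤ n`, and `k ↦ k` if `|k| > n`
or `k = 0`; the permutation `w` is numbered from `1` here. -/
def unsignedFun {n : ℕ} (w : Equiv.Perm (Fin n)) (k : ℤ) : ℤ :=
  if h : 1 ≤ k.natAbs ∧ k.natAbs ≤ n then k.sign * ((w ⟨k.natAbs - 1, by omega⟩ : ℕ) + 1 : ℤ) else k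

theorem unsignedFun_inv {n : ℕ} (w : Equiv.Perm (Fin n)) (k : ℤ) :
    unsignedFun w⁻¹ (unsignedFun w k) = k := by
  by_cases h : 1 ≤ k.natAbs ∧ k.natAbs ≤ n
  · have hk : k ≠ 0 := by omega
    obtain ⟨v, hv⟩ : ∃ v : Fin n, w ⟨k.natAbs - 1, by omega⟩ = v := ⟨_, rfl⟩
    have h1 : unsignedFun w k = k.sign * ((v : ℕ) + 1 : ℤ) := by
      simp [unsignedFun, h, hv]
    have h2 : (unsignedFun w k).natAbs = (v : ℕ) + 1 := by
      rw [h1, Int.natAbs_mul, Int.natAbs_sign_of_ne_zero hk]; omega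
    have h3 : (unsignedFun w k).sign = k.sign := by
      rw [h1, Int.sign_mul, Int.sign_sign, Int.sign_eq_one_of_pos (a := ((v : ℕ) + 1 : ℤ)) (by omega),
        mul_one]
    have h4 : 1 ≤ (unsignedFun w k).natAbs ∧ (unsignedFun w k).natAbs ≤ n := by
      have := v.2
      omega
    have h5 : w⁻¹ v = ⟨k.natAbs - 1, by omega⟩ := by
      rw [Equiv.Perm.inv_eq_iff_eq, hv]
    generalize unsignedFun w k = u at h2 h3 h4 ⊢
    have h6 : (⟨u.natAbs - 1, by omega⟩ : Fin n) = v := Fin.ext (by simp [h2])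
    rw [unsignedFun, dif_pos h4, h3, h6, h5]
    have h7 : ((k.natAbs - 1 : ℕ) + 1 : ℤ) = (k.natAbs : ℤ) := by omega
    simp only [h7]
    exact Int.sign_mul_natAbs k
  · have h1 : unsignedFun w k = k := by simp [unsignedFun, h]
    rw [h1]
    simp [unsignedFun, h]

/-- The natural embedding of `S_n` in `B_n`, onto the signed permutations without negatives in the
one-line notation. -/
def unsigned {n : ℕ} (w : Equiv.Perm (Fin n)) : SignedPerm n :=
  ⟨⟨unsignedFun w, unsignedFun w⁻¹, unsignedFun_inv w, fun k => by
      simpa using unsignedFun_inv w⁻¹ k⟩, by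
    refine ⟨fun k => ?_, fun k hk => ?_⟩
    · change unsignedFun w (-k) = -unsignedFun w k
      by_cases h : 1 ≤ k.natAbs ∧ k.natAbs ≤ n <;> simp [unsignedFun, h]
    · change unsignedFun w k = k
      have h : ¬ (1 ≤ k.natAbs ∧ k.natAbs ≤ n) := by rw [Int.abs_eq_natAbs] at hk; omega
      simp [unsignedFun, h]⟩

/-- `C_{S,n}`: the permutations in `S_n` that consist of a single cycle of length `n` (for
`n ≥ 2`). -/
def cyclicS (n : ℕ) : Set (Equiv.Perm (Fin n)) := {w | w.cycleType = {n}}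

/-- The condition of Elizalde's algorithm on a pair of elements of `{1, …, n}`:
`π z > π y` and `σ z < σ y`. -/
def Q (n : ℕ) (π σ : ℤ → ℤ) (z y : ℤ) : Bool :=
  decide ((1 ≤ y ∧ y ≤ n) ∧ π y < π z ∧ σ z < σ y)

/-- Swap the entries `x` and `y` in a cycle notation. -/
def swapEntries (c : List (List ℤ)) (x y : ℤ) : List (List ℤ) :=
  c.map fun l => l.map (Equiv.swap x y)

/-- Elizalde's chain of swaps, on triples `(σ, x, y)` in which the entry `x` has just been put where
`y` was and vice versa: as long as the last swap did not involve the first element of the `j`-th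
cycle and the elements preceding the swapped ones differ by `1`, those are swapped as well. -/
noncomputable def swapChain (j : ℕ) (s : List (List ℤ) × ℤ × ℤ) : List (List ℤ) × ℤ × ℤ :=
  whileLoop
    (fun s => (firstOf s.1 j ≠ s.2.1 ∧ firstOf s.1 j ≠ s.2.2) ∧
      |prec s.1 s.2.1 - prec s.1 s.2.2| = 1)
    (fun s => (swapEntries s.1 (prec s.1 s.2.2) (prec s.1 s.2.1), prec s.1 s.2.2, prec s.1 s.2.1)) s

/-- Elizalde's `while` loop for the `j`-th cycle: as long as the condition holds for its last element
`z` and `z + ε`, swap `z` and `z + ε` and perform the chain of swaps that follows. -/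
noncomputable def elizaldeLoop (n : ℕ) (π : ℤ → ℤ) (j : ℕ) (ε : ℤ) (c : List (List ℤ)) :
    List (List ℤ) :=
  whileLoop
    (fun c => Q n π (cycleVal c) (lastOf c j) (lastOf c j + ε) = true)
    (fun c => (swapChain j (swapEntries c (lastOf c j) (lastOf c j + ε),
      lastOf c j, lastOf c j + ε)).1) c

/-- The `j`-th iteration of the `for` loop of Elizalde's algorithm. -/
noncomputable def elizaldeStep (n : ℕ) (π : ℤ → ℤ) (c : List (List ℤ)) (j : ℕ) : List (List ℤ) :=
  let z := lastOf c j
  let up := Q n π (cycleVal c) z (z + 1)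
  let down := Q n π (cycleVal c) z (z - 1)
  if up = true ∧ (down = true → π (z - 1) < π (z + 1)) then elizaldeLoop n π j 1 c
  else if down = true then elizaldeLoop n π j (-1) c
  else c

/-- The cycle notation returned by Elizalde's algorithm on `π`. -/
noncomputable def elizaldeAlgorithm (n : ℕ) (π : ℤ → ℤ) : List (List ℤ) :=
  (List.range (startCycles n π).length).foldl (elizaldeStep n π) (startCycles n π)

open Classical in
/-- Elizalde's map `C_{S,n+1} → S_n`: the permutation whose cycle notation is returned by his
algorithm (the identity if there is none). -/
noncomputable def elizalde (n : ℕ) (w : Equiv.Perm (Fin (n + 1))) : Equiv.Perm (Fin n) :=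
  if h : ∃ v : Equiv.Perm (Fin n), ∀ i : ℤ, 1 ≤ i → i ≤ n →
      values (unsigned v) i = cycleVal (elizaldeAlgorithm n (values (unsigned w))) i
  then h.choose else 1

end CyclicDescents

/-!
The algorithm that computes `φ` is studied on the level of *places*. Write `π` as a cycle
`(e 0, …, e n)` with `e n = n + 1`; then `|e p|` is a position and `e (p + 1)` the value of `π` there.
The cycle notation in which the algorithm works has the same places throughout; only the entries
change. The cycles of the starting notation are closed one after the other: before the `j`-th
iteration the first `j` cycles count as closed, while the remaining places still form one long cycle
through `n + 1` (`nxt`). As each cycle begins with its largest entry, and these entries increase, it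
makes no difference for the comparisons in the loop whether the later cycles are already closed
(`Heads.ok_iff`).

A pair of adjacent positions is *right* (`Ok`) if its two values compare as the descent set of `π`
demands. At the start all pairs are right. Closing a cycle with last entry `z` replaces the value at
the position `|z|` by the smaller head of the cycle, so that only the positions next to `|z|` can be
wrong. A pass of the inner loop exchanges the absolute values of two entries that differ by one; this
moves the values at two adjacent positions past each other and may create just one new wrong pair,
that of the preceding places, which is the next one to be exchanged (`ChainState.next`). Such a chain
of exchanges is an involution (`chain_chain`), and repeated chains carry the last entry of the cycle
in one direction until no pair is wrong (`outerTo_blocks`). So one iteration ends with the next cycle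
closed and all pairs right, which gives the assertion on descents at positive positions
(`PhiData.mem_des_iff`).

The last chain of an iteration can be recognized from its result: it leaves, at the position just
vacated, a value between the head of the cycle and that of the next one (`Back`), while an iteration
without exchanges leaves no such trace. Hence each iteration can be undone (`Run.injective`,
`Reaches.injective`). Since the final notation is determined by `φ(π)` (`Heads.entries_unique`), `φ`
is injective, and by counting it is a bijection from the cyclic `π` with `n + 1` in their notation
onto `B_n` (`phi_surjective`).

The signs of the entries never change, so `φ` preserves the number of negatives. The value at
position `1` never crosses `-1` (`ChainState.one_iff`, `StartState.one_iff`); thus its sign is that of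
`π 1` except when it is `-1`, and this is when the factor `s` enters. Counting negatives modulo `2`,
one reads off from `Φ(π)` and the parity of `π` which of the four cases in the definition of `Φ`
applies (`Phi_spec`), and `Φ` is bijective on each parity class.

For `π` without negatives a wrong pair is always a lost descent, so Elizalde's algorithm makes the
same exchanges (`foldl_elizaldeStep_blocks`), and its bijectivity follows by counting the cycles of
length `n + 1`.
-/

namespace CyclicDescents

/-! ### Labelings and exchanges of absolute values -/

/-- The entries of a cycle notation of an element of `B_n`, followed by `n + 1`, as a function of
their place `0, …, n`; the value beyond the last place is `0`. -/
structure IsLabeling (n : ℕ) (e : ℕ → ℤ) : Prop where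
  top : e n = n + 1
  out : ∀ p, n < p → e p = 0
  bd : ∀ p, p < n → 1 ≤ (e p).natAbs ∧ (e p).natAbs ≤ n
  inj : ∀ p q, p ≤ n → q ≤ n → (e p).natAbs = (e q).natAbs → p = q

/-- The integer with the sign of `u` (positive if `u = 0`) and the absolute value of `w`. -/
def withSign (u w : ℤ) : ℤ := if u < 0 then -(w.natAbs : ℤ) else w.natAbs

/-- Exchange the absolute values of the entries at the places `i` and `k`, keeping the signs. -/
def swapAbs (e : ℕ → ℤ) (i k : ℕ) : ℕ → ℤ := fun p =>
  if p = i then withSign (e i) (e k) else if p = k then withSign (e k) (e i) else e p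

/-- The absolute values of `u` and `w` differ by one. -/
def Adj (u w : ℤ) : Prop := u.natAbs + 1 = w.natAbs ∨ w.natAbs + 1 = u.natAbs

/-- `u` and `w` are both negative or both nonnegative. -/
def SameSign (u w : ℤ) : Prop := (u < 0 ↔ w < 0)

theorem Adj.symm {u w : ℤ} (h : Adj u w) : Adj w u := Or.symm h

theorem natAbs_withSign (u w : ℤ) : (withSign u w).natAbs = w.natAbs := by
  unfold withSign; split_ifs <;> omega

theorem withSign_neg {u w : ℤ} (hw : w ≠ 0) : withSign u w < 0 ↔ u < 0 := by
  unfold withSign; split_ifs <;> omega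

theorem swapAbs_left (e : ℕ → ℤ) (i k : ℕ) : swapAbs e i k i = withSign (e i) (e k) := by
  simp [swapAbs]

theorem swapAbs_right {e : ℕ → ℤ} {i k : ℕ} (h : i ≠ k) :
    swapAbs e i k k = withSign (e k) (e i) := by
  simp [swapAbs, h.symm]

theorem swapAbs_of_ne {e : ℕ → ℤ} {i k p : ℕ} (h : p ≠ i) (h' : p ≠ k) :
    swapAbs e i k p = e p := by
  simp [swapAbs, h, h']

theorem natAbs_swapAbs_left (e : ℕ → ℤ) (i k : ℕ) :
    (swapAbs e i k i).natAbs = (e k).natAbs := by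
  rw [swapAbs_left, natAbs_withSign]

theorem natAbs_swapAbs_right (e : ℕ → ℤ) (i k : ℕ) :
    (swapAbs e i k k).natAbs = (e i).natAbs := by
  by_cases h : i = k
  · subst h; rw [natAbs_swapAbs_left]
  · rw [swapAbs_right h, natAbs_withSign]

namespace IsLabeling

variable {n : ℕ} {e : ℕ → ℤ}

theorem ne_zero (h : IsLabeling n e) {p : ℕ} (hp : p ≤ n) : e p ≠ 0 := by
  rcases hp.lt_or_eq with hp | rfl
  · have := h.bd p hp; omega
  · rw [h.top]; omega

theorem swapAbs_neg (h : IsLabeling n e) {i k : ℕ} (hi : i ≤ n) (hk : k ≤ n) (p : ℕ) :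
    swapAbs e i k p < 0 ↔ e p < 0 := by
  unfold swapAbs
  split_ifs with h1 h2
  · rw [withSign_neg (h.ne_zero hk), h1]
  · rw [withSign_neg (h.ne_zero hi), h2]
  · rfl

theorem swapAbs (h : IsLabeling n e) {i k : ℕ} (hi : i < n) (hk : k < n) :
    IsLabeling n (swapAbs e i k) where
  top := by rw [swapAbs_of_ne (by omega) (by omega), h.top]
  out p hp := by rw [swapAbs_of_ne (by omega) (by omega), h.out p hp]
  bd p hp := by
    by_cases h1 : p = i
    · subst h1; rw [natAbs_swapAbs_left]; exact h.bd k hk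
    by_cases h2 : p = k
    · subst h2; rw [natAbs_swapAbs_right]; exact h.bd i hi
    rw [swapAbs_of_ne h1 h2]; exact h.bd p hp
  inj p q hp hq hpq := by
    have key : ∀ p, (CyclicDescents.swapAbs e i k p).natAbs = (e (Equiv.swap i k p)).natAbs := by
      intro p
      by_cases h1 : p = i
      · subst h1; rw [natAbs_swapAbs_left, Equiv.swap_apply_left]
      by_cases h2 : p = k
      · subst h2; rw [natAbs_swapAbs_right, Equiv.swap_apply_right]
      rw [swapAbs_of_ne h1 h2, Equiv.swap_apply_of_ne_of_ne h1 h2]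
    have hle : ∀ p, p ≤ n → Equiv.swap i k p ≤ n := by
      intro p hp
      rw [Equiv.swap_apply_def]; split_ifs <;> omega
    rw [key, key] at hpq
    exact (Equiv.swap i k).injective (h.inj _ _ (hle p hp) (hle q hq) hpq)

/-- Exchanging two consecutive absolute values affects the relative order of no two entries, except
for the exchanged entries themselves if they have the same sign. -/
theorem swapAbs_lt (h : IsLabeling n e) {i k : ℕ} (hi : i < n) (hk : k < n)
    (hadj : Adj (e i) (e k)) {p q : ℕ} (hp : p ≤ n) (hq : q ≤ n)
    (hne : SameSign (e i) (e k) → ¬ (p = i ∧ q = k) ∧ ¬ (p = k ∧ q = i)) :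
    CyclicDescents.swapAbs e i k p < CyclicDescents.swapAbs e i k q ↔ e p < e q := by
  have hik : i ≠ k := by rintro rfl; unfold Adj at hadj; omega
  have zi := h.bd i hi
  have zk := h.bd k hk
  have key : ∀ r ≤ n, (r = i ∧ CyclicDescents.swapAbs e i k r = withSign (e i) (e k) ∧ e r = e i) ∨
      (r = k ∧ CyclicDescents.swapAbs e i k r = withSign (e k) (e i) ∧ e r = e k) ∨
      (CyclicDescents.swapAbs e i k r = e r ∧ (e r).natAbs ≠ (e i).natAbs ∧
        (e r).natAbs ≠ (e k).natAbs) := by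
    intro r hr
    by_cases h1 : r = i
    · subst h1; exact Or.inl ⟨rfl, swapAbs_left _ _ _, rfl⟩
    by_cases h2 : r = k
    · subst h2; exact Or.inr (Or.inl ⟨rfl, swapAbs_right hik, rfl⟩)
    exact Or.inr (Or.inr ⟨swapAbs_of_ne h1 h2, fun h' => h1 (h.inj _ _ hr hi.le h'),
      fun h' => h2 (h.inj _ _ hr hk.le h')⟩)
  unfold SameSign at hne
  unfold Adj at hadj
  rcases key p hp with ⟨h1, h2, h3⟩ | ⟨h1, h2, h3⟩ | ⟨h2, h3, h3'⟩ <;>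
  rcases key q hq with ⟨h4, h5, h6⟩ | ⟨h4, h5, h6⟩ | ⟨h5, h6, h6'⟩ <;>
  rw [h2, h5] <;> unfold withSign <;> (try split_ifs) <;> omega

/-- Exchanging consecutive absolute values of entries of the same sign reverses their order. -/
theorem swapAbs_lt_flip (h : IsLabeling n e) {i k : ℕ} (hi : i < n) (hk : k < n)
    (hadj : Adj (e i) (e k)) (hs : SameSign (e i) (e k)) :
    (CyclicDescents.swapAbs e i k i < CyclicDescents.swapAbs e i k k ↔ e k < e i) ∧
      (CyclicDescents.swapAbs e i k k < CyclicDescents.swapAbs e i k i ↔ e i < e k) := by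
  have hik : i ≠ k := by rintro rfl; unfold Adj at hadj; omega
  have zi := h.bd i hi
  have zk := h.bd k hk
  rw [swapAbs_left, swapAbs_right hik]
  unfold SameSign at hs
  unfold Adj at hadj
  unfold withSign
  constructor <;> split_ifs <;> omega

end IsLabeling

theorem swapAbs_swapAbs {e : ℕ → ℤ} {i k : ℕ} (hik : i ≠ k) (hi : e i ≠ 0) (hk : e k ≠ 0) :
    swapAbs (swapAbs e i k) i k = e := by
  funext p
  have key : ∀ u w : ℤ, u ≠ 0 → w ≠ 0 → withSign (withSign u w) (withSign w u) = u := by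
    intro u w hu hw
    unfold withSign; split_ifs <;> omega
  by_cases h1 : p = i
  · subst h1; rw [swapAbs_left, swapAbs_left, swapAbs_right hik, key _ _ hi hk]
  by_cases h2 : p = k
  · subst h2; rw [swapAbs_right hik, swapAbs_left, swapAbs_right hik, key _ _ hk hi]
  rw [swapAbs_of_ne h1 h2, swapAbs_of_ne h1 h2]

theorem swapAbs_comm {e : ℕ → ℤ} {i k i' k' : ℕ} (h1 : i ≠ i') (h2 : i ≠ k') (h3 : k ≠ i')
    (h4 : k ≠ k') : swapAbs (swapAbs e i k) i' k' = swapAbs (swapAbs e i' k') i k := by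
  funext p
  by_cases p = i <;> by_cases p = k <;> by_cases p = i' <;> by_cases p = k' <;>
    simp_all [swapAbs]
  all_goals grind

/-! ### Chains of exchanges -/

open Classical in
/-- A chain of exchanges: exchange the absolute values at the places `i` and `k`; as long as the
exchanged entries have the same sign and the absolute values at the two preceding places are
consecutive, go on with those places, but for at most `d` further exchanges. -/
noncomputable def chain : (ℕ → ℤ) → ℕ → ℕ → ℕ → ℕ → ℤ
  | e, i, k, 0 => swapAbs e i k
  | e, i, k, d + 1 =>
    if SameSign (e i) (e k) ∧ Adj (e (i - 1)) (e (k - 1)) then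
      chain (swapAbs e i k) (i - 1) (k - 1) d
    else swapAbs e i k

theorem chain_of_ne {i k d : ℕ} {e : ℕ → ℤ} {p : ℕ} (hp : p < i - d ∨ i < p)
    (hp' : p < k - d ∨ k < p) : chain e i k d p = e p := by
  induction d generalizing e i k with
  | zero => rw [chain, swapAbs_of_ne (by omega) (by omega)]
  | succ d ih =>
    rw [chain]
    split_ifs
    · rw [ih (by omega) (by omega), swapAbs_of_ne (by omega) (by omega)]
    · rw [swapAbs_of_ne (by omega) (by omega)]

theorem chain_swapAbs_comm {i k d : ℕ} {e : ℕ → ℤ} {p q : ℕ} (hd : d ≤ i) (hik : i + d < k)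
    (h1 : p < i - d ∨ i < p) (h2 : p < k - d ∨ k < p) (h3 : q < i - d ∨ i < q)
    (h4 : q < k - d ∨ k < q) :
    chain (swapAbs e p q) i k d = swapAbs (chain e i k d) p q := by
  induction d generalizing e i k with
  | zero => rw [chain, chain, swapAbs_comm] <;> omega
  | succ d ih =>
    rw [chain, chain]
    have e1 : swapAbs e p q i = e i := swapAbs_of_ne (by omega) (by omega)
    have e2 : swapAbs e p q k = e k := swapAbs_of_ne (by omega) (by omega)
    have e3 : swapAbs e p q (i - 1) = e (i - 1) := swapAbs_of_ne (by omega) (by omega)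
    have e4 : swapAbs e p q (k - 1) = e (k - 1) := swapAbs_of_ne (by omega) (by omega)
    rw [e1, e2, e3, e4]
    have e5 : swapAbs (swapAbs e p q) i k = swapAbs (swapAbs e i k) p q := by
      rw [swapAbs_comm] <;> omega
    split_ifs
    · rw [e5, ih] <;> omega
    · exact e5

/-- The absolute values after the first exchange of a chain are permanent. -/
theorem natAbs_chain {i k d : ℕ} {e : ℕ → ℤ} (hd : d ≤ i) (hik : i + d < k) :
    (chain e i k d i).natAbs = (e k).natAbs ∧ (chain e i k d k).natAbs = (e i).natAbs := by
  cases d with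
  | zero => rw [chain, natAbs_swapAbs_left, natAbs_swapAbs_right]; exact ⟨rfl, rfl⟩
  | succ d =>
    rw [chain]
    split_ifs
    · rw [chain_of_ne (by omega) (by omega), chain_of_ne (by omega) (by omega),
        natAbs_swapAbs_left, natAbs_swapAbs_right]; exact ⟨rfl, rfl⟩
    · rw [natAbs_swapAbs_left, natAbs_swapAbs_right]; exact ⟨rfl, rfl⟩

theorem chain_first_neg {i k d : ℕ} {e : ℕ → ℤ} (hd : d ≤ i) (hik : i + d < k) (hi : e i ≠ 0)
    (hk : e k ≠ 0) : (chain e i k d i < 0 ↔ e i < 0) ∧ (chain e i k d k < 0 ↔ e k < 0) := by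
  have h0 : (swapAbs e i k i < 0 ↔ e i < 0) ∧ (swapAbs e i k k < 0 ↔ e k < 0) := by
    rw [swapAbs_left, swapAbs_right (by omega), withSign_neg hk, withSign_neg hi]
    exact ⟨Iff.rfl, Iff.rfl⟩
  cases d with
  | zero => rw [chain]; exact h0
  | succ d =>
    rw [chain]
    split_ifs
    · rw [chain_of_ne (by omega) (by omega), chain_of_ne (by omega) (by omega)]
      exact h0
    · exact h0

/-- A chain of exchanges is an involution, since the pairs of places that take part in it can be
read off from the signs and from the pairs of absolute values at those places. -/
theorem chain_chain {i k d : ℕ} {e : ℕ → ℤ} (hd : d ≤ i) (hik : i + d < k)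
    (h0 : ∀ p ≤ k, e p ≠ 0) : chain (chain e i k d) i k d = e := by
  induction d generalizing e i k with
  | zero => exact swapAbs_swapAbs (by omega) (h0 _ (by omega)) (h0 _ le_rfl)
  | succ d ih =>
    have hi := h0 i (by omega)
    have hk := h0 k le_rfl
    have hsw : ∀ p ≤ k, swapAbs e i k p ≠ 0 := by
      intro p hp
      have := h0 p hp
      unfold swapAbs withSign
      split_ifs <;> omega
    have hneg := chain_first_neg hd hik hi hk
    have hss : SameSign (chain e i k (d + 1) i) (chain e i k (d + 1) k) ↔
        SameSign (e i) (e k) := by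
      unfold SameSign; rw [hneg.1, hneg.2]
    by_cases hc : SameSign (e i) (e k) ∧ Adj (e (i - 1)) (e (k - 1))
    · have h1 : chain e i k (d + 1) = chain (swapAbs e i k) (i - 1) (k - 1) d := by
        rw [chain, if_pos hc]
      have h2 := natAbs_chain (e := swapAbs e i k) (i := i - 1) (k := k - 1) (d := d)
        (by omega) (by omega)
      rw [← h1, swapAbs_of_ne (p := k - 1) (by omega) (by omega),
        swapAbs_of_ne (p := i - 1) (by omega) (by omega)] at h2
      have hc' : SameSign (chain e i k (d + 1) i) (chain e i k (d + 1) k) ∧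
          Adj (chain e i k (d + 1) (i - 1)) (chain e i k (d + 1) (k - 1)) := by
        refine ⟨hss.2 hc.1, ?_⟩
        have := hc.2
        unfold Adj at this ⊢
        omega
      conv_lhs => rw [chain]
      rw [if_pos hc', h1, ← chain_swapAbs_comm (by omega) (by omega) (by omega) (by omega)
        (by omega) (by omega), swapAbs_swapAbs (by omega) hi hk]
      exact ih (by omega) (by omega) (fun p hp => h0 p (by omega))
    · have h1 : chain e i k (d + 1) = swapAbs e i k := by
        rw [chain, if_neg hc]
      have hc' : ¬ (SameSign (chain e i k (d + 1) i) (chain e i k (d + 1) k) ∧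
          Adj (chain e i k (d + 1) (i - 1)) (chain e i k (d + 1) (k - 1))) := by
        rw [hss, h1, swapAbs_of_ne (p := k - 1) (by omega) (by omega),
          swapAbs_of_ne (p := i - 1) (by omega) (by omega)]
        exact hc
      conv_lhs => rw [chain]
      rw [if_neg hc', h1, swapAbs_swapAbs (by omega) hi hk]

/-! ### Closing one cycle -/

/-- The successor function on places when the cycles on the places `< a` have been closed, and the
places from `a` on still form one long cycle through the last place; the next cycle to be closed
occupies the places `a, …, z`. -/
structure Frame (n : ℕ) where
  a : ℕ
  z : ℕ
  nx : ℕ → ℕ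
  le : a ≤ z
  lt : z < n
  nx_of_le : ∀ p, a ≤ p → nx p = p + 1
  nx_lt : ∀ p, p < a → nx p < a
  nx_inj : ∀ p q, p < a → q < a → nx p = nx q → p = q

/-- The successor function after the cycle on the places `a, …, z` has been closed. -/
def Frame.cl {n : ℕ} (F : Frame n) (p : ℕ) : ℕ := if p = F.z then F.a else F.nx p

/-- The relative order that a permutation with descent set `D` has at the adjacent positions `p` and
`q`: `True` if the value at `p` is the smaller one. -/
def Target (D : Finset ℕ) (p q : ℕ) : Prop := if p < q then p ∉ D else q ∈ D

/-- If the positions `|e p|` and `|e q|` are adjacent, then the values there (the entries at the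
places `u p` and `u q`) are in the order prescribed by `D`. -/
def Ok (D : Finset ℕ) (u : ℕ → ℕ) (e : ℕ → ℤ) (p q : ℕ) : Prop :=
  Adj (e p) (e q) → (e (u p) < e (u q) ↔ Target D (e p).natAbs (e q).natAbs)

/-- The value at position `1` is not less than `-1`. -/
def AtLeastNegOne (n : ℕ) (u : ℕ → ℕ) (e : ℕ → ℤ) : Prop :=
  ∀ p < n, (e p).natAbs = 1 → -1 ≤ e (u p)

theorem target_symm {D : Finset ℕ} {p q : ℕ} (h : p ≠ q) : Target D q p ↔ ¬ Target D p q := by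
  unfold Target
  rcases lt_or_gt_of_ne h with h | h
  · rw [if_pos h, if_neg (by omega), not_not]
  · rw [if_pos h, if_neg (by omega)]

theorem Adj.ne {u w : ℤ} (h : Adj u w) : u.natAbs ≠ w.natAbs := by unfold Adj at h; omega

section Frame

variable {n : ℕ} {F : Frame n} {D : Finset ℕ} {e : ℕ → ℤ}

theorem Frame.cl_z : F.cl F.z = F.a := by simp [Frame.cl]

theorem Frame.cl_of_ne {p : ℕ} (h : p ≠ F.z) : F.cl p = F.nx p := by simp [Frame.cl, h]

theorem Frame.cl_succ {p : ℕ} (h : F.a ≤ p) (h' : p ≠ F.z) : F.cl p = p + 1 := by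
  rw [F.cl_of_ne h', F.nx_of_le p h]

theorem Frame.cl_le {p : ℕ} (h : p ≤ F.z) : F.cl p ≤ F.z := by
  have h0 := F.le
  by_cases h1 : p = F.z
  · subst h1; rw [F.cl_z]; exact F.le
  by_cases h2 : F.a ≤ p
  · rw [F.cl_succ h2 h1]; omega
  · rw [F.cl_of_ne h1]; have := F.nx_lt p (by omega); omega

theorem Frame.cl_lt {p : ℕ} (h : p < F.a) : F.cl p < F.a := by
  have h0 := F.le
  rw [F.cl_of_ne (by omega)]; exact F.nx_lt p h

theorem Frame.cl_le_n {p : ℕ} (h : p < n) : F.cl p ≤ n := by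
  have h0 := F.lt
  by_cases h1 : p ≤ F.z
  · have := F.cl_le h1; omega
  · have := F.le
    rw [F.cl_succ (by omega) (by omega)]; omega

theorem Frame.cl_inj {p q : ℕ} (h : F.cl p = F.cl q) : p = q := by
  have h0 := F.le
  have key : ∀ p, p < F.a ∧ F.cl p < F.a ∧ F.cl p = F.nx p ∨ p = F.z ∧ F.cl p = F.a ∨
      p ≠ F.z ∧ F.a ≤ p ∧ F.cl p = p + 1 := by
    intro p
    by_cases h1 : p < F.a
    · exact Or.inl ⟨h1, F.cl_lt h1, F.cl_of_ne (by omega)⟩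
    by_cases h2 : p = F.z
    · subst h2; exact Or.inr (Or.inl ⟨rfl, F.cl_z⟩)
    exact Or.inr (Or.inr ⟨h2, by omega, F.cl_succ (by omega) h2⟩)
  rcases key p with ⟨h1, h2, h3⟩ | ⟨h1, h2⟩ | ⟨h1, h2, h3⟩ <;>
  rcases key q with ⟨h4, h5, h6⟩ | ⟨h4, h5⟩ | ⟨h4, h5, h6⟩ <;>
  first
  | omega
  | exact F.nx_inj p q h1 h4 (by omega)

theorem IsLabeling.ok_symm (h : IsLabeling n e) {p q : ℕ} (hp : p < n) (hq : q < n)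
    (hok : Ok D F.cl e p q) : Ok D F.cl e q p := by
  intro hadj
  have h1 := hok hadj.symm
  rw [target_symm hadj.symm.ne, ← h1, not_lt, le_iff_lt_or_eq, or_iff_left]
  intro h2
  have := F.cl_inj (h.inj _ _ (F.cl_le_n hq) (F.cl_le_n hp) (congrArg Int.natAbs h2))
  subst this
  exact hadj.ne rfl

/-- The entry at the place `a` is the largest one on the places up to `z`. -/
def HeadMax (F : Frame n) (e : ℕ → ℤ) : Prop := ∀ p ≤ F.z, p ≠ F.a → e p < e F.a

theorem HeadMax.le (h : HeadMax F e) {p : ℕ} (hp : p ≤ F.z) : e p ≤ e F.a := by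
  by_cases h1 : p = F.a
  · rw [h1]
  · exact (h p hp h1).le

/-- The position with absolute value `r` compares as prescribed with a position `|e z|` holding the
entry at the place `w`. -/
def VirtualOk (D : Finset ℕ) (F : Frame n) (e : ℕ → ℤ) (w : ℕ) (r : ℤ) : Prop :=
  ∀ q < n, ((e q).natAbs : ℤ) = r →
    (e w < e (F.cl q) ↔ Target D (e F.z).natAbs (e q).natAbs)

/-- What a chain of exchanges, started at the places `z` and `k₀`, preserves: the relative order
of all entries other than the exchanged ones, and the signs. The exchanged places are at the same
distance from `z` and from `k₀`, hence the condition in `cross`. Values larger than `e (z + 1)` stay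
at their positions, by `big`. -/
structure ChainOrder (F : Frame n) (k₀ : ℕ) (e f : ℕ → ℤ) : Prop where
  lab : IsLabeling n f
  neg : ∀ p, f p < 0 ↔ e p < 0
  low : ∀ p q, p ≤ F.z → q ≤ F.z → (f p < f q ↔ e p < e q)
  high : ∀ p q, F.z < p → p ≤ n → F.z < q → q ≤ n → (f p < f q ↔ e p < e q)
  cross : ∀ p q, p ≤ F.z → F.z < q → q ≤ n → q + F.z ≠ p + k₀ →
    (f p < f q ↔ e p < e q) ∧ (f q < f p ↔ e q < e p)
  head : f F.a < f (F.z + 1)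
  big : ∀ p, F.z < p → p < n → f (F.z + 1) < f (p + 1) → f p = e p
  one : AtLeastNegOne n F.cl f ↔ AtLeastNegOne n F.cl e

theorem ChainOrder.trans {k₀ : ℕ} {e f g : ℕ → ℤ} (h : ChainOrder F k₀ e f)
    (h' : ChainOrder F k₀ f g) : ChainOrder F k₀ e g where
  lab := h'.lab
  neg p := (h'.neg p).trans (h.neg p)
  low p q hp hq := (h'.low p q hp hq).trans (h.low p q hp hq)
  high p q hp hp' hq hq' := (h'.high p q hp hp' hq hq').trans (h.high p q hp hp' hq hq')
  cross p q hp hq hq' hne := ⟨(h'.cross p q hp hq hq' hne).1.trans (h.cross p q hp hq hq' hne).1,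
    (h'.cross p q hp hq hq' hne).2.trans (h.cross p q hp hq hq' hne).2⟩
  head := h'.head
  big p hp hp' hlt := by
    have := F.lt
    rw [h'.big p hp hp' hlt]
    exact h.big p hp hp' ((h'.high _ _ (by omega) (by omega) (by omega) (by omega)).1 hlt)
  one := h'.one.trans h.one

/-- What a single exchange inside a chain preserves. -/
theorem chainOrder_swapAbs {k₀ i k : ℕ} (hl : IsLabeling n e) (hai : F.a ≤ i)
    (hiz : i ≤ F.z) (hzk : F.z < k) (hkk : k + F.z = i + k₀) (hk : k < n)
    (hadj : Adj (e i) (e k)) (h1 : e F.a < e (k₀ + 1)) (h2 : e (k₀ + 1) < e (F.z + 1))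
    (hbig : e (k + 1) < e (F.z + 1))
    (hone : AtLeastNegOne n F.cl (swapAbs e i k) ↔ AtLeastNegOne n F.cl e) :
    ChainOrder F k₀ e (swapAbs e i k) := by
  have hz := F.lt
  have haz := F.le
  have hi : i < n := by omega
  have hhigh : ∀ p q, F.z < p → p ≤ n → F.z < q → q ≤ n →
      (swapAbs e i k p < swapAbs e i k q ↔ e p < e q) := by
    intro p q hp hp' hq hq'
    exact hl.swapAbs_lt hi hk hadj hp' hq' (fun _ => by omega)
  refine ⟨hl.swapAbs hi hk, hl.swapAbs_neg hi.le hk.le, ?_, hhigh, ?_, ?_, ?_, hone⟩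
  · intro p q hp hq
    exact hl.swapAbs_lt hi hk hadj (by omega) (by omega) (fun _ => by omega)
  · intro p q hp hq hq' hne
    exact ⟨hl.swapAbs_lt hi hk hadj (by omega) (by omega) (fun _ => by omega),
      hl.swapAbs_lt hi hk hadj (by omega) (by omega) (fun _ => by omega)⟩
  · refine (hl.swapAbs_lt hi hk hadj (by omega) (by omega) ?_).2 (h1.trans h2)
    -- consecutive entries of the same sign leave no room for the entry at the place `k₀ + 1`
    intro hs
    refine ⟨?_, by omega⟩
    rintro ⟨h3, h4⟩
    have e1 : e F.a = e i := by rw [h3]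
    have e2 : e (F.z + 1) = e k := by rw [h4]
    unfold SameSign at hs
    unfold Adj at hadj
    omega
  · intro p hp hp' hlt
    by_cases hpk : p = k
    · subst hpk
      rw [hhigh _ _ (by omega) (by omega) (by omega) (by omega)] at hlt
      omega
    · exact swapAbs_of_ne (by omega) hpk

/-- The state of a chain just before the exchange at the places `i` and `k`: the pair of positions
`|e i|, |e k|` is wrong, and all other pairs not involving `|e z|` are right. The values at these
two positions are the entries that have just been exchanged, so they are consecutive (`near`,
`near'`). The only position that may be wrong relative to `|e z|` is `|e z| + δ`, and the position
`|e z| - δ` that the last entry of the cycle has left is now at the place `k₀`. -/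
structure ChainState (D : Finset ℕ) (F : Frame n) (δ : ℤ) (k₀ : ℕ) (e : ℕ → ℤ) (i k : ℕ) :
    Prop where
  lab : IsLabeling n e
  dir : δ = 1 ∨ δ = -1
  max : HeadMax F e
  lo : F.a ≤ i
  hi : i < F.z
  hk : F.z < k
  diag : k + F.z = i + k₀
  k₀_lt : k₀ < n
  adj : Adj (e i) (e k)
  btw : e F.a < e (k₀ + 1)
  btw' : e (k₀ + 1) < e (F.z + 1)
  wrong : ¬ Ok D F.cl e i k
  near : Adj (e (i + 1)) (e (k + 1))
  near' : SameSign (e (i + 1)) (e (k + 1))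
  back : ((e k₀).natAbs : ℤ) = (e F.z).natAbs - δ
  ok : ∀ p q, p < n → q < n → p ≠ F.z → q ≠ F.z → ¬ (p = i ∧ q = k) → ¬ (p = k ∧ q = i) →
    Ok D F.cl e p q
  ok_z : ∀ q < n, ((e q).natAbs : ℤ) ≠ (e F.z).natAbs + δ → Ok D F.cl e F.z q
  virt : VirtualOk D F e (k₀ + 1) ((e F.z).natAbs + δ)

/-- The state after a chain of exchanges. -/
structure ChainEnd (D : Finset ℕ) (F : Frame n) (δ : ℤ) (k₀ : ℕ) (e : ℕ → ℤ) : Prop where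
  lab : IsLabeling n e
  back : ((e k₀).natAbs : ℤ) = (e F.z).natAbs - δ
  ok : ∀ p q, p < n → q < n → p ≠ F.z → q ≠ F.z → Ok D F.cl e p q
  ok_z : ∀ q < n, ((e q).natAbs : ℤ) ≠ (e F.z).natAbs + δ → Ok D F.cl e F.z q
  virt : VirtualOk D F e (k₀ + 1) ((e F.z).natAbs + δ)

end Frame

section Frame

variable {n : ℕ} {F : Frame n} {D : Finset ℕ} {e : ℕ → ℤ}

/-- An exchange does not affect pairs of other positions whose values are not the exchanged
entries. -/
theorem ok_swapAbs_of_ne (hl : IsLabeling n e) {i k p q : ℕ} (hi : i < n) (hk : k < n)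
    (hadj : Adj (e i) (e k)) (hp : p < n) (hq : q < n) (hpi : p ≠ i) (hpk : p ≠ k) (hqi : q ≠ i)
    (hqk : q ≠ k) (hok : Ok D F.cl e p q)
    (hne : SameSign (e i) (e k) → ¬ (F.cl p = i ∧ F.cl q = k) ∧ ¬ (F.cl p = k ∧ F.cl q = i)) :
    Ok D F.cl (swapAbs e i k) p q := by
  intro h
  rw [swapAbs_of_ne hpi hpk, swapAbs_of_ne hqi hqk] at h ⊢
  rw [hl.swapAbs_lt hi hk hadj (F.cl_le_n hp) (F.cl_le_n hq) hne]
  exact hok h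

/-- If the exchanged entries have the same sign, then the pair of positions that hold them becomes
wrong. -/
theorem not_ok_swapAbs (hl : IsLabeling n e) {i k p q : ℕ} (hi : i < n) (hk : k < n)
    (hadj : Adj (e i) (e k)) (hs : SameSign (e i) (e k)) (hp : F.cl p = i) (hq : F.cl q = k)
    (hpi : p ≠ i) (hpk : p ≠ k) (hqi : q ≠ i) (hqk : q ≠ k) (hpq : Adj (e p) (e q))
    (hok : Ok D F.cl e p q) : ¬ Ok D F.cl (swapAbs e i k) p q := by
  intro h
  have h1 := hok hpq
  unfold Ok at h
  rw [swapAbs_of_ne hpi hpk, swapAbs_of_ne hqi hqk, hp, hq,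
    (hl.swapAbs_lt_flip hi hk hadj hs).1] at h
  rw [hp, hq] at h1
  have h2 := h1.trans (h hpq).symm
  have : e i ≠ e k := fun h' => hadj.ne (congrArg _ h')
  omega

namespace ChainState

variable {δ : ℤ} {k₀ i k : ℕ}

theorem k_le (h : ChainState D F δ k₀ e i k) : k < k₀ := by
  have := h.diag; have := h.hi; omega

theorem cl_i (h : ChainState D F δ k₀ e i k) : F.cl i = i + 1 :=
  F.cl_succ h.lo h.hi.ne

theorem cl_k (h : ChainState D F δ k₀ e i k) : F.cl k = k + 1 :=
  F.cl_succ (by have := F.le; have := h.hk; omega) h.hk.ne'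

/-- Neighbouring values compare in the same way with every other entry. -/
theorem near_lt (h : ChainState D F δ k₀ e i k) {q : ℕ} (hq : q ≤ n) (hqi : q ≠ i + 1)
    (hqk : q ≠ k + 1) : (e (i + 1) < e q ↔ e (k + 1) < e q) ∧
      (e q < e (i + 1) ↔ e q < e (k + 1)) := by
  have h1 := h.near
  have h2 := h.near'
  have hz := F.lt
  have hi := h.hi
  have hk := h.k_le
  have hk₀ := h.k₀_lt
  have h3 : (e q).natAbs ≠ (e (i + 1)).natAbs :=
    fun h' => hqi (h.lab.inj _ _ hq (by omega) h')
  have h4 : (e q).natAbs ≠ (e (k + 1)).natAbs :=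
    fun h' => hqk (h.lab.inj _ _ hq (by omega) h')
  unfold Adj at h1
  unfold SameSign at h2
  omega

/-- An exchange inside a chain does not move the value at position `1` across `-1`. -/
theorem one_iff (h : ChainState D F δ k₀ e i k) :
    AtLeastNegOne n F.cl (swapAbs e i k) ↔ AtLeastNegOne n F.cl e := by
  have hz := F.lt
  have hi := h.hi
  have hk := h.hk
  have hk' := h.k_le
  have hk₀ := h.k₀_lt
  have hadj := h.adj
  have hnear := h.near
  have hnear' := h.near'
  have hik : i ≠ k := by omega
  have hi1 : i < n := by omega
  have hk1 : k < n := by omega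
  have hl' := h.lab.swapAbs hi1 hk1
  -- the values at the positions `|e i|` and `|e k|` are neither `±1` nor `±2` if these positions
  -- are `1` and `2`
  have d1 : (e (i + 1)).natAbs ≠ (e i).natAbs :=
    fun h' => absurd (h.lab.inj _ _ (by omega) (by omega) h') (by omega)
  have d2 : (e (i + 1)).natAbs ≠ (e k).natAbs :=
    fun h' => absurd (h.lab.inj _ _ (by omega) (by omega) h') (by omega)
  have d3 : (e (k + 1)).natAbs ≠ (e i).natAbs :=
    fun h' => absurd (h.lab.inj _ _ (by omega) (by omega) h') (by omega)
  have d4 : (e (k + 1)).natAbs ≠ (e k).natAbs :=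
    fun h' => absurd (h.lab.inj _ _ (by omega) (by omega) h') (by omega)
  have z1 := h.lab.bd i hi1
  have z2 := h.lab.bd k hk1
  have z3 := h.lab.ne_zero (p := i + 1) (by omega)
  have z4 := h.lab.ne_zero (p := k + 1) (by omega)
  have si : swapAbs e i k (i + 1) = e (i + 1) := swapAbs_of_ne (by omega) (by omega)
  have sk : swapAbs e i k (k + 1) = e (k + 1) := swapAbs_of_ne (by omega) (by omega)
  have key : ∀ f : ℕ → ℤ, IsLabeling n f → ∀ p < n, (f p).natAbs = 1 →
      (AtLeastNegOne n F.cl f ↔ -1 ≤ f (F.cl p)) := by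
    intro f hf p hp hp1
    refine ⟨fun h' => h' p hp hp1, fun h' q hq hq1 => ?_⟩
    rw [hf.inj q p hq.le hp.le (hq1.trans hp1.symm)]
    exact h'
  unfold Adj at hadj hnear
  unfold SameSign at hnear'
  by_cases h1 : (e i).natAbs = 1
  · rw [key e h.lab i hi1 h1, key _ hl' k hk1 (by rw [natAbs_swapAbs_right, h1]), h.cl_i, h.cl_k,
      sk]
    omega
  by_cases h2 : (e k).natAbs = 1
  · rw [key e h.lab k hk1 h2, key _ hl' i hi1 (by rw [natAbs_swapAbs_left, h2]), h.cl_i, h.cl_k,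
      si]
    omega
  have h3 : ∀ p, -1 ≤ swapAbs e i k p ↔ -1 ≤ e p := by
    intro p
    unfold swapAbs withSign
    split_ifs <;> (try subst p) <;> omega
  constructor <;> intro h' p hp hp1
  · have hpi : p ≠ i := by rintro rfl; omega
    have hpk : p ≠ k := by rintro rfl; omega
    rw [← h3]
    exact h' p hp (by rwa [swapAbs_of_ne hpi hpk])
  · have hpi : p ≠ i := by rintro rfl; rw [natAbs_swapAbs_left] at hp1; omega
    have hpk : p ≠ k := by rintro rfl; rw [natAbs_swapAbs_right] at hp1; omega
    rw [swapAbs_of_ne hpi hpk] at hp1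
    rw [h3]
    exact h' p hp hp1

theorem order (h : ChainState D F δ k₀ e i k) : ChainOrder F k₀ e (swapAbs e i k) := by
  have hz := F.lt
  have hk := h.hk
  have hi := h.hi
  have hk' := h.k_le
  have hk₀ := h.k₀_lt
  have haz := F.le
  have hlo := h.lo
  refine chainOrder_swapAbs h.lab h.lo h.hi.le h.hk h.diag (by omega) h.adj h.btw h.btw' ?_
    h.one_iff
  -- `e (k + 1)` is next to `e (i + 1) ≤ e a`, whereas `e (k₀ + 1)` separates `e a` from `e (z + 1)`
  have h1 := (h.near_lt (q := k₀ + 1) (by omega) (by omega) (by omega)).1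
  have h2 := h.max.le (p := i + 1) (by omega)
  have h3 := h.btw
  have h4 := h.btw'
  omega

/-- After an exchange, at most the pair of the preceding places is wrong. -/
theorem ok_swapAbs (h : ChainState D F δ k₀ e i k) {p q : ℕ} (hp : p < n) (hq : q < n)
    (hpz : p ≠ F.z) (hqz : q ≠ F.z)
    (hne : F.a < i → SameSign (e i) (e k) →
      ¬ (p + 1 = i ∧ q + 1 = k) ∧ ¬ (p + 1 = k ∧ q + 1 = i)) :
    Ok D F.cl (swapAbs e i k) p q := by
  have hz := F.lt
  have hi := h.hi
  have hk := h.hk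
  have hk' := h.k_le
  have hk₀ := h.k₀_lt
  have haz := F.le
  have hlo := h.lo
  have hi1 : i < n := by omega
  have hk1 : k < n := by omega
  have hik : i ≠ k := by omega
  have hl' := h.lab.swapAbs hi1 hk1
  have si : swapAbs e i k (i + 1) = e (i + 1) := swapAbs_of_ne (by omega) (by omega)
  have sk : swapAbs e i k (k + 1) = e (k + 1) := swapAbs_of_ne (by omega) (by omega)
  -- The exchange reverses the order of the two values at the positions `|e i|` and `|e k|`.
  have okik : Ok D F.cl (swapAbs e i k) i k := by
    intro _
    have h2 := fun h' => h.wrong (fun _ => h')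
    rw [natAbs_swapAbs_left, natAbs_swapAbs_right, target_symm h.adj.ne]
    rw [h.cl_i, h.cl_k] at h2 ⊢
    rw [si, sk]
    tauto
  -- A third position compares with the new value at `|e k|` as with the old one, which was right.
  have oki : ∀ q < n, q ≠ F.z → q ≠ i → q ≠ k → Ok D F.cl (swapAbs e i k) i q := by
    intro q hq hqz hqi hqk hadj'
    have hq1 := F.cl_le_n hq
    have hcl1 : F.cl q ≠ i + 1 := by rw [← h.cl_i]; exact fun h' => hqi (F.cl_inj h')
    have hcl2 : F.cl q ≠ k + 1 := by rw [← h.cl_k]; exact fun h' => hqk (F.cl_inj h')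
    rw [h.cl_i, h.lab.swapAbs_lt hi1 hk1 h.adj (by omega) hq1 (fun _ => by omega),
      (h.near_lt hq1 hcl1 hcl2).1, natAbs_swapAbs_left, swapAbs_of_ne hqi hqk, ← h.cl_k]
    have h1 := h.ok k q hk1 hq hk.ne' hqz (by omega) (by omega)
    refine h1 ?_
    unfold Adj at hadj' ⊢
    rwa [natAbs_swapAbs_left, swapAbs_of_ne hqi hqk] at hadj'
  have okk : ∀ q < n, q ≠ F.z → q ≠ i → q ≠ k → Ok D F.cl (swapAbs e i k) k q := by
    intro q hq hqz hqi hqk hadj'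
    have hq1 := F.cl_le_n hq
    have hcl1 : F.cl q ≠ i + 1 := by rw [← h.cl_i]; exact fun h' => hqi (F.cl_inj h')
    have hcl2 : F.cl q ≠ k + 1 := by rw [← h.cl_k]; exact fun h' => hqk (F.cl_inj h')
    rw [h.cl_k, h.lab.swapAbs_lt hi1 hk1 h.adj (by omega) hq1 (fun _ => by omega),
      ← (h.near_lt hq1 hcl1 hcl2).1, natAbs_swapAbs_right, swapAbs_of_ne hqi hqk, ← h.cl_i]
    have h1 := h.ok i q hi1 hq hi.ne hqz (by omega) (by omega)
    refine h1 ?_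
    unfold Adj at hadj' ⊢
    rwa [natAbs_swapAbs_right, swapAbs_of_ne hqi hqk] at hadj'
  by_cases h1 : p = i
  · subst h1
    by_cases h2 : q = k
    · subst h2; exact okik
    by_cases h3 : q = p
    · subst h3; exact fun h' => absurd rfl h'.ne
    exact oki q hq hqz h3 h2
  by_cases h2 : p = k
  · subst h2
    by_cases h3 : q = i
    · subst h3; exact hl'.ok_symm hi1 hk1 okik
    by_cases h4 : q = p
    · subst h4; exact fun h' => absurd rfl h'.ne
    exact okk q hq hqz h3 h4
  by_cases h3 : q = i
  · subst h3; exact hl'.ok_symm hi1 hp (oki p hp hpz h1 h2)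
  by_cases h4 : q = k
  · subst h4; exact hl'.ok_symm hk1 hp (okk p hp hpz h1 h2)
  refine ok_swapAbs_of_ne h.lab hi1 hk1 h.adj hp hq h1 h2 h3 h4
    (h.ok p q hp hq hpz hqz (by omega) (by omega)) ?_
  have key : ∀ p, p ≠ F.z → (F.cl p = i → F.a < i ∧ p + 1 = i) ∧ (F.cl p = k → p + 1 = k) := by
    intro p hpz
    by_cases hpa : p < F.a
    · have := F.cl_lt hpa; omega
    · rw [F.cl_succ (by omega) hpz]; omega
  have k1 := key p hpz
  have k2 := key q hqz
  intro hs
  constructor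
  · rintro ⟨h5, h6⟩
    exact (hne (k1.1 h5).1 hs).1 ⟨(k1.1 h5).2, k2.2 h6⟩
  · rintro ⟨h5, h6⟩
    exact (hne (k2.1 h6).1 hs).2 ⟨k1.2 h5, (k2.1 h6).2⟩

/-- An exchange inside a chain makes no further position wrong relative to `|e z|`. -/
theorem ok_z_swapAbs (h : ChainState D F δ k₀ e i k) {q : ℕ} (hq : q < n)
    (hne : ((swapAbs e i k q).natAbs : ℤ) ≠ (swapAbs e i k F.z).natAbs + δ) :
    Ok D F.cl (swapAbs e i k) F.z q := by
  have hz := F.lt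
  have hi := h.hi
  have hk := h.hk
  have hk' := h.k_le
  have hk₀ := h.k₀_lt
  have haz := F.le
  have hlo := h.lo
  have hi1 : i < n := by omega
  have hk1 : k < n := by omega
  have hl' := h.lab.swapAbs hi1 hk1
  have sz : swapAbs e i k F.z = e F.z := swapAbs_of_ne (by omega) (by omega)
  rw [sz] at hne
  intro hadj'
  have hcl1 : F.cl F.z ≠ i + 1 := by rw [← h.cl_i]; exact fun h' => hi.ne' (F.cl_inj h')
  have hcl2 : F.cl F.z ≠ k + 1 := by rw [← h.cl_k]; exact fun h' => hk.ne (F.cl_inj h')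
  by_cases h1 : q = i
  · subst h1
    rw [natAbs_swapAbs_left] at hne
    unfold Adj at hadj'
    rw [natAbs_swapAbs_left, sz] at hadj'
    rw [natAbs_swapAbs_left, h.cl_i, sz, h.lab.swapAbs_lt hi1 hk1 h.adj (F.cl_le_n hz)
      (by omega) (fun _ => by omega), (h.near_lt (F.cl_le_n hz) hcl1 hcl2).2, ← h.cl_k]
    exact h.ok_z k hk1 hne hadj'
  by_cases h2 : q = k
  · subst h2
    rw [natAbs_swapAbs_right] at hne
    unfold Adj at hadj'
    rw [natAbs_swapAbs_right, sz] at hadj'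
    rw [natAbs_swapAbs_right, h.cl_k, sz, h.lab.swapAbs_lt hi1 hk1 h.adj (F.cl_le_n hz)
      (by omega) (fun _ => by omega), ← (h.near_lt (F.cl_le_n hz) hcl1 hcl2).2, ← h.cl_i]
    exact h.ok_z i hi1 hne hadj'
  rw [swapAbs_of_ne h1 h2] at hne
  refine ok_swapAbs_of_ne h.lab hi1 hk1 h.adj hz hq (by omega) (by omega) h1 h2 (h.ok_z q hq hne) ?_ hadj'
  rw [F.cl_z]
  intro _
  refine ⟨?_, by omega⟩
  -- the place `k - 1` is not the place `k₀` of the only other position next to `|e z|`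
  rintro ⟨h3, h4⟩
  have hq1 : q + 1 = k := by
    by_cases hqa : q < F.a
    · have := F.cl_lt hqa; omega
    by_cases hqz : q = F.z
    · subst hqz; rw [F.cl_z] at h4; omega
    · rw [F.cl_succ (by omega) hqz] at h4; omega
  unfold Adj at hadj'
  rw [sz, swapAbs_of_ne h1 h2] at hadj'
  have hb := h.back
  have hδ := h.dir
  have := h.lab.inj q k₀ hq.le hk₀.le
  omega

end ChainState

end Frame

section Frame

variable {n : ℕ} {F : Frame n} {D : Finset ℕ} {e : ℕ → ℤ} {δ : ℤ}

namespace ChainState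

variable {k₀ i k : ℕ}

theorem virt_swapAbs (h : ChainState D F δ k₀ e i k) :
    VirtualOk D F (swapAbs e i k) (k₀ + 1) ((swapAbs e i k F.z).natAbs + δ) := by
  have hz := F.lt
  have hi := h.hi
  have hk := h.hk
  have hk' := h.k_le
  have hk₀ := h.k₀_lt
  have haz := F.le
  have hlo := h.lo
  have hi1 : i < n := by omega
  have hk1 : k < n := by omega
  have sz : swapAbs e i k F.z = e F.z := swapAbs_of_ne (by omega) (by omega)
  rw [sz]
  intro q hq hqr
  rw [h.lab.swapAbs_lt hi1 hk1 h.adj (by omega) (F.cl_le_n hq) (fun _ => by omega), sz]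
  have hne := h.near_lt (q := k₀ + 1) (by omega) (by omega) (by omega)
  by_cases h1 : q = i
  · subst h1
    rw [natAbs_swapAbs_left] at hqr ⊢
    rw [h.cl_i, hne.2, ← h.cl_k]
    exact h.virt k hk1 hqr
  by_cases h2 : q = k
  · subst h2
    rw [natAbs_swapAbs_right] at hqr ⊢
    rw [h.cl_k, ← hne.2, ← h.cl_i]
    exact h.virt i hi1 hqr
  rw [swapAbs_of_ne h1 h2] at hqr ⊢
  exact h.virt q hq hqr

theorem back_swapAbs (h : ChainState D F δ k₀ e i k) :
    ((swapAbs e i k k₀).natAbs : ℤ) = (swapAbs e i k F.z).natAbs - δ := by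
  have hi := h.hi
  have hk := h.hk
  have hk' := h.k_le
  rw [swapAbs_of_ne (by omega) (by omega), swapAbs_of_ne (by omega) (by omega)]
  exact h.back

/-- An entry of the cycle to be closed and the first entry after that cycle are not consecutive. -/
theorem lt_pred (h : ChainState D F δ k₀ e i k) (hs : SameSign (e i) (e k)) (hai : F.a < i) :
    F.z < k - 1 := by
  have hk := h.hk
  have hi := h.hi
  by_contra hcon
  have hkz : k = F.z + 1 := by omega
  have h1 := h.max i hi.le hai.ne'
  have h2 := h.btw
  have h3 := h.btw'
  have h4 := h.adj
  rw [← hkz] at h3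
  unfold SameSign at hs
  unfold Adj at h4
  omega

/-- As long as the chain goes on, the exchange passes the defect on to the preceding places. -/
theorem next (h : ChainState D F δ k₀ e i k) (hai : F.a < i) (hs : SameSign (e i) (e k))
    (hadj : Adj (e (i - 1)) (e (k - 1))) :
    ChainState D F δ k₀ (swapAbs e i k) (i - 1) (k - 1) := by
  have hz := F.lt
  have hi := h.hi
  have hk := h.hk
  have hk' := h.k_le
  have hk₀ := h.k₀_lt
  have haz := F.le
  have hlo := h.lo
  have hi1 : i < n := by omega
  have hk1 : k < n := by omega
  have hkz := h.lt_pred hs hai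
  have hdiag := h.diag
  have ho := h.order
  have e1 : i - 1 + 1 = i := by omega
  have e2 : k - 1 + 1 = k := by omega
  have s1 : swapAbs e i k (i - 1) = e (i - 1) := swapAbs_of_ne (by omega) (by omega)
  have s2 : swapAbs e i k (k - 1) = e (k - 1) := swapAbs_of_ne (by omega) (by omega)
  exact
    { lab := ho.lab
      dir := h.dir
      max := fun p hp hpa => (ho.low _ _ hp haz).2 (h.max p hp hpa)
      lo := by omega
      hi := by omega
      hk := hkz
      diag := by omega
      k₀_lt := hk₀
      adj := by rw [s1, s2]; exact hadj
      btw := (ho.cross _ _ haz (by omega) (by omega) (by omega)).1.2 h.btw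
      btw' := (ho.high _ _ (by omega) (by omega) (by omega) (by omega)).2 h.btw'
      wrong := by
        refine not_swapAbs_ok h hai hs hadj hkz
      near := by
        have := h.adj
        unfold Adj at this ⊢
        rw [e1, e2, natAbs_swapAbs_left, natAbs_swapAbs_right]
        exact this.symm
      near' := by
        unfold SameSign at hs ⊢
        rw [e1, e2, ho.neg, ho.neg]
        exact hs
      back := h.back_swapAbs
      ok := fun p q hp hq hpz hqz h1 h2 => h.ok_swapAbs hp hq hpz hqz (fun _ _ => by omega)
      ok_z := fun q hq hne => h.ok_z_swapAbs hq hne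
      virt := h.virt_swapAbs }
where
  not_swapAbs_ok (h : ChainState D F δ k₀ e i k) (hai : F.a < i) (hs : SameSign (e i) (e k))
      (hadj : Adj (e (i - 1)) (e (k - 1))) (hkz : F.z < k - 1) :
      ¬ Ok D F.cl (swapAbs e i k) (i - 1) (k - 1) := by
    have hz := F.lt
    have hi := h.hi
    have hk' := h.k_le
    have hk₀ := h.k₀_lt
    have haz := F.le
    refine not_ok_swapAbs h.lab (by omega) (by omega) h.adj hs ?_ ?_ (by omega) (by omega)
      (by omega) (by omega) hadj ?_
    · rw [F.cl_succ (by omega) (by omega)]; omega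
    · rw [F.cl_succ (by omega) (by omega)]; omega
    · exact h.ok _ _ (by omega) (by omega) (by omega) (by omega) (by omega) (by omega)

theorem chainEnd (h : ChainState D F δ k₀ e i k)
    (hend : F.a < i → SameSign (e i) (e k) → ¬ Adj (e (i - 1)) (e (k - 1))) :
    ChainEnd D F δ k₀ (swapAbs e i k) where
  lab := h.order.lab
  back := h.back_swapAbs
  ok p q hp hq hpz hqz := by
    by_cases hc : F.a < i ∧ SameSign (e i) (e k) ∧
      ((p + 1 = i ∧ q + 1 = k) ∨ (p + 1 = k ∧ q + 1 = i))
    · have hi := h.hi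
      have hk := h.hk
      have hst := hend hc.1 hc.2.1
      intro hadj
      exfalso
      rw [swapAbs_of_ne (by omega) (by omega), swapAbs_of_ne (by omega) (by omega)] at hadj
      rcases hc.2.2 with ⟨h1, h2⟩ | ⟨h1, h2⟩
      · rw [show i - 1 = p by omega, show k - 1 = q by omega] at hst
        exact hst hadj
      · rw [show i - 1 = q by omega, show k - 1 = p by omega] at hst
        exact hst hadj.symm
    · refine h.ok_swapAbs hp hq hpz hqz ?_
      intro h1 h2
      constructor
      · exact fun h3 => hc ⟨h1, h2, Or.inl h3⟩
      · exact fun h3 => hc ⟨h1, h2, Or.inr h3⟩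
  ok_z q hq hne := h.ok_z_swapAbs hq hne
  virt := h.virt_swapAbs

theorem chain_spec (h : ChainState D F δ k₀ e i k) :
    ChainOrder F k₀ e (chain e i k (i - F.a)) ∧
      ChainEnd D F δ k₀ (chain e i k (i - F.a)) := by
  obtain ⟨d, hd⟩ : ∃ d, i - F.a = d := ⟨_, rfl⟩
  rw [hd]
  induction d generalizing e i k with
  | zero => exact ⟨h.order, h.chainEnd (by omega)⟩
  | succ d ih =>
    rw [CyclicDescents.chain]
    split_ifs with hc
    · have h1 := ih (h.next (by omega) hc.1 hc.2) (by omega)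
      exact ⟨h.order.trans h1.1, h1.2⟩
    · exact ⟨h.order, h.chainEnd fun _ h1 h2 => hc ⟨h1, h2⟩⟩

end ChainState

/-- The situation in which a chain of exchanges starts, at the places `z` and `k`: the pair of
positions `|e z|, |e k|` is wrong, the value at `|e k|` lies between `e a` and `e (z + 1)`, and it
would be right for the position `|e z|` with regard to the other neighbour of that position. -/
structure StartState (D : Finset ℕ) (F : Frame n) (δ : ℤ) (e : ℕ → ℤ) (k : ℕ) : Prop where
  lab : IsLabeling n e
  dir : δ = 1 ∨ δ = -1
  max : HeadMax F e
  hk : F.z < k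
  k_lt : k < n
  front : ((e k).natAbs : ℤ) = (e F.z).natAbs + δ
  btw : e F.a < e (k + 1)
  btw' : e (k + 1) < e (F.z + 1)
  wrong : ¬ Ok D F.cl e F.z k
  ok : ∀ p q, p < n → q < n → p ≠ F.z → q ≠ F.z → Ok D F.cl e p q
  back : VirtualOk D F e (k + 1) ((e F.z).natAbs - δ)

namespace StartState

variable {k : ℕ}

theorem adj (h : StartState D F δ e k) : Adj (e F.z) (e k) := by
  have h1 := h.dir
  have h2 := h.front
  unfold Adj
  omega

theorem cl_k (h : StartState D F δ e k) : F.cl k = k + 1 :=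
  F.cl_succ (by have := F.le; have := h.hk; omega) h.hk.ne'

/-- The first exchange of a chain does not move the value at position `1` across `-1`: one of the
two values involved is the largest entry of its cycle, and the other one is larger still. -/
theorem one_iff (h : StartState D F δ e k) :
    AtLeastNegOne n F.cl (swapAbs e F.z k) ↔ AtLeastNegOne n F.cl e := by
  have hz := F.lt
  have haz := F.le
  have hk := h.hk
  have hk1 := h.k_lt
  have hadj := h.adj
  have hl' := h.lab.swapAbs hz hk1
  have z1 := h.lab.bd _ hz
  have z2 := h.lab.bd k hk1
  have hm := h.max.le (p := F.z) le_rfl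
  have hm' : swapAbs e F.z k F.z ≤ swapAbs e F.z k F.a := by
    by_cases h1 : F.z = F.a
    · rw [← h1]
    · exact ((h.lab.swapAbs_lt hz hk1 h.adj hz.le (by omega) (fun _ => by omega)).2
        (h.max _ le_rfl h1)).le
  have hb := h.btw
  have sk : swapAbs e F.z k (k + 1) = e (k + 1) := swapAbs_of_ne (by omega) (by omega)
  have key : ∀ f : ℕ → ℤ, IsLabeling n f → ∀ p < n, (f p).natAbs = 1 →
      (AtLeastNegOne n F.cl f ↔ -1 ≤ f (F.cl p)) := by
    intro f hf p hp hp1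
    refine ⟨fun h' => h' p hp hp1, fun h' q hq hq1 => ?_⟩
    rw [hf.inj q p hq.le hp.le (hq1.trans hp1.symm)]
    exact h'
  unfold Adj at hadj
  by_cases h1 : (e F.z).natAbs = 1
  · rw [key e h.lab _ hz h1, key _ hl' k hk1 (by rw [natAbs_swapAbs_right, h1]), F.cl_z, h.cl_k,
      sk]
    omega
  by_cases h2 : (e k).natAbs = 1
  · have h3 := natAbs_swapAbs_left e F.z k
    rw [key e h.lab k hk1 h2, key _ hl' _ hz (by rw [natAbs_swapAbs_left, h2]), F.cl_z, h.cl_k]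
    omega
  have h3 : ∀ p, -1 ≤ swapAbs e F.z k p ↔ -1 ≤ e p := by
    intro p
    by_cases hpz : p = F.z
    · rw [hpz, swapAbs_left]
      unfold withSign; split_ifs <;> omega
    by_cases hpk : p = k
    · rw [hpk, swapAbs_right hk.ne]
      unfold withSign; split_ifs <;> omega
    rw [swapAbs_of_ne hpz hpk]
  constructor <;> intro h' p hp hp1
  · have hpi : p ≠ F.z := by rintro rfl; omega
    have hpk : p ≠ k := by rintro rfl; omega
    rw [← h3]
    exact h' p hp (by rwa [swapAbs_of_ne hpi hpk])
  · have hpi : p ≠ F.z := by rintro rfl; rw [natAbs_swapAbs_left] at hp1; omega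
    have hpk : p ≠ k := by rintro rfl; rw [natAbs_swapAbs_right] at hp1; omega
    rw [swapAbs_of_ne hpi hpk] at hp1
    rw [h3]
    exact h' p hp hp1

theorem order (h : StartState D F δ e k) : ChainOrder F k e (swapAbs e F.z k) :=
  chainOrder_swapAbs h.lab F.le le_rfl h.hk (by omega) h.k_lt h.adj h.btw h.btw' h.btw' h.one_iff

/-- After the first exchange of a chain, at most the pair of the preceding places is wrong among
the pairs not involving `|e z|`. -/
theorem ok_swapAbs (h : StartState D F δ e k) {p q : ℕ} (hp : p < n) (hq : q < n)
    (hpz : p ≠ F.z) (hqz : q ≠ F.z)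
    (hne : F.a < F.z → SameSign (e F.z) (e k) →
      ¬ (p + 1 = F.z ∧ q + 1 = k) ∧ ¬ (p + 1 = k ∧ q + 1 = F.z)) :
    Ok D F.cl (swapAbs e F.z k) p q := by
  have hz := F.lt
  have hk := h.hk
  have haz := F.le
  have hk1 := h.k_lt
  have hl' := h.lab.swapAbs hz hk1
  have okk : ∀ q < n, q ≠ F.z → q ≠ k → Ok D F.cl (swapAbs e F.z k) k q := by
    intro q hq hqz hqk hadj'
    have hfr := h.front
    have hqk' : (e q).natAbs ≠ (e k).natAbs := fun h' => hqk (h.lab.inj _ _ hq.le hk1.le h')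
    unfold Adj at hadj'
    rw [natAbs_swapAbs_right, swapAbs_of_ne hqz hqk] at hadj'
    rw [h.cl_k, h.lab.swapAbs_lt hz hk1 h.adj (by omega) (F.cl_le_n hq) (fun _ => by omega),
      natAbs_swapAbs_right, swapAbs_of_ne hqz hqk]
    have hδ := h.dir
    exact h.back q hq (by omega)
  by_cases h1 : p = k
  · subst h1
    by_cases h2 : q = p
    · subst h2; exact fun h' => absurd rfl h'.ne
    exact okk q hq hqz h2
  by_cases h2 : q = k
  · subst h2
    exact hl'.ok_symm hk1 hp (okk p hp hpz h1)
  refine ok_swapAbs_of_ne h.lab hz hk1 h.adj hp hq hpz h1 hqz h2 (h.ok p q hp hq hpz hqz) ?_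
  have key : ∀ p, p ≠ F.z → (F.cl p = F.z → F.a < F.z ∧ p + 1 = F.z) ∧
      (F.cl p = k → p + 1 = k) := by
    intro p hpz
    by_cases hpa : p < F.a
    · have := F.cl_lt hpa; omega
    · rw [F.cl_succ (by omega) hpz]; omega
  have k1 := key p hpz
  have k2 := key q hqz
  intro hs
  constructor
  · rintro ⟨h5, h6⟩
    exact (hne (k1.1 h5).1 hs).1 ⟨(k1.1 h5).2, k2.2 h6⟩
  · rintro ⟨h5, h6⟩
    exact (hne (k2.1 h6).1 hs).2 ⟨k1.2 h5, (k2.1 h6).2⟩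

/-- After the first exchange of a chain, the position that the last entry of the cycle has left is
right relative to its new position. -/
theorem ok_z_swapAbs (h : StartState D F δ e k) {q : ℕ} (hq : q < n)
    (hne : ((swapAbs e F.z k q).natAbs : ℤ) ≠ (swapAbs e F.z k F.z).natAbs + δ) :
    Ok D F.cl (swapAbs e F.z k) F.z q := by
  have hz := F.lt
  have hk := h.hk
  have haz := F.le
  have hk1 := h.k_lt
  intro hadj'
  have hδ := h.dir
  have hfr := h.front
  have hqk : q = k := by
    by_contra hqk
    by_cases hqz : q = F.z
    · subst hqz; exact hadj'.ne rfl
    unfold Adj at hadj'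
    rw [natAbs_swapAbs_left] at hne hadj'
    rw [swapAbs_of_ne hqz hqk] at hne hadj'
    exact hqz (h.lab.inj _ _ hq.le hz.le (by omega))
  subst hqk
  rw [F.cl_z, h.cl_k, (h.order.cross _ _ haz (by omega) (by omega) (by omega)).1,
    natAbs_swapAbs_left, natAbs_swapAbs_right, target_symm h.adj.ne]
  have h1 := fun h' => h.wrong (fun _ => h')
  rw [F.cl_z, h.cl_k] at h1
  have := h.btw
  tauto

theorem virt_swapAbs (h : StartState D F δ e k) :
    VirtualOk D F (swapAbs e F.z k) (k + 1) ((swapAbs e F.z k F.z).natAbs + δ) := by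
  have hz := F.lt
  have hk := h.hk
  have haz := F.le
  have hk1 := h.k_lt
  intro q hq hqr
  have hδ := h.dir
  have hfr := h.front
  rw [natAbs_swapAbs_left] at hqr ⊢
  have h1 : q ≠ F.z := by rintro rfl; rw [natAbs_swapAbs_left] at hqr; omega
  have h2 : q ≠ k := by rintro rfl; rw [natAbs_swapAbs_right] at hqr; omega
  rw [h.lab.swapAbs_lt hz hk1 h.adj (by omega) (F.cl_le_n hq) (fun _ => by omega), ← h.cl_k]
  rw [swapAbs_of_ne h1 h2] at hqr ⊢
  refine h.ok k q hk1 hq hk.ne' h1 ?_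
  unfold Adj
  omega

theorem back_swapAbs (h : StartState D F δ e k) :
    ((swapAbs e F.z k k).natAbs : ℤ) = (swapAbs e F.z k F.z).natAbs - δ := by
  rw [natAbs_swapAbs_left, natAbs_swapAbs_right, h.front]
  omega

theorem lt_pred (h : StartState D F δ e k) (hs : SameSign (e F.z) (e k)) : F.z < k - 1 := by
  have hk := h.hk
  by_contra hcon
  have hkz : k = F.z + 1 := by omega
  have h1 := h.max.le (p := F.z) le_rfl
  have h2 := h.btw
  have h3 := h.btw'
  have h4 := h.adj
  rw [← hkz] at h3
  unfold SameSign at hs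
  unfold Adj at h4
  omega

theorem next (h : StartState D F δ e k) (haz' : F.a < F.z) (hs : SameSign (e F.z) (e k))
    (hadj : Adj (e (F.z - 1)) (e (k - 1))) :
    ChainState D F δ k (swapAbs e F.z k) (F.z - 1) (k - 1) := by
  have hz := F.lt
  have hk := h.hk
  have hk1 := h.k_lt
  have haz := F.le
  have hkz := h.lt_pred hs
  have ho := h.order
  have e1 : F.z - 1 + 1 = F.z := by omega
  have e2 : k - 1 + 1 = k := by omega
  have s1 : swapAbs e F.z k (F.z - 1) = e (F.z - 1) := swapAbs_of_ne (by omega) (by omega)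
  have s2 : swapAbs e F.z k (k - 1) = e (k - 1) := swapAbs_of_ne (by omega) (by omega)
  have hwrong : ¬ Ok D F.cl (swapAbs e F.z k) (F.z - 1) (k - 1) := by
    refine not_ok_swapAbs h.lab (by omega) (by omega) h.adj hs ?_ ?_ (by omega) (by omega)
      (by omega) (by omega) hadj ?_
    · rw [F.cl_succ (by omega) (by omega)]; omega
    · rw [F.cl_succ (by omega) (by omega)]; omega
    · exact h.ok _ _ (by omega) (by omega) (by omega) (by omega)
  exact
    { lab := ho.lab
      dir := h.dir
      max := fun p hp hpa => (ho.low _ _ hp haz).2 (h.max p hp hpa)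
      lo := by omega
      hi := by omega
      hk := hkz
      diag := by omega
      k₀_lt := hk1
      adj := by rw [s1, s2]; exact hadj
      btw := (ho.cross _ _ haz (by omega) (by omega) (by omega)).1.2 h.btw
      btw' := (ho.high _ _ (by omega) (by omega) (by omega) (by omega)).2 h.btw'
      wrong := hwrong
      near := by
        have := h.adj
        unfold Adj at this ⊢
        rw [e1, e2, natAbs_swapAbs_left, natAbs_swapAbs_right]
        exact this.symm
      near' := by
        unfold SameSign at hs ⊢
        rw [e1, e2, ho.neg, ho.neg]
        exact hs
      back := h.back_swapAbs
      ok := fun p q hp hq hpz hqz h1 h2 => h.ok_swapAbs hp hq hpz hqz (fun _ _ => by omega)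
      ok_z := fun q hq hne => h.ok_z_swapAbs hq hne
      virt := h.virt_swapAbs }

theorem chainEnd (h : StartState D F δ e k)
    (hend : F.a < F.z → SameSign (e F.z) (e k) → ¬ Adj (e (F.z - 1)) (e (k - 1))) :
    ChainEnd D F δ k (swapAbs e F.z k) where
  lab := h.order.lab
  back := h.back_swapAbs
  ok p q hp hq hpz hqz := by
    by_cases hc : F.a < F.z ∧ SameSign (e F.z) (e k) ∧
      ((p + 1 = F.z ∧ q + 1 = k) ∨ (p + 1 = k ∧ q + 1 = F.z))
    · have hk := h.hk
      have hst := hend hc.1 hc.2.1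
      have hkz := h.lt_pred hc.2.1
      intro hadj
      exfalso
      rw [swapAbs_of_ne (by omega) (by omega), swapAbs_of_ne (by omega) (by omega)] at hadj
      rcases hc.2.2 with ⟨h1, h2⟩ | ⟨h1, h2⟩
      · rw [show F.z - 1 = p by omega, show k - 1 = q by omega] at hst
        exact hst hadj
      · rw [show F.z - 1 = q by omega, show k - 1 = p by omega] at hst
        exact hst hadj.symm
    · refine h.ok_swapAbs hp hq hpz hqz ?_
      intro h1 h2
      constructor
      · exact fun h3 => hc ⟨h1, h2, Or.inl h3⟩
      · exact fun h3 => hc ⟨h1, h2, Or.inr h3⟩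
  ok_z q hq hne := h.ok_z_swapAbs hq hne
  virt := h.virt_swapAbs

theorem chain_spec (h : StartState D F δ e k) :
    ChainOrder F k e (chain e F.z k (F.z - F.a)) ∧
      ChainEnd D F δ k (chain e F.z k (F.z - F.a)) := by
  have haz := F.le
  cases hd : F.z - F.a with
  | zero => exact ⟨h.order, h.chainEnd (by omega)⟩
  | succ d =>
    rw [CyclicDescents.chain]
    split_ifs with hc
    · have h1 := (h.next (by omega) hc.1 hc.2).chain_spec
      rw [show F.z - 1 - F.a = d by omega] at h1
      exact ⟨h.order.trans h1.1, h1.2⟩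
    · exact ⟨h.order, h.chainEnd fun _ h1 h2 => hc ⟨h1, h2⟩⟩

end StartState

end Frame

section Frame

variable {n : ℕ} {F : Frame n} {D : Finset ℕ} {e f g : ℕ → ℤ} {δ : ℤ}

/-! ### Runs of chains -/

/-- The situation before the cycle on the places `a, …, z` is closed. -/
structure Ready (D : Finset ℕ) (F : Frame n) (e : ℕ → ℤ) : Prop where
  lab : IsLabeling n e
  max : HeadMax F e
  head : e F.a < e (F.z + 1)
  ok : ∀ p q, p < n → q < n → Ok D F.nx e p q

/-- If the pairs of positions in both directions `δ` and `-δ` are wrong, then the value in the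
direction `δ` is the larger one. -/
def Choice (D : Finset ℕ) (F : Frame n) (δ : ℤ) (e : ℕ → ℤ) : Prop :=
  ∀ k q, k < n → q < n → ((e k).natAbs : ℤ) = (e F.z).natAbs + δ →
    ((e q).natAbs : ℤ) = (e F.z).natAbs - δ →
    ¬ Ok D F.cl e F.z k → ¬ Ok D F.cl e F.z q → e (F.cl q) < e (F.cl k)

/-- The invariant of the loop that moves the last entry of the cycle in the direction `δ`. By
`virt`, the position ahead of `|e z|` would be right if the value at `|e z|` were a certain entry
`e w` above `e a`; by `back`, a wrong value ahead would be right at `|e z|` with regard to the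
position behind. -/
structure Mid (D : Finset ℕ) (F : Frame n) (δ : ℤ) (e : ℕ → ℤ) : Prop where
  lab : IsLabeling n e
  dir : δ = 1 ∨ δ = -1
  max : HeadMax F e
  head : e F.a < e (F.z + 1)
  ok : ∀ p q, p < n → q < n → p ≠ F.z → q ≠ F.z → Ok D F.cl e p q
  virt : ∃ w, F.z < w ∧ w ≤ n ∧ e F.a < e w ∧ e w ≤ e (F.z + 1) ∧
    VirtualOk D F e w ((e F.z).natAbs + δ) ∧
    ∀ q < n, ((e q).natAbs : ℤ) = (e F.z).natAbs + δ → F.cl q ≠ w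
  back : ∀ k < n, ((e k).natAbs : ℤ) = (e F.z).natAbs + δ → ¬ Ok D F.cl e F.z k →
    VirtualOk D F e (F.cl k) ((e F.z).natAbs - δ)

/-- The trace that a step in the direction `δ` leaves: the value at the position just vacated lies
between `e a` and `e (z + 1)`, is rightly larger than the value at the position `|e z|`, and compares
with the value ahead as the value at `|e z|` should. -/
structure Back (D : Finset ℕ) (F : Frame n) (δ : ℤ) (e : ℕ → ℤ) (k : ℕ) : Prop where
  hk : F.z < k
  k_lt : k < n
  natAbs_eq : ((e k).natAbs : ℤ) = (e F.z).natAbs - δ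
  btw : e F.a < e (k + 1)
  btw' : e (k + 1) < e (F.z + 1)
  target : Target D (e F.z).natAbs (e k).natAbs
  virt : VirtualOk D F e (k + 1) ((e F.z).natAbs + δ)
  ok_z : ∀ q < n, ((e q).natAbs : ℤ) ≠ (e F.z).natAbs + δ → Ok D F.cl e F.z q

/-- What the steps of a run preserve. -/
structure RunOrder (F : Frame n) (e f : ℕ → ℤ) : Prop where
  neg : ∀ p, f p < 0 ↔ e p < 0
  low : ∀ p q, p ≤ F.z → q ≤ F.z → (f p < f q ↔ e p < e q)
  high : ∀ p q, F.z < p → p ≤ n → F.z < q → q ≤ n → (f p < f q ↔ e p < e q)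
  big : ∀ p, F.z < p → p < n → f (F.z + 1) < f (p + 1) → f p = e p
  one : AtLeastNegOne n F.cl f ↔ AtLeastNegOne n F.cl e

theorem RunOrder.refl (F : Frame n) (e : ℕ → ℤ) : RunOrder F e e :=
  ⟨fun _ => Iff.rfl, fun _ _ _ _ => Iff.rfl, fun _ _ _ _ _ _ => Iff.rfl, fun _ _ _ _ => rfl, Iff.rfl⟩

theorem RunOrder.trans (h : RunOrder F e f) (h' : RunOrder F f g) : RunOrder F e g where
  neg p := (h'.neg p).trans (h.neg p)
  low p q hp hq := (h'.low p q hp hq).trans (h.low p q hp hq)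
  high p q hp hp' hq hq' := (h'.high p q hp hp' hq hq').trans (h.high p q hp hp' hq hq')
  big p hp hp' hlt := by
    have := F.lt
    rw [h'.big p hp hp' hlt]
    exact h.big p hp hp' ((h'.high _ _ (by omega) (by omega) (by omega) (by omega)).1 hlt)
  one := h'.one.trans h.one

theorem ChainOrder.runOrder {k : ℕ} (h : ChainOrder F k e f) : RunOrder F e f :=
  ⟨h.neg, h.low, h.high, h.big, h.one⟩

/-- The result `f` of a number of steps in the direction `δ`, each of which is a chain of exchanges
started at a wrong pair of positions. -/
inductive Run (D : Finset ℕ) (F : Frame n) (δ : ℤ) (e : ℕ → ℤ) : (ℕ → ℤ) → Prop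
  | refl : Run D F δ e e
  | step {f : ℕ → ℤ} (h : Run D F δ e f) (k : ℕ) (hk : k < n)
      (hf : ((f k).natAbs : ℤ) = (f F.z).natAbs + δ) (hw : ¬ Ok D F.cl f F.z k) :
      Run D F δ e (chain f F.z k (F.z - F.a))

theorem HeadMax.le_of_lt (h : HeadMax F e) {p : ℕ} (hp : e F.a < e p) : F.z < p := by
  by_contra hcon
  have := h.le (p := p) (by omega)
  omega

theorem Frame.lt_of_lt_cl {p : ℕ} (h : F.z < F.cl p) : F.z < p ∧ F.cl p = p + 1 := by
  have haz := F.le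
  have h1 : F.z < p := by
    by_contra hcon
    have := F.cl_le (p := p) (by omega)
    omega
  exact ⟨h1, F.cl_succ (by omega) (by omega)⟩

/-- A wrong value ahead of the last entry of the cycle lies between `e a` and `e (z + 1)`. -/
theorem Mid.startState (h : Mid D F δ e) {k : ℕ} (hk : k < n)
    (hf : ((e k).natAbs : ℤ) = (e F.z).natAbs + δ) (hw : ¬ Ok D F.cl e F.z k) :
    StartState D F δ e k := by
  obtain ⟨w, hw1, hw2, hw3, hw4, hw5, hw6⟩ := h.virt
  have h1 := hw5 k hk hf
  have h2 := fun h' => hw (fun _ => h')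
  rw [F.cl_z] at h2
  have h3 : e w ≠ e (F.cl k) := fun h' =>
    hw6 k hk hf (h.lab.inj _ _ hw2 (F.cl_le_n hk) (congrArg _ h')).symm
  have h4 : e F.a < e (F.cl k) ∧ e (F.cl k) < e w := by
    by_cases h5 : e w < e (F.cl k)
    · exact absurd ⟨fun _ => h1.1 h5, fun _ => hw3.trans h5⟩ h2
    · have h6 : ¬ Target D (e F.z).natAbs (e k).natAbs := fun h' => h5 (h1.2 h')
      have h7 : e F.a < e (F.cl k) := by
        by_contra h7
        exact h2 ⟨fun h' => absurd h' h7, fun h' => absurd h' h6⟩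
      exact ⟨h7, by omega⟩
  have h5 := F.lt_of_lt_cl (h.max.le_of_lt h4.1)
  have h6 := h.back k hk hf hw
  rw [h5.2] at h4 h6
  exact ⟨h.lab, h.dir, h.max, h5.1, hk, hf, h4.1, h4.2.trans_le hw4, hw, h.ok, h6⟩

/-- The trace of a step is all that the loop needs in order to go on. -/
theorem Back.mid {k : ℕ} (h : Back D F δ e k) (hl : IsLabeling n e)
    (hδ : δ = 1 ∨ δ = -1) (hm : HeadMax F e) (hh : e F.a < e (F.z + 1))
    (hok : ∀ p q, p < n → q < n → p ≠ F.z → q ≠ F.z → Ok D F.cl e p q) : Mid D F δ e := by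
  have haz := F.le
  have hk := h.hk
  have hk' := h.k_lt
  have hclk : F.cl k = k + 1 := F.cl_succ (by omega) (by omega)
  refine ⟨hl, hδ, hm, hh, hok, ⟨k + 1, by omega, by omega, h.btw, h.btw'.le, h.virt, ?_⟩, ?_⟩
  · intro q hq hqf hcl
    rw [← hclk] at hcl
    rw [F.cl_inj hcl, h.natAbs_eq] at hqf
    omega
  · intro k₂ hk₂ hf hw q hq hqb
    have hqk : q = k := hl.inj _ _ hq.le hk'.le (by have := h.natAbs_eq; omega)
    subst hqk
    refine iff_of_true ?_ h.target
    have h1 := h.virt k₂ hk₂ hf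
    rw [hclk]
    have h2 : e (F.cl k₂) ≠ e (q + 1) := by
      intro h'
      have h3 := hl.inj _ _ (F.cl_le_n hk₂) (by omega) (congrArg Int.natAbs h')
      rw [← hclk] at h3
      rw [F.cl_inj h3, h.natAbs_eq] at hf
      omega
    by_contra h4
    refine hw fun _ => ?_
    rw [F.cl_z]
    have h5 := h.btw
    exact iff_of_true (by omega) (h1.1 (by omega))

theorem StartState.back_chain {k : ℕ} (h : StartState D F δ e k) :
    ChainOrder F k e (chain e F.z k (F.z - F.a)) ∧
      Back D F δ (chain e F.z k (F.z - F.a)) k ∧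
      Mid D F δ (chain e F.z k (F.z - F.a)) := by
  obtain ⟨ho, hE⟩ := h.chain_spec
  generalize chain e F.z k (F.z - F.a) = f at ho hE
  have hz := F.lt
  have haz := F.le
  have hk := h.hk
  have hk' := h.k_lt
  have hδ := h.dir
  have hb := hE.back
  have b1 : f F.a < f (k + 1) := (ho.cross _ _ haz (by omega) (by omega) (by omega)).1.2 h.btw
  have b2 : f (k + 1) < f (F.z + 1) :=
    (ho.high _ _ (by omega) (by omega) (by omega) (by omega)).2 h.btw'
  have hB : Back D F δ f k := by
    refine ⟨hk, hk', hb, b1, b2, ?_, hE.virt, hE.ok_z⟩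
    have h1 := hE.ok_z k hk' (by omega)
    rw [← h1 (by unfold Adj; omega), F.cl_z, h.cl_k]
    exact b1
  exact ⟨ho, hB, hB.mid ho.lab hδ (fun p hp hpa => (ho.low _ _ hp haz).2 (h.max p hp hpa)) ho.head
    hE.ok⟩

namespace Ready

theorem ok_cl (h : Ready D F e) {p q : ℕ} (hp : p < n) (hq : q < n) (hpz : p ≠ F.z)
    (hqz : q ≠ F.z) : Ok D F.cl e p q := by
  have h1 := h.ok p q hp hq
  unfold Ok at h1 ⊢
  rwa [F.cl_of_ne hpz, F.cl_of_ne hqz]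

theorem virt (h : Ready D F e) {r : ℤ} (hr : r = (e F.z).natAbs + 1 ∨ r = (e F.z).natAbs + -1) :
    VirtualOk D F e (F.z + 1) r := by
  intro q hq hqr
  have h1 := h.ok _ q F.lt hq (by unfold Adj; omega)
  have hqz : q ≠ F.z := by rintro rfl; omega
  rw [F.nx_of_le _ F.le] at h1
  rw [F.cl_of_ne hqz]
  exact h1

/-- When the cycle is closed, the value at `|e z|` drops from `e (z + 1)` to `e a`. So a position
becomes wrong only if its value lies in between, and that value follows a place after `z`. -/
theorem wrong (h : Ready D F e) {k : ℕ} (hk : k < n) (hw : ¬ Ok D F.cl e F.z k) :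
    F.z < k ∧ e F.a < e (k + 1) ∧ e (k + 1) < e (F.z + 1) := by
  have hadj : Adj (e F.z) (e k) := by
    by_contra hadj; exact hw fun h' => absurd h' hadj
  have hkz : k ≠ F.z := by rintro rfl; exact hadj.ne rfl
  have h1 := h.ok _ k F.lt hk hadj
  have h2 := fun h' => hw (fun _ => h')
  rw [F.nx_of_le _ F.le] at h1
  rw [← h1, F.cl_z, F.cl_of_ne hkz] at h2
  have h3 := h.head
  have h4 : e F.a < e (F.nx k) ∧ ¬ e (F.z + 1) < e (F.nx k) := by
    constructor
    · by_contra h4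
      exact h2 ⟨fun h' => absurd h' h4, fun h' => absurd (h3.trans h') h4⟩
    · intro h5
      exact h2 ⟨fun _ => h5, fun _ => h3.trans h5⟩
  rw [← F.cl_of_ne hkz] at h4
  have h5 := F.lt_of_lt_cl (h.max.le_of_lt h4.1)
  rw [h5.2] at h4
  refine ⟨h5.1, h4.1, lt_of_le_of_ne (not_lt.1 h4.2) fun h' => ?_⟩
  have hz := F.lt
  have := h.lab.inj _ _ (by omega) (by omega) (congrArg Int.natAbs h')
  omega

theorem mid (h : Ready D F e) (hδ : δ = 1 ∨ δ = -1) (hc : Choice D F δ e) : Mid D F δ e := by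
  have hz := F.lt
  have haz := F.le
  refine ⟨h.lab, hδ, h.max, h.head, fun p q => h.ok_cl, ⟨F.z + 1, by omega, by omega, h.head,
    le_rfl, h.virt (by omega), ?_⟩, ?_⟩
  · intro q hq hqf hcl
    have := F.lt_of_lt_cl (p := q) (by omega)
    omega
  · intro k hk hf hw q hq hqb
    obtain ⟨h1, h2, h3⟩ := h.wrong hk hw
    have hkcl : F.cl k = k + 1 := F.cl_succ (by omega) (by omega)
    have h4 := h.virt (r := (e F.z).natAbs - δ) (by omega) q hq hqb
    have h5 := hc k q hk hq hf hqb hw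
    rw [hkcl] at h5 ⊢
    by_cases hw' : Ok D F.cl e F.z q
    · have h6 := hw' (by unfold Adj; omega)
      rw [F.cl_z] at h6
      -- the value behind is not between `e a` and `e (z + 1)`
      have h7 : e (F.cl q) ≠ e (F.z + 1) := by
        intro h'
        have := h.lab.inj _ _ (F.cl_le_n hq) (by omega) (congrArg Int.natAbs h')
        have := F.lt_of_lt_cl (p := q) (by omega)
        omega
      rw [← h4]
      rw [← h4] at h6
      omega
    · have h6 := fun h' => hw' (fun _ => h')
      rw [F.cl_z, ← h4] at h6
      rw [← h4]
      have := h5 hw'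
      omega

theorem one_iff (h : Ready D F e) :
    AtLeastNegOne n F.nx e ↔ AtLeastNegOne n F.cl e := by
  have h1 := h.max.le (p := F.z) le_rfl
  have h2 := h.head
  unfold AtLeastNegOne
  refine forall_congr' fun p => forall_congr' fun hp => forall_congr' fun hp1 => ?_
  by_cases hpz : p = F.z
  · subst hpz
    rw [F.cl_z, F.nx_of_le _ F.le]
    omega
  · rw [F.cl_of_ne hpz]

end Ready

theorem Run.mid (h : Run D F δ e f) (hδ : δ = 1 ∨ δ = -1) (hr : Ready D F e)
    (hc : Choice D F δ e) :
    RunOrder F e f ∧ Mid D F δ f ∧ (f = e ∨ ∃ k, Back D F δ f k) := by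
  induction h with
  | refl => exact ⟨RunOrder.refl F e, hr.mid hδ hc, Or.inl rfl⟩
  | step h k hk hf hw ih =>
    obtain ⟨h1, h2, h3⟩ := (ih.2.1.startState hk hf hw).back_chain
    exact ⟨ih.1.trans h1.runOrder, h3, Or.inr ⟨k, h2⟩⟩

/-- Before the cycle is closed there is no trace of a step: the value at the position behind would
have to be larger than `e (z + 1)`, with which it has been compared rightly. -/
theorem Ready.not_back {k : ℕ} (h : Ready D F e) (hδ : δ = 1 ∨ δ = -1) : ¬ Back D F δ e k := by
  intro hB
  have haz := F.le
  have hk := hB.hk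
  have h1 := (h.virt (r := (e F.z).natAbs - δ) (by omega) k hB.k_lt hB.natAbs_eq).2 hB.target
  rw [F.cl_succ (by omega) (by omega)] at h1
  have := hB.btw'
  omega

/-- The traces of steps in both directions contradict each other, as each of the two values left
behind would have to be the larger one. -/
theorem Back.dir_eq {k k' : ℕ} {δ' : ℤ} (h : Back D F δ e k) (h' : Back D F δ' e k')
    (hδ : δ = 1 ∨ δ = -1) (hδ' : δ' = 1 ∨ δ' = -1) : δ = δ' := by
  by_contra hne
  have haz := F.le
  have hk := h.hk
  have hk' := h'.hk
  have h1 := (h.virt k' h'.k_lt (by have := h'.natAbs_eq; omega)).2 h'.target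
  have h2 := (h'.virt k h.k_lt (by have := h.natAbs_eq; omega)).2 h.target
  rw [F.cl_succ (by omega) (by omega)] at h1 h2
  omega

/-- A chain ends before it could reach the entries of the cycle to be closed from the right. -/
theorem ChainState.chain_eq_min {k₀ i k d : ℕ} (h : ChainState D F δ k₀ e i k) (hd : d = i - F.a) :
    chain e i k d = chain e i k (min d (k - F.z - 1)) := by
  induction d generalizing e i k with
  | zero => simp
  | succ d ih =>
    have hk := h.hk
    by_cases hc : SameSign (e i) (e k) ∧ Adj (e (i - 1)) (e (k - 1))
    · have h1 := h.lt_pred hc.1 (by omega)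
      rw [show min (d + 1) (k - F.z - 1) = min d (k - 1 - F.z - 1) + 1 by omega,
        CyclicDescents.chain, CyclicDescents.chain, if_pos hc, if_pos hc]
      exact ih (h.next (by omega) hc.1 hc.2) (by omega)
    · rw [CyclicDescents.chain, if_neg hc]
      cases min (d + 1) (k - F.z - 1) with
      | zero => rw [CyclicDescents.chain]
      | succ m => rw [CyclicDescents.chain, if_neg hc]

theorem StartState.chain_eq_min {k : ℕ} (h : StartState D F δ e k) :
    chain e F.z k (F.z - F.a) =
      chain e F.z k (min (F.z - F.a) (k - F.z - 1)) := by
  have hk := h.hk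
  by_cases hc : SameSign (e F.z) (e k) ∧ Adj (e (F.z - 1)) (e (k - 1))
  · have h1 := h.lt_pred hc.1
    cases hd : F.z - F.a with
    | zero => simp
    | succ d =>
      rw [show min (d + 1) (k - F.z - 1) = min d (k - 1 - F.z - 1) + 1 by omega,
        CyclicDescents.chain, CyclicDescents.chain, if_pos hc, if_pos hc]
      exact (h.next (by omega) hc.1 hc.2).chain_eq_min (by omega)
  · have key : ∀ m, chain e F.z k m = swapAbs e F.z k := by
      intro m
      cases m with
      | zero => rw [CyclicDescents.chain]
      | succ m => rw [CyclicDescents.chain, if_neg hc]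
    rw [key, key]

/-- The chain started at the same places undoes a chain. -/
theorem StartState.chain_chain {k : ℕ} (h : StartState D F δ e k) :
    chain (chain e F.z k (F.z - F.a)) F.z k
      (min (F.z - F.a) (k - F.z - 1)) = e := by
  have hk := h.hk
  have hk' := h.k_lt
  rw [h.chain_eq_min]
  exact CyclicDescents.chain_chain (by omega) (by omega) fun p hp => h.lab.ne_zero (by omega)

theorem Run.eq_or_exists (h : Run D F δ e g) : g = e ∨ ∃ f k, Run D F δ e f ∧ k < n ∧
    ((f k).natAbs : ℤ) = (f F.z).natAbs + δ ∧ ¬ Ok D F.cl f F.z k ∧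
    g = chain f F.z k (F.z - F.a) := by
  cases h with
  | refl => exact Or.inl rfl
  | step h k hk hf hw => exact Or.inr ⟨_, k, h, hk, hf, hw, rfl⟩

/-- A run can be traced back: its direction and its last step are determined by its result, and so
is the number of its steps, since the closing of a cycle that needs no step leaves no trace. -/
theorem Run.injective {δ' : ℤ} {e' : ℕ → ℤ} (h : Run D F δ e g) (h' : Run D F δ' e' g)
    (hδ : δ = 1 ∨ δ = -1) (hδ' : δ' = 1 ∨ δ' = -1) (hr : Ready D F e) (hr' : Ready D F e')
    (hc : Choice D F δ e) (hc' : Choice D F δ' e') : e = e' := by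
  induction h with
  | refl =>
    rcases (h'.mid hδ' hr' hc').2.2 with h1 | ⟨k, h1⟩
    · exact h1
    · exact absurd h1 (hr.not_back hδ')
  | step h k hk hf hw ih =>
    have hS := (h.mid hδ hr hc).2.1.startState hk hf hw
    obtain ⟨-, hB, -⟩ := hS.back_chain
    rcases h'.eq_or_exists with h1 | ⟨f₂, k₂, h₂, hk₂, hf₂, hw₂, hg⟩
    · rw [h1] at hB; exact absurd hB (hr'.not_back hδ)
    have hS₂ := (h₂.mid hδ' hr' hc').2.1.startState hk₂ hf₂ hw₂
    obtain ⟨ho₂, hB₂, -⟩ := hS₂.back_chain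
    rw [← hg] at hB₂ ho₂
    obtain rfl := hB.dir_eq hB₂ hδ hδ'
    have hkk : k = k₂ := ho₂.lab.inj _ _ hk.le hk₂.le
      (by have := hB.natAbs_eq; have := hB₂.natAbs_eq; omega)
    subst hkk
    have i1 := hS.chain_chain
    have i2 := hS₂.chain_chain
    rw [← hg, i1] at i2
    rw [← i2] at h₂
    exact ih h₂

/-! ### The passage from one open state to the next -/

/-- `f` is a result of closing the cycle on the places `a, …, z` that has no wrong positions. -/
def Closes (D : Finset ℕ) (F : Frame n) (e f : ℕ → ℤ) : Prop :=
  ∃ δ : ℤ, (δ = 1 ∨ δ = -1) ∧ Choice D F δ e ∧ Run D F δ e f ∧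
    ∀ p q, p < n → q < n → Ok D F.cl f p q

theorem Closes.injective {e' : ℕ → ℤ} (h : Closes D F e g) (h' : Closes D F e' g)
    (hr : Ready D F e) (hr' : Ready D F e') : e = e' := by
  obtain ⟨δ, hδ, hc, hrun, -⟩ := h
  obtain ⟨δ', hδ', hc', hrun', -⟩ := h'
  exact hrun.injective hrun' hδ hδ' hr hr' hc hc'

/-- The values larger than the entry at the place `b` are in the same relative order as the values
of `π` at the same positions. -/
def Agrees (n : ℕ) (π : ℤ → ℤ) (u : ℕ → ℕ) (b : ℕ) (e : ℕ → ℤ) : Prop :=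
  ∀ p q, p < n → q < n → e b < e (u p) → e b < e (u q) →
    (e (u p) < e (u q) ↔ π |e p| < π |e q|)

theorem Closes.spec (h : Closes D F e f) (hr : Ready D F e) :
    RunOrder F e f ∧ IsLabeling n f ∧ HeadMax F f ∧ f F.a < f (F.z + 1) := by
  obtain ⟨δ, hδ, hc, hrun, -⟩ := h
  obtain ⟨h1, h2, -⟩ := hrun.mid hδ hr hc
  exact ⟨h1, h2.lab, h2.max, h2.head⟩

theorem Closes.agrees {π : ℤ → ℤ} (h : Closes D F e f) (hr : Ready D F e)
    (ha : Agrees n π F.nx F.a e) : Agrees n π F.cl (F.z + 1) f := by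
  obtain ⟨ho, hl, hm, hh⟩ := h.spec hr
  have hz := F.lt
  have haz := F.le
  have key : ∀ p, p < n → f (F.z + 1) < f (F.cl p) → F.z < p ∧ F.cl p = p + 1 ∧ F.nx p = p + 1 ∧
      f p = e p ∧ e F.a < e (p + 1) := by
    intro p hp hlt
    have h1 := F.lt_of_lt_cl (hm.le_of_lt (hh.trans hlt))
    rw [h1.2] at hlt
    refine ⟨h1.1, h1.2, F.nx_of_le _ (by omega), ho.big p h1.1 hp hlt, hr.head.trans ?_⟩
    exact (ho.high _ _ (by omega) (by omega) (by omega) (by omega)).1 hlt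
  intro p q hp hq h1 h2
  obtain ⟨p1, p2, p3, p4, p5⟩ := key p hp h1
  obtain ⟨q1, q2, q3, q4, q5⟩ := key q hq h2
  rw [p2, q2, ho.high _ _ (by omega) (by omega) (by omega) (by omega), p4, q4]
  have h3 := ha p q hp hq
  rw [p3, q3] at h3
  exact h3 p5 q5

end Frame

/-! ### Cycle notations as blocks of places -/

/-- `s 0 = 0 < s 1 < … < s m = n` are the places before which a cycle begins, together with the last
place `n`; the values of `s` beyond `m` are fixed so that `s` is determined. -/
structure Cuts (n m : ℕ) (s : ℕ → ℕ) : Prop where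
  zero : s 0 = 0
  last : s m = n
  lt : ∀ j < m, s j < s (j + 1)
  tail : ∀ j, m < j → s j = n + 1

/-- The cycle notation with the entries `e 0, e 1, …`, whose cycles begin at the places `s j`. -/
def blocks (s : ℕ → ℕ) (m : ℕ) (e : ℕ → ℤ) : List (List ℤ) :=
  (List.range m).map fun j => (List.range' (s j) (s (j + 1) - s j)).map e

/-- The successor function on places when the first `j` cycles are closed, while the rest still forms
one long cycle through the last place. -/
def nxt (s : ℕ → ℕ) : ℕ → ℕ → ℕ
  | 0, p => p + 1
  | j + 1, p => if p = s (j + 1) - 1 then s j else nxt s j p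

namespace Cuts

variable {n m : ℕ} {s : ℕ → ℕ}

theorem mono (h : Cuts n m s) {i j : ℕ} (hij : i ≤ j) (hj : j ≤ m) : s i ≤ s j := by
  induction j with
  | zero => rw [Nat.le_zero.1 hij]
  | succ j ih =>
    rcases hij.lt_or_eq with h1 | h1
    · exact (ih (by omega) (by omega)).trans (h.lt j (by omega)).le
    · rw [h1]

theorem le_n (h : Cuts n m s) {j : ℕ} (hj : j ≤ m) : s j ≤ n := h.last ▸ h.mono hj le_rfl

theorem exists_block_lt (h : Cuts n m s) {p j : ℕ} (hj : j ≤ m) (hp : p < s j) :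
    ∃ l < j, s l ≤ p ∧ p < s (l + 1) := by
  induction j with
  | zero => rw [h.zero] at hp; omega
  | succ j ih =>
    by_cases h1 : p < s j
    · obtain ⟨l, h2, h3⟩ := ih (by omega) h1
      exact ⟨l, by omega, h3⟩
    · exact ⟨j, by omega, by omega, hp⟩

theorem exists_block (h : Cuts n m s) {p : ℕ} (hp : p < n) :
    ∃ l < m, s l ≤ p ∧ p < s (l + 1) :=
  h.exists_block_lt le_rfl (by rwa [h.last])

theorem nxt_of_le (h : Cuts n m s) {j p : ℕ} (hj : j ≤ m) (hp : s j ≤ p) : nxt s j p = p + 1 := by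
  induction j with
  | zero => rfl
  | succ j ih =>
    have h1 := h.lt j (by omega)
    rw [nxt, if_neg (by omega), ih (by omega) (by omega)]

theorem nxt_block (h : Cuts n m s) {j l p : ℕ} (hj : j ≤ m) (hl : l < j) (hp : s l ≤ p)
    (hp' : p < s (l + 1)) : nxt s j p = if p + 1 = s (l + 1) then s l else p + 1 := by
  induction j with
  | zero => omega
  | succ j ih =>
    rw [nxt]
    rcases (Nat.lt_succ_iff.1 hl).lt_or_eq with h1 | h1
    · have h2 := h.mono (i := l + 1) (j := j) (by omega) (by omega)
      have h3 := h.lt j (by omega)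
      rw [if_neg (by omega), ih (by omega) h1]
    · subst h1
      by_cases h2 : p + 1 = s (l + 1)
      · rw [if_pos (by omega), if_pos h2]
      · rw [if_neg (by omega), if_neg h2, h.nxt_of_le (by omega) hp]

theorem nxt_lt (h : Cuts n m s) {j p : ℕ} (hj : j ≤ m) (hp : p < s j) : nxt s j p < s j := by
  obtain ⟨l, hl, h1, h2⟩ := h.exists_block_lt hj hp
  have h3 := h.mono (i := l + 1) (j := j) (by omega) hj
  rw [h.nxt_block hj hl h1 h2]
  split_ifs <;> omega

/-- Every place has a predecessor in its cycle. -/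
theorem exists_pred (h : Cuts n m s) {l q : ℕ} (hl : l < m) (hq : s l ≤ q) (hq' : q < s (l + 1)) :
    ∃ p, s l ≤ p ∧ p < s (l + 1) ∧ nxt s m p = q := by
  by_cases h1 : q = s l
  · refine ⟨s (l + 1) - 1, by omega, by omega, ?_⟩
    rw [h.nxt_block le_rfl hl (by omega) (by omega), if_pos (by omega), h1]
  · refine ⟨q - 1, by omega, by omega, ?_⟩
    rw [h.nxt_block le_rfl hl (by omega) (by omega), if_neg (by omega)]
    omega

theorem block_unique (h : Cuts n m s) {l l' p : ℕ} (hl : l < m) (hl' : l' < m) (h1 : s l ≤ p)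
    (h2 : p < s (l + 1)) (h3 : s l' ≤ p) (h4 : p < s (l' + 1)) : l = l' := by
  rcases lt_trichotomy l l' with h5 | h5 | h5
  · have := h.mono (i := l + 1) (j := l') (by omega) (by omega); omega
  · exact h5
  · have := h.mono (i := l' + 1) (j := l) (by omega) (by omega); omega

theorem nxt_inj (h : Cuts n m s) {j p q : ℕ} (hj : j ≤ m) (hp : p < s j) (hq : q < s j)
    (heq : nxt s j p = nxt s j q) : p = q := by
  obtain ⟨l, hl, h1, h2⟩ := h.exists_block_lt hj hp
  obtain ⟨l', hl', h3, h4⟩ := h.exists_block_lt hj hq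
  have hlt : s l < s (l + 1) := h.lt l (by omega)
  have hlt' : s l' < s (l' + 1) := h.lt l' (by omega)
  have key : l = l' := by
    refine h.block_unique (p := nxt s j p) (by omega) (by omega) ?_ ?_ ?_ ?_
    · rw [h.nxt_block hj hl h1 h2]; split_ifs <;> omega
    · rw [h.nxt_block hj hl h1 h2]; split_ifs <;> omega
    · rw [heq, h.nxt_block hj hl' h3 h4]; split_ifs <;> omega
    · rw [heq, h.nxt_block hj hl' h3 h4]; split_ifs <;> omega
  subst key
  rw [h.nxt_block hj hl h1 h2, h.nxt_block hj hl h3 h4] at heq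
  split_ifs at heq <;> omega

/-- The frame for the `j`-th cycle. -/
def frame (h : Cuts n m s) {j : ℕ} (hj : j < m) : Frame n where
  a := s j
  z := s (j + 1) - 1
  nx := nxt s j
  le := by have := h.lt j hj; omega
  lt := by have := h.lt j hj; have := h.le_n (j := j + 1) hj; omega
  nx_of_le _ hp := h.nxt_of_le hj.le hp
  nx_lt _ hp := h.nxt_lt hj.le hp
  nx_inj _ _ hp hq heq := h.nxt_inj hj.le hp hq heq

theorem frame_cl (h : Cuts n m s) {j : ℕ} (hj : j < m) : (h.frame hj).cl = nxt s (j + 1) := rfl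

theorem frame_a (h : Cuts n m s) {j : ℕ} (hj : j < m) : (h.frame hj).a = s j := rfl

theorem frame_z (h : Cuts n m s) {j : ℕ} (hj : j < m) : (h.frame hj).z + 1 = s (j + 1) := by
  have := h.lt j hj
  change s (j + 1) - 1 + 1 = _
  omega

theorem frame_nx (h : Cuts n m s) {j : ℕ} (hj : j < m) : (h.frame hj).nx = nxt s j := rfl

end Cuts

/-- `n` integers with distinct absolute values between `1` and `n` take all these values. -/
theorem exists_natAbs_eq {n : ℕ} {e : ℕ → ℤ} (hb : ∀ p < n, 1 ≤ (e p).natAbs ∧ (e p).natAbs ≤ n)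
    (hi : ∀ p q, p < n → q < n → (e p).natAbs = (e q).natAbs → p = q) {r : ℕ} (h1 : 1 ≤ r)
    (h2 : r ≤ n) : ∃ p < n, (e p).natAbs = r := by
  have h3 : (Finset.range n).image (fun p => (e p).natAbs) = Finset.Icc 1 n := by
    refine Finset.eq_of_subset_of_card_le ?_ ?_
    · intro x hx
      obtain ⟨p, hp, rfl⟩ := Finset.mem_image.1 hx
      exact Finset.mem_Icc.2 (hb p (Finset.mem_range.1 hp))
    · rw [Finset.card_image_of_injOn]
      · simp
      · intro p hp q hq hpq
        exact hi p q (Finset.mem_range.1 hp) (Finset.mem_range.1 hq) hpq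
  have h4 : r ∈ (Finset.range n).image (fun p => (e p).natAbs) := by
    rw [h3]; exact Finset.mem_Icc.2 ⟨h1, h2⟩
  obtain ⟨p, hp, hpr⟩ := Finset.mem_image.1 h4
  exact ⟨p, Finset.mem_range.1 hp, hpr⟩

theorem IsLabeling.surj {n : ℕ} {e : ℕ → ℤ} (h : IsLabeling n e) {r : ℕ} (h1 : 1 ≤ r)
    (h2 : r ≤ n) : ∃ p < n, (e p).natAbs = r :=
  exists_natAbs_eq h.bd (fun p q hp hq => h.inj p q hp.le hq.le) h1 h2

theorem find?_eq_some_of_unique {α : Type*} {l : List α} {P : α → Bool} {x : α} (hx : x ∈ l)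
    (hP : P x = true) (hu : ∀ y ∈ l, P y = true → y = x) : l.find? P = some x := by
  induction l with
  | nil => simp at hx
  | cons y l ih =>
    by_cases h1 : P y = true
    · rw [List.find?_cons_of_pos h1, hu y (by simp) h1]
    · rw [List.find?_cons_of_neg h1]
      refine ih ?_ fun y' hy' => hu y' (by simp [hy'])
      rcases List.mem_cons.1 hx with rfl | hx
      · exact absurd hP h1
      · exact hx

section Blocks

variable {n m : ℕ} {s : ℕ → ℕ} {e : ℕ → ℤ}

theorem mem_arrows_blocks (h : Cuts n m s) {x : ℤ × ℤ} :
    x ∈ arrows (blocks s m e) ↔ ∃ p < n, x = (e p, e (nxt s m p)) := by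
  have key : ∀ l < m, (x ∈ ((List.range' (s l) (s (l + 1) - s l)).map e).zip
      (((List.range' (s l) (s (l + 1) - s l)).map e).rotate 1) ↔
      ∃ p, s l ≤ p ∧ p < s (l + 1) ∧ x = (e p, e (nxt s m p))) := by
    intro l hl
    have hlt := h.lt l hl
    rw [List.mem_iff_getElem]
    simp only [List.length_zip, List.length_map, List.length_range', List.length_rotate,
      List.getElem_zip, List.getElem_map, List.getElem_range', List.getElem_rotate, one_mul,
      min_self]
    constructor
    · rintro ⟨r, hr, rfl⟩
      refine ⟨s l + r, by omega, by omega, ?_⟩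
      rw [h.nxt_block le_rfl hl (by omega) (by omega)]
      by_cases h1 : s l + r + 1 = s (l + 1)
      · rw [if_pos h1, show r + 1 = s (l + 1) - s l by omega, Nat.mod_self, add_zero]
      · rw [if_neg h1, Nat.mod_eq_of_lt (by omega)]; rfl
    · rintro ⟨p, hp, hp', rfl⟩
      refine ⟨p - s l, by omega, ?_⟩
      rw [h.nxt_block le_rfl hl hp hp', show s l + (p - s l) = p by omega]
      by_cases h1 : p + 1 = s (l + 1)
      · rw [if_pos h1, show p - s l + 1 = s (l + 1) - s l by omega, Nat.mod_self, add_zero]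
      · rw [if_neg h1, Nat.mod_eq_of_lt (by omega), show s l + (p - s l + 1) = p + 1 by omega]
  rw [arrows, blocks, List.mem_flatMap]
  constructor
  · rintro ⟨c, hc, hx⟩
    obtain ⟨l, hl, rfl⟩ := List.mem_map.1 hc
    have hl := List.mem_range.1 hl
    obtain ⟨p, hp, hp', hx⟩ := (key l hl).1 hx
    exact ⟨p, hp'.trans_le (h.le_n hl), hx⟩
  · rintro ⟨p, hp, hx⟩
    obtain ⟨l, hl, h1, h2⟩ := h.exists_block hp
    exact ⟨_, List.mem_map.2 ⟨l, List.mem_range.2 hl, rfl⟩, (key l hl).2 ⟨p, h1, h2, hx⟩⟩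

theorem mem_flatten_blocks (h : Cuts n m s) {x : ℤ} :
    x ∈ (blocks s m e).flatten ↔ ∃ p < n, x = e p := by
  rw [blocks, List.mem_flatten]
  constructor
  · rintro ⟨c, hc, hx⟩
    obtain ⟨l, hl, rfl⟩ := List.mem_map.1 hc
    obtain ⟨p, hp, rfl⟩ := List.mem_map.1 hx
    have hl := List.mem_range.1 hl
    have hp := List.mem_range'_1.1 hp
    have := h.le_n (j := l + 1) hl
    exact ⟨p, by omega, rfl⟩
  · rintro ⟨p, hp, rfl⟩
    obtain ⟨l, hl, h1, h2⟩ := h.exists_block hp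
    refine ⟨_, List.mem_map.2 ⟨l, List.mem_range.2 hl, rfl⟩, List.mem_map.2 ⟨p, ?_, rfl⟩⟩
    exact List.mem_range'_1.2 ⟨h1, by omega⟩

theorem cycleVal_blocks (h : Cuts n m s) (hl : IsLabeling n e) {p : ℕ} (hp : p < n) {x : ℤ}
    (hx : x.natAbs = (e p).natAbs) : cycleVal (blocks s m e) x = x.sign * e (nxt s m p) := by
  have h1 : (arrows (blocks s m e)).find? (fun y => y.1.natAbs == x.natAbs) =
      some (e p, e (nxt s m p)) := by
    refine find?_eq_some_of_unique ((mem_arrows_blocks h).2 ⟨p, hp, rfl⟩) (by simp [hx]) ?_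
    intro y hy hy'
    obtain ⟨q, hq, rfl⟩ := (mem_arrows_blocks h).1 hy
    have : (e q).natAbs = x.natAbs := by simpa using hy'
    rw [hl.inj q p hq.le hp.le (this.trans hx)]
  rw [cycleVal, h1]

theorem cycleVal_blocks_natAbs (h : Cuts n m s) (hl : IsLabeling n e) {p : ℕ} (hp : p < n) :
    cycleVal (blocks s m e) ((e p).natAbs : ℤ) = e (nxt s m p) := by
  rw [cycleVal_blocks h hl hp (Int.natAbs_natCast _), Int.sign_eq_one_of_pos, one_mul]
  have := hl.bd p hp
  omega

theorem prec_blocks (h : Cuts n m s) (hl : IsLabeling n e) {p : ℕ} (hp : p < n) :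
    prec (blocks s m e) (e (nxt s m p)) = e p := by
  have h1 : (arrows (blocks s m e)).find? (fun y => y.2 == e (nxt s m p)) =
      some (e p, e (nxt s m p)) := by
    refine find?_eq_some_of_unique ((mem_arrows_blocks h).2 ⟨p, hp, rfl⟩) (by simp) ?_
    intro y hy hy'
    obtain ⟨q, hq, rfl⟩ := (mem_arrows_blocks h).1 hy
    have h2 : e (nxt s m q) = e (nxt s m p) := by simpa using hy'
    have h3 : ∀ q, q < n → nxt s m q < n := by
      intro q hq
      have := h.nxt_lt le_rfl (p := q) (by rwa [h.last])
      rwa [h.last] at this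
    have h4 := hl.inj _ _ (h3 q hq).le (h3 p hp).le (congrArg Int.natAbs h2)
    rw [h.nxt_inj le_rfl (by rwa [h.last]) (by rwa [h.last]) h4]
  rw [prec, h1]

theorem appearing_blocks (h : Cuts n m s) (hl : IsLabeling n e) {p : ℕ} (hp : p < n) {y : ℤ}
    (hy : y.natAbs = (e p).natAbs) : appearing (blocks s m e) y = e p := by
  unfold appearing
  split_ifs with h1
  · obtain ⟨q, hq, rfl⟩ := (mem_flatten_blocks h).1 h1
    rw [hl.inj q p hq.le hp.le hy]
  · rcases Int.natAbs_eq_natAbs_iff.1 hy with h2 | h2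
    · exact absurd ((mem_flatten_blocks h).2 ⟨p, hp, h2⟩) h1
    · rw [h2, neg_neg]

theorem firstOf_blocks (h : Cuts n m s) {j : ℕ} (hj : j < m) :
    firstOf (blocks s m e) j = e (s j) := by
  have h1 := h.lt j hj
  obtain ⟨d, hd⟩ : ∃ d, s (j + 1) - s j = d + 1 := ⟨s (j + 1) - s j - 1, by omega⟩
  simp [firstOf, blocks, hj, hd, List.range'_succ]

theorem lastOf_blocks (h : Cuts n m s) {j : ℕ} (hj : j < m) :
    lastOf (blocks s m e) j = e (s (j + 1) - 1) := by
  have h1 := h.lt j hj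
  obtain ⟨d, hd⟩ : ∃ d, s (j + 1) - s j = d + 1 := ⟨s (j + 1) - s j - 1, by omega⟩
  have h2 : s (j + 1) - 1 = s j + d := by omega
  simp [lastOf, blocks, hj, hd, h2, List.range'_concat]

theorem blocks_congr (h : Cuts n m s) {f : ℕ → ℤ} (hef : ∀ p < n, e p = f p) :
    blocks s m e = blocks s m f := by
  unfold blocks
  refine List.map_congr_left fun l hl => List.map_congr_left fun p hp => hef p ?_
  have hl := List.mem_range.1 hl
  have hp := List.mem_range'_1.1 hp
  have := h.le_n (j := l + 1) hl
  omega

theorem map_map_blocks (g : ℤ → ℤ) :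
    ((blocks s m e).map fun l => l.map g) = blocks s m (g ∘ e) := by
  simp [blocks, Function.comp_def]

theorem sign_mul_abs {u w : ℤ} (hu : u ≠ 0) : u.sign * |w| = withSign u w := by
  unfold withSign
  rw [Int.abs_eq_natAbs]
  split_ifs with h
  · rw [Int.sign_eq_neg_one_of_neg h]; ring
  · rw [Int.sign_eq_one_of_pos (by omega)]; ring

theorem replaceEntries_blocks (h : Cuts n m s) (hl : IsLabeling n e) {i k : ℕ} (hi : i < n)
    (hk : k < n) : replaceEntries (blocks s m e) (e i) (e k) = blocks s m (swapAbs e i k) := by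
  rw [replaceEntries, map_map_blocks]
  refine blocks_congr h fun p hp => ?_
  have h1 : e p = e i ↔ p = i :=
    ⟨fun h' => hl.inj _ _ hp.le hi.le (congrArg _ h'), fun h' => by rw [h']⟩
  have h2 : e p = e k ↔ p = k :=
    ⟨fun h' => hl.inj _ _ hp.le hk.le (congrArg _ h'), fun h' => by rw [h']⟩
  simp only [Function.comp, swapAbs, h1, h2, sign_mul_abs (hl.ne_zero hi.le),
    sign_mul_abs (hl.ne_zero hk.le)]

/-- The condition `P` says that the two positions are adjacent and in the wrong order. -/
theorem P_blocks (h : Cuts n m s) (hl : IsLabeling n e) (π : ℤ → ℤ) {p q : ℕ} (hp : p < n)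
    (hq : q < n) : P n π (cycleVal (blocks s m e)) (e p).natAbs (e q).natAbs = true ↔
      Adj (e p) (e q) ∧ ¬ Ok (Des (n + 1) π) (nxt s m) e p q := by
  have bp := hl.bd p hp
  have bq := hl.bd q hq
  have h3 : ∀ q, q < n → nxt s m q < n := by
    intro q hq
    have := h.nxt_lt le_rfl (p := q) (by rwa [h.last])
    rwa [h.last] at this
  have key : ∀ p q, p < n → q < n → (e p).natAbs + 1 = (e q).natAbs →
      ((e p).natAbs ∈ Des n (cycleVal (blocks s m e)) ↔ e (nxt s m q) < e (nxt s m p)) := by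
    intro p q hp hq hpq
    have hq' := hl.bd q hq
    rw [Des, Finset.mem_filter, Finset.mem_range, cycleVal_blocks_natAbs h hl hp,
      show ((e p).natAbs : ℤ) + 1 = ((e q).natAbs : ℤ) by omega, cycleVal_blocks_natAbs h hl hq]
    constructor
    · exact fun h' => h'.2
    · exact fun h' => ⟨by omega, h'⟩
  have hne : Adj (e p) (e q) → e (nxt s m p) ≠ e (nxt s m q) := by
    intro hadj h'
    have h4 := hl.inj _ _ (h3 p hp).le (h3 q hq).le (congrArg Int.natAbs h')
    have h5 := h.nxt_inj le_rfl (by rwa [h.last]) (by rwa [h.last]) h4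
    rw [h5] at hadj
    exact hadj.ne rfl
  rw [P, decide_eq_true_iff]
  unfold Ok
  by_cases hadj : Adj (e p) (e q)
  · have hne := hne hadj
    have hadj' := hadj
    unfold Adj at hadj
    rw [Finset.mem_inter, Finset.mem_symmDiff]
    rcases hadj with h1 | h1
    · have h2 := key p q hp hq h1
      rw [min_eq_left (by omega), h2, Target, if_pos (by omega)]
      have h4 : (e p).natAbs ∈ Finset.Icc 1 (n - 1) := Finset.mem_Icc.2 (by omega)
      have h5 : e (nxt s m q) < e (nxt s m p) ↔ ¬ e (nxt s m p) < e (nxt s m q) := by omega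
      tauto
    · have h2 := key q p hq hp h1
      rw [min_eq_right (by omega), h2, Target, if_neg (by omega)]
      have h4 : (e q).natAbs ∈ Finset.Icc 1 (n - 1) := Finset.mem_Icc.2 (by omega)
      tauto
  · have h1 : ¬ ((e p).natAbs + 1 = (e q).natAbs ∨ (e q).natAbs + 1 = (e p).natAbs) := hadj
    tauto

end Blocks

/-! ### The loops of the algorithm -/

/-- The loop `while cond do s := body s`, started at `s`, terminates at `t`. -/
inductive LoopTo {α : Type} (cond : α → Prop) (body : α → α) : α → α → Prop
  | done {s : α} (h : ¬ cond s) : LoopTo cond body s s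
  | step {s t : α} (h : cond s) (h' : LoopTo cond body (body s) t) : LoopTo cond body s t

theorem LoopTo.whileLoop_eq {α : Type} {cond : α → Prop} {body : α → α} {s t : α}
    (h : LoopTo cond body s t) : whileLoop cond body s = t := by
  classical
  have key : ∃ k, t = body^[k] s ∧ ¬ cond (body^[k] s) ∧ ∀ i < k, cond (body^[i] s) := by
    induction h with
    | done h => exact ⟨0, rfl, h, fun _ h => absurd h (Nat.not_lt_zero _)⟩
    | step h h' ih =>
      obtain ⟨k, h1, h2, h3⟩ := ih
      refine ⟨k + 1, h1, h2, fun i hi => ?_⟩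
      cases i with
      | zero => exact h
      | succ i => exact h3 i (by omega)
  obtain ⟨k, h1, h2, h3⟩ := key
  have hex : ∃ k, ¬ cond (body^[k] s) := ⟨k, h2⟩
  rw [whileLoop, dif_pos hex, h1]
  congr 1
  exact ((Nat.find_eq_iff hex).2 ⟨h2, fun i hi => not_not.2 (h3 i hi)⟩)

/-- Each cycle begins with its largest entry, and these entries increase, up to the last place. -/
structure Heads (s : ℕ → ℕ) (m : ℕ) (e : ℕ → ℤ) : Prop where
  max : ∀ l < m, ∀ p, s l < p → p < s (l + 1) → e p < e (s l)
  lt : ∀ l < m, e (s l) < e (s (l + 1))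

section

variable {n m : ℕ} {s : ℕ → ℕ} {e f : ℕ → ℤ}

theorem Heads.mono (hd : Heads s m e) {i j : ℕ} (hij : i ≤ j) (hj : j ≤ m) :
    e (s i) ≤ e (s j) := by
  induction j with
  | zero => rw [Nat.le_zero.1 hij]
  | succ j ih =>
    rcases hij.lt_or_eq with h1 | h1
    · exact (ih (by omega) (by omega)).trans (hd.lt j (by omega)).le
    · rw [h1]

theorem Heads.le_head (hd : Heads s m e) {l p : ℕ} (hl : l < m) (h1 : s l ≤ p)
    (h2 : p < s (l + 1)) : e p ≤ e (s l) := by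
  rcases h1.lt_or_eq with h1 | h1
  · exact (hd.max l hl p h1 h2).le
  · rw [h1]

theorem Heads.headMax (hd : Heads s m e) (h : Cuts n m s) {j : ℕ} (hj : j < m) :
    HeadMax (h.frame hj) e := by
  intro p hp hpa
  have hz := h.frame_z hj
  rw [h.frame_a] at hpa ⊢
  obtain ⟨l, hl, h1, h2⟩ := h.exists_block_lt (p := p) (j := j + 1) (by omega) (by omega)
  by_cases hlj : l = j
  · subst hlj
    exact hd.max l (by omega) p (by omega) h2
  · have h3 := hd.le_head (by omega) h1 h2
    have h4 := hd.lt l (by omega)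
    have h5 := hd.mono (i := l + 1) (j := j) (by omega) (by omega)
    omega

theorem Heads.of_order (hd : Heads s m e) (h : Cuts n m s) {j : ℕ} (hj : j < m)
    (low : ∀ p q, p ≤ (h.frame hj).z → q ≤ (h.frame hj).z → (f p < f q ↔ e p < e q))
    (high : ∀ p q, (h.frame hj).z < p → p ≤ n → (h.frame hj).z < q → q ≤ n →
      (f p < f q ↔ e p < e q))
    (head : f (h.frame hj).a < f ((h.frame hj).z + 1)) : Heads s m f := by
  have hz := h.frame_z hj
  rw [hz, h.frame_a] at head
  constructor
  · intro l hl p h1 h2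
    have hn := h.le_n (j := l + 1) hl
    by_cases hlj : l ≤ j
    · have := h.mono (i := l + 1) (j := j + 1) (by omega) (by omega)
      exact (low _ _ (by omega) (by omega)).2 (hd.max l hl p h1 h2)
    · have := h.mono (i := j + 1) (j := l) (by omega) (by omega)
      exact (high _ _ (by omega) (by omega) (by omega) (by omega)).2 (hd.max l hl p h1 h2)
  · intro l hl
    have hn := h.le_n (j := l + 1) hl
    have hlt := h.lt l hl
    rcases lt_trichotomy l j with hlj | hlj | hlj
    · have := h.mono (i := l + 1) (j := j) (by omega) (by omega)
      have := h.lt j hj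
      exact (low _ _ (by omega) (by omega)).2 (hd.lt l hl)
    · subst hlj; exact head
    · have := h.mono (i := j + 1) (j := l) (by omega) (by omega)
      exact (high _ _ (by omega) (by omega) (by omega) (by omega)).2 (hd.lt l hl)

theorem ChainOrder.heads {h : Cuts n m s} {j : ℕ} {hj : j < m} {k : ℕ}
    (ho : ChainOrder (h.frame hj) k e f) (hd : Heads s m e) : Heads s m f :=
  hd.of_order h hj ho.low ho.high ho.head

/-- As far as positions in the first `j + 1` cycles are concerned, it does not matter whether the
later cycles are closed. -/
theorem Heads.ok_iff (hd : Heads s m e) (h : Cuts n m s) {j : ℕ} (hj : j < m)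
    {D : Finset ℕ} {p q : ℕ} (hp : p ≤ (h.frame hj).z) (hq : q < n) :
    Ok D (nxt s m) e p q ↔ Ok D (h.frame hj).cl e p q := by
  have hz := h.frame_z hj
  have key : ∀ p ≤ (h.frame hj).z, nxt s m p = nxt s (j + 1) p := by
    intro p hp
    obtain ⟨l, hl, h1, h2⟩ := h.exists_block_lt (p := p) (j := j + 1) (by omega) (by omega)
    rw [h.nxt_block le_rfl (by omega) h1 h2, h.nxt_block (by omega) hl h1 h2]
  rw [h.frame_cl]
  unfold Ok
  rw [key p hp]
  suffices e (nxt s (j + 1) p) < e (nxt s m q) ↔ e (nxt s (j + 1) p) < e (nxt s (j + 1) q) by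
    rw [this]
  by_cases hqz : q ≤ (h.frame hj).z
  · rw [key q hqz]
  have h1 : e (nxt s (j + 1) p) ≤ e (s j) := by
    rw [← h.frame_cl hj, ← h.frame_a hj]
    exact (hd.headMax h hj).le ((h.frame hj).cl_le hp)
  -- At the end of a later cycle, its head is exchanged for the next one; both exceed `e a`.
  obtain ⟨l, hlm, h2, h3⟩ := h.exists_block hq
  rw [h.nxt_block le_rfl hlm h2 h3, h.nxt_of_le (j := j + 1) (p := q) (by omega) (by omega)]
  split_ifs with h4
  · have hjl : j < l := by
      by_contra hcon
      have := h.mono (i := l + 1) (j := j + 1) (by omega) (by omega)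
      omega
    have h5 := hd.lt j hj
    have h6 := hd.mono (i := j + 1) (j := l) (by omega) (by omega)
    have h7 := hd.lt l hlm
    rw [h4]
    exact iff_of_true (by omega) (by omega)
  · rfl

/-- One pass of the inner loop that involves the first entry of the cycle. -/
theorem innerBody_first (h : Cuts n m s) (hl : IsLabeling n e) {j k : ℕ} (hj : j < m)
    (hk : k < n) : innerBody j (blocks s m e, e (s j), e k) =
      (blocks s m (swapAbs e (s j) k), e (s j), e k) := by
  have h1 := (h.frame hj).lt
  have h2 := (h.frame hj).le
  rw [h.frame_a] at h2
  rw [innerBody]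
  simp only
  rw [firstOf_blocks h hj, if_pos (Or.inl rfl), replaceEntries_blocks h hl (by omega) hk]

/-- One pass of the inner loop that does not involve the first entry of the cycle. -/
theorem innerBody_blocks (h : Cuts n m s) (hl : IsLabeling n e) {j i k i' k' : ℕ} (hj : j < m)
    (hi : i < n) (hk : k < n) (hi' : i' < n) (hk' : k' < n) (hik : i ≠ k)
    (hsi : nxt s m i' = i) (hsk : nxt s m k' = k) (hai : i ≠ s j) (hak : k ≠ s j) :
    innerBody j (blocks s m e, e i, e k) =
      (blocks s m (swapAbs e i k), swapAbs e i k i', swapAbs e i k k') := by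
  have h1 := (h.frame hj).lt
  have h2 := (h.frame hj).le
  rw [h.frame_a] at h2
  have hl' := hl.swapAbs hi hk
  have h3 : ¬ (e (s j) = e i ∨ e (s j) = e k) := by
    rintro (h' | h')
    · exact hai (hl.inj _ _ (by omega) hi.le (congrArg _ h')).symm
    · exact hak (hl.inj _ _ (by omega) hk.le (congrArg _ h')).symm
  rw [innerBody]
  simp only
  rw [firstOf_blocks h hj, if_neg h3, replaceEntries_blocks h hl hi hk,
    sign_mul_abs (hl.ne_zero hi.le), sign_mul_abs (hl.ne_zero hk.le), ← swapAbs_left,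
    ← swapAbs_right hik]
  have h4 := prec_blocks h hl' hi'
  have h5 := prec_blocks h hl' hk'
  rw [hsi] at h4
  rw [hsk] at h5
  rw [h4, h5]

theorem P_comm (n : ℕ) (π σ : ℤ → ℤ) (x y : ℕ) : P n π σ x y = P n π σ y x := by
  rw [P, P, decide_eq_decide, min_comm, or_comm]

variable {π : ℤ → ℤ} {δ : ℤ}

/-- The condition of the inner loop for the places `p` and `q`. -/
theorem Heads.P_iff (hd : Heads s m e) (h : Cuts n m s) (hl : IsLabeling n e) {j : ℕ} (hj : j < m)
    {p q : ℕ} (hp : p ≤ (h.frame hj).z) (hq : q < n) :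
    P n π (cycleVal (blocks s m e)) (e p).natAbs (e q).natAbs = true ↔
      ¬ Ok (Des (n + 1) π) (h.frame hj).cl e p q := by
  have h1 := (h.frame hj).lt
  rw [P_blocks h hl π (by omega) hq, hd.ok_iff h hj hp hq]
  constructor
  · exact fun h' => h'.2
  · intro h'
    refine ⟨?_, h'⟩
    by_contra hadj
    exact h' fun h'' => absurd h'' hadj

/-- The head of a later cycle is too large to take part in an exchange of entries of the same sign
that lets the chain go on. -/
theorem Heads.pred_eq (hd : Heads s m e) (h : Cuts n m s) {j i k k₀ : ℕ} (hj : j < m)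
    (hk : (h.frame hj).z < k) (hk' : k < n) (hi : i ≤ (h.frame hj).z)
    (hadj : Adj (e i) (e k)) (hs : SameSign (e i) (e k)) (hbtw : e (s j) < e (k₀ + 1))
    (hbtw' : e (k₀ + 1) < e (s (j + 1))) : nxt s m (k - 1) = k := by
  have hz := h.frame_z hj
  obtain ⟨l, hlm, h2, h3⟩ := h.exists_block hk'
  have hjl : j < l := by
    by_contra hcon
    have := h.mono (i := l + 1) (j := j + 1) (by omega) (by omega)
    omega
  have h4 : k ≠ s l := by
    rintro rfl
    have h5 := hd.mono (i := j + 1) (j := l) (by omega) (by omega)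
    have h6 := (hd.headMax h hj).le hi
    rw [h.frame_a] at h6
    unfold Adj at hadj
    unfold SameSign at hs
    omega
  rw [h.nxt_block le_rfl hlm (by omega) (by omega), if_neg (by omega)]
  omega

theorem exists_pred_gt (h : Cuts n m s) {j k : ℕ} (hj : j < m) (hk : (h.frame hj).z < k)
    (hk' : k < n) : ∃ k', (h.frame hj).z < k' ∧ k' < n ∧ nxt s m k' = k := by
  have hz := h.frame_z hj
  obtain ⟨l, hlm, h2, h3⟩ := h.exists_block hk'
  have hjl : j < l := by
    by_contra hcon
    have := h.mono (i := l + 1) (j := j + 1) (by omega) (by omega)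
    omega
  obtain ⟨k', h4, h5, h6⟩ := h.exists_pred hlm h2 h3
  have := h.mono (i := j + 1) (j := l) (by omega) (by omega)
  have := h.le_n (j := l + 1) hlm
  exact ⟨k', by omega, by omega, h6⟩

theorem nxt_pred (h : Cuts n m s) {j i : ℕ} (hj : j < m) (hi : s j < i)
    (hi' : i ≤ (h.frame hj).z) : nxt s m (i - 1) = i := by
  have hz := h.frame_z hj
  rw [h.nxt_block le_rfl hj (by omega) (by omega), if_neg (by omega)]
  omega

/-- The inner loop, from its second pass on, performs a chain of exchanges. -/
theorem ChainState.innerLoop {h : Cuts n m s} {j : ℕ} {hj : j < m} {k₀ i k : ℕ}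
    (hc : ChainState (Des (n + 1) π) (h.frame hj) δ k₀ e i k) (hd : Heads s m e) :
    ∃ x y, LoopTo (fun t => P n π (cycleVal t.1) t.2.1.natAbs t.2.2.natAbs = true) (innerBody j)
      (blocks s m e, e i, e k) (blocks s m (chain e i k (i - s j)), x, y) := by
  obtain ⟨d, hdd⟩ : ∃ d, i - s j = d := ⟨_, rfl⟩
  rw [hdd]
  induction d generalizing e i k with
  | zero =>
    have hz := (h.frame hj).lt
    have hi := hc.hi
    have hk' := hc.k_le
    have hk₀ := hc.k₀_lt
    have hkz := hc.hk
    have hlo := hc.lo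
    rw [h.frame_a] at hlo
    obtain rfl : i = s j := by omega
    refine ⟨e (s j), e k, .step ((hd.P_iff h hc.lab hj hi.le (by omega)).2 hc.wrong) ?_⟩
    rw [innerBody_first h hc.lab hj (by omega), chain]
    refine .done ?_
    have hE := hc.chainEnd (by rw [h.frame_a]; omega)
    have hd' := hc.order.heads hd
    have h1 := hd'.P_iff (π := π) h hE.lab hj (p := s j) (q := k) hi.le (by omega)
    rw [natAbs_swapAbs_left, natAbs_swapAbs_right] at h1
    simp only
    rw [P_comm, h1, not_not]
    exact hE.ok _ _ (by omega) (by omega) hi.ne hkz.ne'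
  | succ d ih =>
    have hz := (h.frame hj).lt
    have haz := (h.frame hj).le
    have hi := hc.hi
    have hk' := hc.k_le
    have hk₀ := hc.k₀_lt
    have hkz := hc.hk
    have hlo := hc.lo
    rw [h.frame_a] at hlo haz
    have hP := (hd.P_iff h hc.lab hj hi.le (by omega)).2 hc.wrong
    have hpi := nxt_pred h hj (i := i) (by omega) hi.le
    rw [chain]
    split_ifs with hcond
    · have hb := hc.btw'
      rw [h.frame_z] at hb
      have hpk := hd.pred_eq h hj hkz (by omega) hi.le hc.adj hcond.1 hc.btw hb
      have hnext := hc.next (by rw [h.frame_a]; omega) hcond.1 hcond.2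
      obtain ⟨x, y, h1⟩ := ih hnext (hc.order.heads hd) (by omega)
      refine ⟨x, y, .step hP ?_⟩
      rwa [innerBody_blocks h hc.lab hj (by omega) (by omega) (by omega) (by omega) (by omega) hpi
        hpk (by omega) (by omega)]
    · obtain ⟨k', h1, h2, h3⟩ := exists_pred_gt h hj hkz (by omega)
      refine ⟨swapAbs e i k (i - 1), swapAbs e i k k', .step hP ?_⟩
      rw [innerBody_blocks h hc.lab hj (by omega) (by omega) (by omega) h2 (by omega) hpi
        h3 (by omega) (by omega)]
      refine .done ?_
      have hE := hc.chainEnd (fun _ h5 h6 => hcond ⟨h5, h6⟩)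
      have hd' := hc.order.heads hd
      simp only
      rw [hd'.P_iff h hE.lab hj (by omega) h2, not_not]
      exact hE.ok _ _ (by omega) (by omega) (by omega) (by omega)

/-- The inner loop performs a chain of exchanges. -/
theorem StartState.innerLoop_eq {h : Cuts n m s} {j : ℕ} {hj : j < m} {k : ℕ}
    (hc : StartState (Des (n + 1) π) (h.frame hj) δ e k) (hd : Heads s m e) :
    (innerLoop n π j (blocks s m e, e (h.frame hj).z, e k)).1 =
      blocks s m (chain e (h.frame hj).z k ((h.frame hj).z - s j)) := by
  suffices H : ∃ x y, LoopTo (fun t => P n π (cycleVal t.1) t.2.1.natAbs t.2.2.natAbs = true)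
      (innerBody j) (blocks s m e, e (h.frame hj).z, e k)
      (blocks s m (chain e (h.frame hj).z k ((h.frame hj).z - s j)), x, y) by
    obtain ⟨x, y, H⟩ := H
    rw [innerLoop, H.whileLoop_eq]
  have hz := (h.frame hj).lt
  have haz := (h.frame hj).le
  have hk := hc.hk
  have hk' := hc.k_lt
  rw [h.frame_a] at haz
  have hP := (hd.P_iff h hc.lab hj le_rfl hk').2 hc.wrong
  cases hdd : (h.frame hj).z - s j with
  | zero =>
    have hzs : (h.frame hj).z = s j := by omega
    refine ⟨e (s j), e k, .step hP ?_⟩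
    rw [hzs, innerBody_first h hc.lab hj hk', chain]
    refine .done ?_
    have hE := hc.chainEnd (by rw [h.frame_a]; omega)
    have hd' := hc.order.heads hd
    have h1 := hd'.P_iff (π := π) h hE.lab hj le_rfl hk'
    have hδ := hc.dir
    have hb := hc.back_swapAbs
    have h3 := hE.ok_z k hk' (by omega)
    rw [hzs] at h1 h3
    rw [natAbs_swapAbs_left, natAbs_swapAbs_right] at h1
    simp only
    rw [P_comm, h1, not_not]
    exact h3
  | succ d =>
    have hpi := nxt_pred h hj (i := (h.frame hj).z) (by omega) le_rfl
    rw [chain]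
    split_ifs with hcond
    · have hb := hc.btw'
      rw [h.frame_z] at hb
      have hpk := hd.pred_eq h hj hk hk' le_rfl hc.adj hcond.1 hc.btw hb
      have hnext := hc.next (by rw [h.frame_a]; omega) hcond.1 hcond.2
      obtain ⟨x, y, h1⟩ := hnext.innerLoop (hc.order.heads hd)
      rw [show (h.frame hj).z - 1 - s j = d by omega] at h1
      refine ⟨x, y, .step hP ?_⟩
      rwa [innerBody_blocks h hc.lab hj (by omega) (by omega) (by omega) (by omega) (by omega) hpi
        hpk (by omega) (by omega)]
    · obtain ⟨k', h1, h2, h3⟩ := exists_pred_gt h hj hk hk'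
      refine ⟨swapAbs e (h.frame hj).z k ((h.frame hj).z - 1), swapAbs e (h.frame hj).z k k',
        .step hP ?_⟩
      rw [innerBody_blocks h hc.lab hj (by omega) (by omega) (by omega) h2 (by omega) hpi
        h3 (by omega) (by omega)]
      refine .done ?_
      have hE := hc.chainEnd (fun _ h5 h6 => hcond ⟨h5, h6⟩)
      have hd' := hc.order.heads hd
      simp only
      rw [hd'.P_iff h hE.lab hj (by omega) h2, not_not]
      exact hE.ok _ _ (by omega) (by omega) (by omega) (by omega)

end

section

variable {n m : ℕ} {s : ℕ → ℕ} {e f : ℕ → ℤ} {π : ℤ → ℤ}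

/-- The direction in which the absolute value of `z ≠ 0` moves when `ε` is added to `z`. -/
def direction (ε z : ℤ) : ℤ := if z < 0 then -ε else ε

theorem natAbs_add_direction {ε z : ℤ} (hε : ε = 1 ∨ ε = -1) (hz : z ≠ 0) :
    ((z + ε).natAbs : ℤ) = z.natAbs + direction ε z := by
  unfold direction; split_ifs <;> omega

theorem direction_unit {ε z : ℤ} (hε : ε = 1 ∨ ε = -1) :
    direction ε z = 1 ∨ direction ε z = -1 := by
  unfold direction; split_ifs <;> omega

/-- The condition of the outer loop. -/
theorem outer_iff (h : Cuts n m s) (hl : IsLabeling n e) (hd : Heads s m e) {j : ℕ} (hj : j < m)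
    {ε : ℤ} (hε : ε = 1 ∨ ε = -1) :
    P n π (cycleVal (blocks s m e)) (lastOf (blocks s m e) j).natAbs
      (lastOf (blocks s m e) j + ε).natAbs = true ↔
    ∃ k < n, ((e k).natAbs : ℤ) = (e (h.frame hj).z).natAbs + direction ε (e (h.frame hj).z) ∧
      ¬ Ok (Des (n + 1) π) (h.frame hj).cl e (h.frame hj).z k := by
  have hz := (h.frame hj).lt
  have hdir := natAbs_add_direction hε (hl.ne_zero hz.le)
  rw [lastOf_blocks h hj]
  change P n π (cycleVal (blocks s m e)) (e (h.frame hj).z).natAbs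
      (e (h.frame hj).z + ε).natAbs = true ↔ _
  constructor
  · intro hP
    have hP' := hP
    rw [P, decide_eq_true_iff, Finset.mem_inter, Finset.mem_Icc] at hP'
    have hb := hl.bd _ hz
    obtain ⟨k, hk, hke⟩ := hl.surj (r := (e (h.frame hj).z + ε).natAbs) (by omega) (by omega)
    rw [← hke, hd.P_iff h hl hj le_rfl hk] at hP
    exact ⟨k, hk, by rw [hke, hdir], hP⟩
  · rintro ⟨k, hk, hke, hw⟩
    rw [← hdir] at hke
    rw [← Int.ofNat.inj hke, hd.P_iff h hl hj le_rfl hk]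
    exact hw

/-- The outer loop for the `j`-th cycle in the direction `ε` turns `c` into `c'`. -/
def OuterTo (n : ℕ) (π : ℤ → ℤ) (j : ℕ) (ε : ℤ) (c c' : List (List ℤ)) : Prop :=
  LoopTo (fun c => P n π (cycleVal c) (lastOf c j).natAbs (lastOf c j + ε).natAbs = true)
    (fun c => (innerLoop n π j (c, lastOf c j, appearing c (lastOf c j + ε))).1) c c'

theorem OuterTo.outerLoop_eq {j : ℕ} {ε : ℤ} {c c' : List (List ℤ)} (h : OuterTo n π j ε c c') :
    outerLoop n π j ε c = c' := h.whileLoop_eq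

/-- The body of the outer loop is a chain of exchanges. -/
theorem StartState.outerBody {h : Cuts n m s} {j : ℕ} {hj : j < m} {ε : ℤ} (hε : ε = 1 ∨ ε = -1)
    {k : ℕ} (hS : StartState (Des (n + 1) π) (h.frame hj) (direction ε (e (h.frame hj).z)) e k)
    (hd : Heads s m e) :
    (innerLoop n π j (blocks s m e, lastOf (blocks s m e) j,
      appearing (blocks s m e) (lastOf (blocks s m e) j + ε))).1 =
      blocks s m (chain e (h.frame hj).z k ((h.frame hj).z - (h.frame hj).a)) := by
  have hz := (h.frame hj).lt
  have hf := hS.front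
  have h1 : lastOf (blocks s m e) j = e (h.frame hj).z := lastOf_blocks h hj
  have h2 : appearing (blocks s m e) (e (h.frame hj).z + ε) = e k := by
    refine appearing_blocks h hS.lab hS.k_lt ?_
    have := natAbs_add_direction hε (hS.lab.ne_zero hz.le)
    omega
  rw [h1, h2]
  exact hS.innerLoop_eq hd

/-- The outer loop performs a run of chains, until the position next to the last entry of the cycle
is right. -/
theorem outerTo_blocks (h : Cuts n m s) {j : ℕ} (hj : j < m) {ε : ℤ} (hε : ε = 1 ∨ ε = -1)
    (hm : Mid (Des (n + 1) π) (h.frame hj) (direction ε (e (h.frame hj).z)) e)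
    (hd : Heads s m e) :
    ∃ f, OuterTo n π j ε (blocks s m e) (blocks s m f) ∧
      (∀ g, Run (Des (n + 1) π) (h.frame hj) (direction ε (e (h.frame hj).z)) g e →
        Run (Des (n + 1) π) (h.frame hj) (direction ε (e (h.frame hj).z)) g f) ∧
      ∀ k < n, ((f k).natAbs : ℤ) = (f (h.frame hj).z).natAbs +
        direction ε (e (h.frame hj).z) → Ok (Des (n + 1) π) (h.frame hj).cl f (h.frame hj).z k := by
  suffices H : ∀ N : ℕ, ∀ e, Mid (Des (n + 1) π) (h.frame hj) (direction ε (e (h.frame hj).z)) e →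
      Heads s m e →
      (n : ℤ) - direction ε (e (h.frame hj).z) * (e (h.frame hj).z).natAbs < N →
      ∃ f, OuterTo n π j ε (blocks s m e) (blocks s m f) ∧
      (∀ g, Run (Des (n + 1) π) (h.frame hj) (direction ε (e (h.frame hj).z)) g e →
        Run (Des (n + 1) π) (h.frame hj) (direction ε (e (h.frame hj).z)) g f) ∧
      ∀ k < n, ((f k).natAbs : ℤ) = (f (h.frame hj).z).natAbs +
        direction ε (e (h.frame hj).z) →
          Ok (Des (n + 1) π) (h.frame hj).cl f (h.frame hj).z k by
    exact H ((n : ℤ) - direction ε (e (h.frame hj).z) *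
      (e (h.frame hj).z).natAbs + 1).toNat e hm hd (by omega)
  clear hm hd
  intro N
  induction N with
  | zero =>
    intro e hm hd hN
    have hb := hm.lab.bd _ (h.frame hj).lt
    rcases direction_unit (z := e (h.frame hj).z) hε with h1 | h1 <;> rw [h1] at hN <;> omega
  | succ N ih =>
    intro e hm hd hN
    by_cases hP : P n π (cycleVal (blocks s m e)) (lastOf (blocks s m e) j).natAbs
      (lastOf (blocks s m e) j + ε).natAbs = true
    · obtain ⟨k, hk, hf, hw⟩ := (outer_iff h hm.lab hd hj hε).1 hP
      have hS := hm.startState hk hf hw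
      obtain ⟨ho, hB, hM⟩ := hS.back_chain
      have hz := (h.frame hj).lt
      have hbody := hS.outerBody hε hd
      have hneg := ho.neg (h.frame hj).z
      have hdir : direction ε (chain e (h.frame hj).z k ((h.frame hj).z - (h.frame hj).a)
          (h.frame hj).z) = direction ε (e (h.frame hj).z) := by
        unfold direction; simp only [hneg]
      have hb := hB.natAbs_eq
      have hlab' := ho.lab
      have hd' := ho.heads hd
      have hkb := natAbs_chain (e := e) (i := (h.frame hj).z) (k := k)
        (d := min ((h.frame hj).z - (h.frame hj).a) (k - (h.frame hj).z - 1)) (by omega)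
        (by have := hS.hk; omega)
      rw [← hS.chain_eq_min] at hkb
      rw [← hdir] at hM
      obtain ⟨f, h1, h2, h3⟩ := ih _ hM hd' (by
        rw [hdir]
        rw [hkb.1, hf]
        rcases direction_unit (z := e (h.frame hj).z) hε with h1 | h1 <;> rw [h1] at hN ⊢ <;>
          omega)
      refine ⟨f, .step hP ?_, ?_, ?_⟩
      · simp only [hbody]
        exact h1
      · intro g hg
        rw [hdir] at h2
        exact h2 g (hg.step k hk hf hw)
      · rw [hdir] at h3
        exact h3
    · refine ⟨e, .done hP, fun g hg => hg, fun k hk hf => ?_⟩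
      by_contra hw
      exact hP ((outer_iff h hm.lab hd hj hε).2 ⟨k, hk, hf, hw⟩)

theorem Ready.closes (h : Cuts n m s) {j : ℕ} (hj : j < m) {ε : ℤ} (hε : ε = 1 ∨ ε = -1)
    (hr : Ready (Des (n + 1) π) (h.frame hj) e) (hd : Heads s m e)
    (hc : Choice (Des (n + 1) π) (h.frame hj) (direction ε (e (h.frame hj).z)) e)
    (hP : P n π (cycleVal (blocks s m e)) (lastOf (blocks s m e) j).natAbs
      (lastOf (blocks s m e) j + ε).natAbs = true) :
    ∃ f, outerLoop n π j ε (blocks s m e) = blocks s m f ∧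
      Closes (Des (n + 1) π) (h.frame hj) e f := by
  have hδ := direction_unit (z := e (h.frame hj).z) hε
  have hm := hr.mid hδ hc
  obtain ⟨f, h1, h2, h3⟩ := outerTo_blocks h hj hε hm hd
  have hrun := h2 e .refl
  refine ⟨f, h1.outerLoop_eq, _, hδ, hc, hrun, ?_⟩
  obtain ⟨-, hM, hB⟩ := hrun.mid hδ hr hc
  obtain ⟨k, hk, hf, hw⟩ := (outer_iff h hr.lab hd hj hε).1 hP
  have hz := (h.frame hj).lt
  have okz : ∀ q < n, Ok (Des (n + 1) π) (h.frame hj).cl f (h.frame hj).z q := by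
    intro q hq
    by_cases h4 : ((f q).natAbs : ℤ) = (f (h.frame hj).z).natAbs +
        direction ε (e (h.frame hj).z)
    · exact h3 q hq h4
    · rcases hB with rfl | ⟨k', hB⟩
      · exact absurd (h3 k hk hf) hw
      · exact hB.ok_z q hq h4
  intro p q hp hq
  by_cases hpz : p = (h.frame hj).z
  · rw [hpz]; exact okz q hq
  by_cases hqz : q = (h.frame hj).z
  · rw [hqz]; exact hM.lab.ok_symm hz hp (okz p hp)
  exact hM.ok p q hp hq hpz hqz

/-- Of two wrong values, the larger one is found by means of `π`. -/
theorem Ready.choice (h : Cuts n m s) {j : ℕ} (hj : j < m) {ε : ℤ} (hε : ε = 1 ∨ ε = -1)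
    (hr : Ready (Des (n + 1) π) (h.frame hj) e) (hd : Heads s m e)
    (ha : Agrees n π (nxt s j) (s j) e)
    (hmax : P n π (cycleVal (blocks s m e)) (lastOf (blocks s m e) j).natAbs
        (lastOf (blocks s m e) j + ε).natAbs = true →
      P n π (cycleVal (blocks s m e)) (lastOf (blocks s m e) j).natAbs
        (lastOf (blocks s m e) j + -ε).natAbs = true →
      ¬ π |lastOf (blocks s m e) j + ε| < π |lastOf (blocks s m e) j + -ε|) :
    Choice (Des (n + 1) π) (h.frame hj) (direction ε (e (h.frame hj).z)) e := by
  have hz := (h.frame hj).lt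
  have haz := (h.frame hj).le
  have hlast : lastOf (blocks s m e) j = e (h.frame hj).z := lastOf_blocks h hj
  have hε' : -ε = 1 ∨ -ε = -1 := by omega
  have hneg : direction (-ε) (e (h.frame hj).z) = -direction ε (e (h.frame hj).z) := by
    unfold direction; split_ifs <;> ring
  have d1 := natAbs_add_direction hε (hr.lab.ne_zero hz.le)
  have d2 := natAbs_add_direction hε' (hr.lab.ne_zero hz.le)
  have hdir := direction_unit (z := e (h.frame hj).z) hε
  intro k q hk hq hfk hfq hwk hwq
  have h1 := hmax ((outer_iff h hr.lab hd hj hε).2 ⟨k, hk, hfk, hwk⟩)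
    ((outer_iff h hr.lab hd hj hε').2 ⟨q, hq, by rw [hneg]; omega, hwq⟩)
  rw [hlast, show |e (h.frame hj).z + ε| = |e k| by simp only [Int.abs_eq_natAbs]; omega,
    show |e (h.frame hj).z + -ε| = |e q| by simp only [Int.abs_eq_natAbs]; omega] at h1
  obtain ⟨k1, k2, -⟩ := hr.wrong hk hwk
  obtain ⟨q1, q2, -⟩ := hr.wrong hq hwq
  have h2 := ha k q hk hq
  rw [← h.frame_nx hj, (h.frame hj).nx_of_le k (by omega),
    (h.frame hj).nx_of_le q (by omega)] at h2
  rw [← h2 k2 q2, not_lt] at h1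
  rw [(h.frame hj).cl_succ (p := k) (by omega) (by omega),
    (h.frame hj).cl_succ (p := q) (by omega) (by omega)]
  refine lt_of_le_of_ne h1 fun h5 => ?_
  have h6 := hr.lab.inj _ _ (by omega) (by omega) (congrArg Int.natAbs h5)
  rw [show q = k by omega] at hfq
  omega

/-- One iteration of the `for` loop closes one cycle. -/
theorem forStep_blocks (h : Cuts n m s) {j : ℕ} (hj : j < m)
    (hr : Ready (Des (n + 1) π) (h.frame hj) e) (hd : Heads s m e)
    (ha : Agrees n π (nxt s j) (s j) e) :
    ∃ f, forStep n π (blocks s m e) j = blocks s m f ∧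
      Closes (Des (n + 1) π) (h.frame hj) e f := by
  have hz := (h.frame hj).lt
  have hup := outer_iff (π := π) h hr.lab hd hj (ε := 1) (by omega)
  have hdown := outer_iff (π := π) h hr.lab hd hj (ε := -1) (by omega)
  have hneg : direction (-1) (e (h.frame hj).z) = -direction 1 (e (h.frame hj).z) := by
    unfold direction; split_ifs <;> ring
  unfold forStep
  simp only
  rw [sub_eq_add_neg]
  split_ifs with h1 h2
  · exact hr.closes h hj (by omega) hd
      (hr.choice h hj (by omega) hd ha fun _ h3 => (h1.2 h3).not_gt) h1.1
  · exact hr.closes h hj (by omega) hd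
      (hr.choice h hj (by omega) hd ha fun _ h4 h5 => h1 ⟨h4, fun _ => h5⟩) h2
  · refine ⟨e, rfl, 1, Or.inl rfl, ?_, .refl, ?_⟩
    all_goals
      have okz : ∀ q < n, Ok (Des (n + 1) π) (h.frame hj).cl e (h.frame hj).z q := by
        intro q hq
        by_contra hw
        have hadj : Adj (e (h.frame hj).z) (e q) := by
          by_contra hadj; exact hw fun h' => absurd h' hadj
        have h3 := direction_unit (ε := 1) (z := e (h.frame hj).z) (by omega)
        unfold Adj at hadj
        by_cases h4 : ((e q).natAbs : ℤ) = (e (h.frame hj).z).natAbs +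
          direction 1 (e (h.frame hj).z)
        · exact h1 ⟨hup.2 ⟨q, hq, h4, hw⟩, fun h5 => absurd h5 h2⟩
        · exact h2 (hdown.2 ⟨q, hq, by omega, hw⟩)
    · intro k q hk hq _ _ hw
      exact absurd (okz k hk) hw
    · intro p q hp hq
      by_cases hpz : p = (h.frame hj).z
      · rw [hpz]; exact okz q hq
      by_cases hqz : q = (h.frame hj).z
      · rw [hqz]; exact hr.lab.ok_symm hz hp (okz p hp)
      exact hr.ok_cl hp hq hpz hqz

/-- The state before the `j`-th iteration of the `for` loop. -/
structure Stage (D : Finset ℕ) (n : ℕ) (s : ℕ → ℕ) (m j : ℕ) (e : ℕ → ℤ) : Prop where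
  lab : IsLabeling n e
  heads : Heads s m e
  ok : ∀ p q, p < n → q < n → Ok D (nxt s j) e p q

variable {D : Finset ℕ}

theorem Stage.ready {j : ℕ} (hs : Stage D n s m j e) (h : Cuts n m s) (hj : j < m) :
    Ready D (h.frame hj) e :=
  ⟨hs.lab, hs.heads.headMax h hj, by rw [h.frame_z, h.frame_a]; exact hs.heads.lt j hj, hs.ok⟩

theorem Stage.next {j : ℕ} (hs : Stage D n s m j e) (h : Cuts n m s) (hj : j < m)
    (hc : Closes D (h.frame hj) e f) : Stage D n s m (j + 1) f := by
  obtain ⟨ho, hl, -, hh⟩ := hc.spec (hs.ready h hj)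
  obtain ⟨-, -, -, -, hok⟩ := hc
  exact ⟨hl, hs.heads.of_order h hj ho.low ho.high hh, hok⟩

/-- The states through which the `for` loop passes, from `e` to the one before the `j`-th
iteration. -/
inductive Reaches (D : Finset ℕ) (h : Cuts n m s) (e : ℕ → ℤ) : ℕ → (ℕ → ℤ) → Prop
  | zero : Reaches D h e 0 e
  | succ {j : ℕ} {f g : ℕ → ℤ} (hr : Reaches D h e j f) (hj : j < m)
      (hc : Closes D (h.frame hj) f g) : Reaches D h e (j + 1) g

theorem Reaches.spec {h : Cuts n m s} {j : ℕ} (hr : Reaches D h e j f)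
    (hs : Stage D n s m 0 e) : Stage D n s m j f ∧ (∀ p, f p < 0 ↔ e p < 0) ∧
      (AtLeastNegOne n (nxt s j) f ↔ AtLeastNegOne n (nxt s 0) e) := by
  induction hr with
  | zero => exact ⟨hs, fun _ => Iff.rfl, Iff.rfl⟩
  | succ hr hj hc ih =>
    obtain ⟨h1, h2, h3⟩ := ih
    have hready := h1.ready h hj
    have ho := (hc.spec hready).1
    exact ⟨h1.next h hj hc, fun p => (ho.neg p).trans (h2 p),
      (ho.one.trans hready.one_iff.symm).trans h3⟩

theorem Reaches.injective {h : Cuts n m s} {j : ℕ} {e' g : ℕ → ℤ} (hr : Reaches D h e j g)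
    (hr' : Reaches D h e' j g) (hs : Stage D n s m 0 e) (hs' : Stage D n s m 0 e') : e = e' := by
  induction hr with
  | zero => cases hr'; rfl
  | succ hr hj hc ih =>
    cases hr' with
    | succ hr' hj' hc' =>
      have h1 := (hr.spec hs).1
      have h2 := (hr'.spec hs').1
      have h3 := hc.injective hc' (h1.ready h hj) (h2.ready h hj)
      rw [← h3] at hr'
      exact ih hr'

theorem foldl_forStep_blocks (h : Cuts n m s) (hs : Stage (Des (n + 1) π) n s m 0 e)
    (ha : Agrees n π (nxt s 0) (s 0) e) {j : ℕ} (hj : j ≤ m) :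
    ∃ f, (List.range j).foldl (forStep n π) (blocks s m e) = blocks s m f ∧
      Reaches (Des (n + 1) π) h e j f ∧ Agrees n π (nxt s j) (s j) f := by
  induction j with
  | zero => exact ⟨e, rfl, .zero, ha⟩
  | succ j ih =>
    obtain ⟨f, h1, h2, h3⟩ := ih (by omega)
    have hready := (h2.spec hs).1.ready h hj
    obtain ⟨g, h4, h5⟩ := forStep_blocks h hj hready (h2.spec hs).1.heads h3
    refine ⟨g, ?_, .succ h2 hj h5, ?_⟩
    · rw [List.range_succ, List.foldl_append, h1, List.foldl_cons, List.foldl_nil, h4]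
    · have h6 := h5.agrees hready h3
      rw [h.frame_z] at h6
      exact h6

end

/-! ### Comparison with Elizalde's algorithm -/

/-- Two loops agree if their conditions and bodies agree under an invariant of the first one. -/
theorem LoopTo.congr {α : Type} {cond cond' : α → Prop} {body body' : α → α} {s t : α}
    (h : LoopTo cond body s t) (I : α → Prop) (hs : I s)
    (hstep : ∀ s, I s → cond s → I (body s)) (hcond : ∀ s, I s → (cond s ↔ cond' s))
    (hbody : ∀ s, I s → cond s → body s = body' s) : LoopTo cond' body' s t := by
  induction h with
  | done h => exact .done fun h' => h ((hcond _ hs).2 h')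
  | step h h' ih =>
    refine .step ((hcond _ hs).1 h) ?_
    rw [← hbody _ hs h]
    exact ih (hstep _ hs h)

section

variable {n m : ℕ} {s : ℕ → ℕ} {e f : ℕ → ℤ} {π : ℤ → ℤ} {δ : ℤ}

theorem target_iff (hπ : ∀ p q : ℤ, 1 ≤ p → p ≤ n → 1 ≤ q → q ≤ n → π p = π q → p = q)
    {u w : ℤ} (hu : 1 ≤ u) (hu' : u ≤ n) (hw : 1 ≤ w) (hw' : w ≤ n) (hadj : Adj u w) :
    Target (Des (n + 1) π) u.natAbs w.natAbs ↔ π u < π w := by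
  have hne : π u ≠ π w := fun h' => hadj.ne (congrArg _ (hπ u w hu hu' hw hw' h'))
  have e1 : (u.natAbs : ℤ) = u := by omega
  have e2 : (w.natAbs : ℤ) = w := by omega
  unfold Target Des
  rcases hadj with h | h
  · rw [if_pos (by omega), Finset.mem_filter, Finset.mem_range, e1,
      show u + 1 = w by omega]
    have : u.natAbs < n + 1 := by omega
    simp only [this, true_and, not_lt]
    omega
  · rw [if_neg (by omega), Finset.mem_filter, Finset.mem_range, e2,
      show w + 1 = u by omega]
    have : w.natAbs < n + 1 := by omega
    simp only [this, true_and]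

theorem swapEntries_blocks (h : Cuts n m s) (hl : IsLabeling n e) (hpos : ∀ p, 0 ≤ e p) {i k : ℕ}
    (hi : i < n) (hk : k < n) :
    swapEntries (blocks s m e) (e i) (e k) = blocks s m (swapAbs e i k) := by
  rw [swapEntries, map_map_blocks]
  refine blocks_congr h fun p hp => ?_
  have h1 : e p = e i ↔ p = i :=
    ⟨fun h' => hl.inj _ _ hp.le hi.le (congrArg _ h'), fun h' => by rw [h']⟩
  have h2 : e p = e k ↔ p = k :=
    ⟨fun h' => hl.inj _ _ hp.le hk.le (congrArg _ h'), fun h' => by rw [h']⟩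
  have hi0 := hpos i
  have hk0 := hpos k
  have w1 : withSign (e i) (e k) = e k := by unfold withSign; split_ifs <;> omega
  have w2 : withSign (e k) (e i) = e i := by unfold withSign; split_ifs <;> omega
  simp only [Function.comp, Equiv.swap_apply_def, swapAbs, h1, h2, w1, w2]

theorem swapAbs_nonneg (hpos : ∀ p, 0 ≤ e p) (i k p : ℕ) : 0 ≤ swapAbs e i k p := by
  have h1 := hpos i
  have h2 := hpos k
  have h3 := hpos p
  unfold swapAbs withSign
  split_ifs <;> omega

theorem chain_nonneg (hpos : ∀ p, 0 ≤ e p) (i k d p : ℕ) : 0 ≤ chain e i k d p := by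
  induction d generalizing e i k with
  | zero => exact swapAbs_nonneg hpos i k p
  | succ d ih =>
    rw [chain]
    split_ifs
    · exact ih (fun p => swapAbs_nonneg hpos i k p) _ _
    · exact swapAbs_nonneg hpos i k p

/-- One step of the chain of swaps: after the exchange at the places `i` and `k`, the chain goes on
if the entries preceding the exchanged ones differ by `1`. -/
theorem swapChain_step (h : Cuts n m s) (hl : IsLabeling n e) (hpos : ∀ p, 0 ≤ e p) {j i k : ℕ}
    (hj : j < m) (hi : i ≤ (h.frame hj).z) (hsi : s j ≤ i) (hk : (h.frame hj).z < k) (hk' : k < n)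
    (hpk : s j < i → nxt s m (k - 1) = k) {t : List (List ℤ) × ℤ × ℤ}
    (hend : (s j < i → ¬ Adj (e (i - 1)) (e (k - 1))) →
      t = (blocks s m (swapAbs e i k), e i, e k))
    (hgo : s j < i → Adj (e (i - 1)) (e (k - 1)) →
      LoopTo (fun s => (firstOf s.1 j ≠ s.2.1 ∧ firstOf s.1 j ≠ s.2.2) ∧
          |prec s.1 s.2.1 - prec s.1 s.2.2| = 1)
        (fun s => (swapEntries s.1 (prec s.1 s.2.2) (prec s.1 s.2.1),
          prec s.1 s.2.2, prec s.1 s.2.1))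
        (swapEntries (blocks s m (swapAbs e i k)) (swapAbs e i k (i - 1))
          (swapAbs e i k (k - 1)), swapAbs e i k (i - 1), swapAbs e i k (k - 1)) t) :
    LoopTo (fun s => (firstOf s.1 j ≠ s.2.1 ∧ firstOf s.1 j ≠ s.2.2) ∧
          |prec s.1 s.2.1 - prec s.1 s.2.2| = 1)
      (fun s => (swapEntries s.1 (prec s.1 s.2.2) (prec s.1 s.2.1),
          prec s.1 s.2.2, prec s.1 s.2.1))
      (swapEntries (blocks s m e) (e i) (e k), e i, e k) t := by
  have hz := (h.frame hj).lt
  have hl' := hl.swapAbs (i := i) (k := k) (by omega) hk'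
  have hpos' := swapAbs_nonneg hpos i k
  have hi0 := hpos i
  have hk0 := hpos k
  have w1 : swapAbs e i k i = e k := by
    rw [swapAbs_left]; unfold withSign; split_ifs <;> omega
  have w2 : swapAbs e i k k = e i := by
    rw [swapAbs_right (by omega)]; unfold withSign; split_ifs <;> omega
  rw [swapEntries_blocks h hl hpos (by omega) hk']
  by_cases hsi' : s j < i
  · have p1 := prec_blocks h hl' (p := i - 1) (by omega)
    have p2 := prec_blocks h hl' (p := k - 1) (by omega)
    rw [nxt_pred h hj hsi' hi, w1] at p1
    rw [hpk hsi', w2] at p2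
    have hkz : (h.frame hj).z ≤ k - 1 := by omega
    have hadj : |swapAbs e i k (k - 1) - swapAbs e i k (i - 1)| = 1 ↔
        Adj (e (i - 1)) (e (k - 1)) := by
      have h1 := hpos (i - 1)
      have h2 := hpos (k - 1)
      have hkn : k - 1 ≠ i := by
        intro hki
        have := hpk hsi'
        have hzz := h.frame_z hj
        rw [h.nxt_block le_rfl hj (by omega) (by omega), if_pos (by omega)] at this
        omega
      rw [swapAbs_of_ne (p := k - 1) hkn (by omega),
        swapAbs_of_ne (p := i - 1) (by omega) (by omega)]
      unfold Adj
      rw [Int.abs_eq_natAbs]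
      omega
    have hf : firstOf (blocks s m (swapAbs e i k)) j ≠ e i ∧
        firstOf (blocks s m (swapAbs e i k)) j ≠ e k := by
      rw [firstOf_blocks h hj]
      constructor
      · rw [← w2]
        intro h'
        have := hl'.inj _ _ (by omega) hk'.le (congrArg Int.natAbs h')
        omega
      · rw [← w1]
        intro h'
        have := hl'.inj _ _ (by omega) (by omega) (congrArg Int.natAbs h')
        omega
    by_cases hc : Adj (e (i - 1)) (e (k - 1))
    · refine .step ⟨hf, ?_⟩ ?_
      · simp only [p1, p2]
        exact hadj.2 hc
      · simp only [p1, p2]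
        exact hgo hsi' hc
    · rw [hend fun _ => hc]
      refine .done fun h' => hc ?_
      have h2 := h'.2
      simp only [p1, p2] at h2
      exact hadj.1 h2
  · obtain rfl : i = s j := by omega
    rw [hend fun h' => absurd h' hsi']
    refine .done fun h' => h'.1.2 ?_
    simp only
    rw [firstOf_blocks h hj, w1]

theorem ChainState.swapChain {h : Cuts n m s} {j : ℕ} {hj : j < m} {k₀ i k : ℕ}
    (hc : ChainState (Des (n + 1) π) (h.frame hj) δ k₀ e i k) (hd : Heads s m e)
    (hpos : ∀ p, 0 ≤ e p) :
    ∃ x y, LoopTo (fun s => (firstOf s.1 j ≠ s.2.1 ∧ firstOf s.1 j ≠ s.2.2) ∧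
          |prec s.1 s.2.1 - prec s.1 s.2.2| = 1)
      (fun s => (swapEntries s.1 (prec s.1 s.2.2) (prec s.1 s.2.1),
          prec s.1 s.2.2, prec s.1 s.2.1))
      (swapEntries (blocks s m e) (e i) (e k), e i, e k)
      (blocks s m (chain e i k (i - s j)), x, y) := by
  obtain ⟨d, hdd⟩ : ∃ d, i - s j = d := ⟨_, rfl⟩
  rw [hdd]
  have hi := hc.hi
  have hk' := hc.k_le
  have hk₀ := hc.k₀_lt
  have hkz := hc.hk
  have hlo := hc.lo
  rw [h.frame_a] at hlo
  have hs : SameSign (e i) (e k) := by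
    have := hpos i; have := hpos k; unfold SameSign; omega
  have hb := hc.btw'
  rw [h.frame_z] at hb
  have hpk := hd.pred_eq h hj hkz (by omega) hi.le hc.adj hs hc.btw hb
  induction d generalizing e i k with
  | zero =>
    refine ⟨e i, e k, swapChain_step h hc.lab hpos hj hi.le hlo hkz (by omega) (fun _ => hpk)
      (fun _ => by rw [chain]) (fun h' => by omega)⟩
  | succ d ih =>
    by_cases hadj : Adj (e (i - 1)) (e (k - 1))
    · have hnext := hc.next (by rw [h.frame_a]; omega) hs hadj
      have hpos' := swapAbs_nonneg hpos i k
      have hs' : SameSign (swapAbs e i k (i - 1)) (swapAbs e i k (k - 1)) := by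
        have := hpos' (i - 1); have := hpos' (k - 1); unfold SameSign; omega
      have hb' := hnext.btw'
      rw [h.frame_z] at hb'
      have hd' := hc.order.heads hd
      obtain ⟨x, y, h1⟩ := ih hnext hd' hpos' (by omega) hnext.hi hnext.k_le hnext.hk
        (by have := hnext.lo; rwa [h.frame_a] at this) hs' hb'
        (hd'.pred_eq h hj hnext.hk (by omega) hnext.hi.le hnext.adj hs' hnext.btw hb')
      refine ⟨x, y, swapChain_step h hc.lab hpos hj hi.le hlo hkz (by omega) (fun _ => hpk)
        (fun h' => absurd hadj (h' (by omega))) fun _ _ => ?_⟩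
      rw [chain, if_pos ⟨hs, hadj⟩]
      exact h1
    · refine ⟨e i, e k, swapChain_step h hc.lab hpos hj hi.le hlo hkz (by omega) (fun _ => hpk)
        (fun _ => ?_) (fun _ h' => absurd h' hadj)⟩
      rw [chain, if_neg fun h' => hadj h'.2]

theorem StartState.swapChain_eq {h : Cuts n m s} {j : ℕ} {hj : j < m} {k : ℕ}
    (hc : StartState (Des (n + 1) π) (h.frame hj) δ e k) (hd : Heads s m e)
    (hpos : ∀ p, 0 ≤ e p) :
    (swapChain j (swapEntries (blocks s m e) (e (h.frame hj).z) (e k), e (h.frame hj).z, e k)).1 =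
      blocks s m (chain e (h.frame hj).z k ((h.frame hj).z - (h.frame hj).a)) := by
  suffices H : ∃ x y, LoopTo (fun s => (firstOf s.1 j ≠ s.2.1 ∧ firstOf s.1 j ≠ s.2.2) ∧
          |prec s.1 s.2.1 - prec s.1 s.2.2| = 1)
      (fun s => (swapEntries s.1 (prec s.1 s.2.2) (prec s.1 s.2.1),
          prec s.1 s.2.2, prec s.1 s.2.1))
      (swapEntries (blocks s m e) (e (h.frame hj).z) (e k), e (h.frame hj).z, e k)
      (blocks s m (chain e (h.frame hj).z k ((h.frame hj).z - s j)), x, y) by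
    obtain ⟨x, y, H⟩ := H
    rw [swapChain, H.whileLoop_eq, h.frame_a]
  have hk := hc.hk
  have hk' := hc.k_lt
  have haz := (h.frame hj).le
  rw [h.frame_a] at haz
  have hs : SameSign (e (h.frame hj).z) (e k) := by
    have := hpos (h.frame hj).z; have := hpos k; unfold SameSign; omega
  have hb := hc.btw'
  rw [h.frame_z] at hb
  have hpk := hd.pred_eq h hj hk hk' le_rfl hc.adj hs hc.btw hb
  cases hdd : (h.frame hj).z - s j with
  | zero =>
    refine ⟨e (h.frame hj).z, e k, swapChain_step h hc.lab hpos hj le_rfl haz hk hk' (fun _ => hpk)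
      (fun _ => by rw [chain]) (fun h' => by omega)⟩
  | succ d =>
    by_cases hadj : Adj (e ((h.frame hj).z - 1)) (e (k - 1))
    · obtain ⟨x, y, h1⟩ := (hc.next (by rw [h.frame_a]; omega) hs hadj).swapChain
        (hc.order.heads hd) (swapAbs_nonneg hpos _ k)
      rw [show (h.frame hj).z - 1 - s j = d by omega] at h1
      refine ⟨x, y, swapChain_step h hc.lab hpos hj le_rfl haz hk hk' (fun _ => hpk)
        (fun h' => absurd hadj (h' (by omega))) fun _ _ => ?_⟩
      rw [chain, if_pos ⟨hs, hadj⟩]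
      exact h1
    · refine ⟨e (h.frame hj).z, e k, swapChain_step h hc.lab hpos hj le_rfl haz hk hk'
        (fun _ => hpk) (fun _ => ?_) (fun _ h' => absurd h' hadj)⟩
      rw [chain, if_neg fun h' => hadj h'.2]

/-- The condition of Elizalde's algorithm is that of the signed algorithm, as a wrong pair of
positions is always a lost descent. -/
theorem Q_iff (h : Cuts n m s) (hl : IsLabeling n e) (hd : Heads s m e) (hpos : ∀ p, 0 ≤ e p)
    (hπ : ∀ p q : ℤ, 1 ≤ p → p ≤ n → 1 ≤ q → q ≤ n → π p = π q → p = q)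
    {j : ℕ} (hj : j < m) {ε : ℤ} (hε : ε = 1 ∨ ε = -1)
    (hw : ∀ k < n, ((e k).natAbs : ℤ) =
      (e (h.frame hj).z).natAbs + direction ε (e (h.frame hj).z) →
      ¬ Ok (Des (n + 1) π) (h.frame hj).cl e (h.frame hj).z k →
      e (h.frame hj).a < e ((h.frame hj).cl k)) :
    Q n π (cycleVal (blocks s m e)) (lastOf (blocks s m e) j)
      (lastOf (blocks s m e) j + ε) = true ↔
    P n π (cycleVal (blocks s m e)) (lastOf (blocks s m e) j).natAbs
      (lastOf (blocks s m e) j + ε).natAbs = true := by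
  have hz := (h.frame hj).lt
  have hzp := hpos (h.frame hj).z
  have hzb := hl.bd _ hz
  have hdir : direction ε (e (h.frame hj).z) = ε := by unfold direction; split_ifs <;> omega
  have hlast : lastOf (blocks s m e) j = e (h.frame hj).z := lastOf_blocks h hj
  rw [outer_iff h hl hd hj hε, hlast, Q, decide_eq_true_iff]
  rw [hdir] at hw ⊢
  have hval : ∀ p < n, cycleVal (blocks s m e) (e p) = e (nxt s m p) := by
    intro p hp
    have h1 := cycleVal_blocks_natAbs h hl hp
    have h2 := hpos p
    rwa [show ((e p).natAbs : ℤ) = e p by omega] at h1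
  have htar : ∀ k < n, Adj (e (h.frame hj).z) (e k) →
      (Target (Des (n + 1) π) (e (h.frame hj).z).natAbs (e k).natAbs ↔
        π (e (h.frame hj).z) < π (e k)) := by
    intro k hk hadj
    have h2 := hpos k
    have h3 := hl.bd k hk
    exact target_iff hπ (by omega) (by omega) (by omega) (by omega) hadj
  constructor
  · rintro ⟨⟨h1, h2⟩, h3, h4⟩
    obtain ⟨k, hk, hke⟩ := hl.surj (r := (e (h.frame hj).z + ε).natAbs) (by omega) (by omega)
    have hk0 := hpos k
    have hke' : e k = e (h.frame hj).z + ε := by omega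
    refine ⟨k, hk, by omega, ?_⟩
    rw [← hd.ok_iff h hj le_rfl hk]
    intro hok
    have hadj : Adj (e (h.frame hj).z) (e k) := by unfold Adj; omega
    have h5 := hok hadj
    rw [htar k hk hadj] at h5
    rw [← hke', hval _ hz, hval k hk] at h4
    rw [← hke'] at h3
    have := h5.1 h4
    omega
  · rintro ⟨k, hk, hke, hwr⟩
    have hk0 := hpos k
    have hkb := hl.bd k hk
    have hke' : e k = e (h.frame hj).z + ε := by omega
    have hadj : Adj (e (h.frame hj).z) (e k) := by unfold Adj; omega
    have h1 := hw k hk hke hwr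
    have h2 : ¬ Target (Des (n + 1) π) (e (h.frame hj).z).natAbs (e k).natAbs := by
      intro h'
      refine hwr fun _ => iff_of_true ?_ h'
      rw [(h.frame hj).cl_z]
      exact h1
    rw [← hke', hval _ hz, hval k hk]
    have h3 : π (e (h.frame hj).z) ≠ π (e k) := by
      intro h'
      have := hπ _ _ (by omega) (by omega) (by omega) (by omega) h'
      omega
    refine ⟨by omega, ?_, ?_⟩
    · rw [htar k hk hadj] at h2
      omega
    · rw [← hd.ok_iff h hj le_rfl hk] at hwr
      by_contra h4
      exact hwr fun _ => iff_of_false h4 h2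

theorem elizaldeLoop_blocks (h : Cuts n m s) {j : ℕ} (hj : j < m) {ε : ℤ} (hε : ε = 1 ∨ ε = -1)
    (hm : Mid (Des (n + 1) π) (h.frame hj) (direction ε (e (h.frame hj).z)) e)
    (hd : Heads s m e) (hpos : ∀ p, 0 ≤ e p)
    (hπ : ∀ p q : ℤ, 1 ≤ p → p ≤ n → 1 ≤ q → q ≤ n → π p = π q → p = q) :
    elizaldeLoop n π j ε (blocks s m e) = outerLoop n π j ε (blocks s m e) := by
  obtain ⟨f, h1, -⟩ := outerTo_blocks h hj hε hm hd
  rw [h1.outerLoop_eq]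
  refine LoopTo.whileLoop_eq (h1.congr (fun c => ∃ e, c = blocks s m e ∧
    Mid (Des (n + 1) π) (h.frame hj) ε e ∧ Heads s m e ∧ ∀ p, 0 ≤ e p)
    ?_ ?_ ?_ ?_)
  · refine ⟨e, rfl, ?_, hd, hpos⟩
    have := hpos (h.frame hj).z
    unfold direction at hm
    rwa [if_neg (by omega)] at hm
  all_goals
    rintro _ ⟨e, rfl, hm, hd, hpos⟩
    have hdir : direction ε (e (h.frame hj).z) = ε := by
      have := hpos (h.frame hj).z
      unfold direction
      rw [if_neg (by omega)]
  · intro hP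
    obtain ⟨k, hk, hf, hw⟩ := (outer_iff h hm.lab hd hj hε).1 hP
    rw [hdir] at hf
    have hS := hm.startState hk hf hw
    rw [← hdir] at hS
    obtain ⟨ho, -, hM⟩ := hS.back_chain
    rw [hdir] at hM
    exact ⟨_, hS.outerBody hε hd, hM, ho.heads hd, chain_nonneg hpos _ _ _⟩
  · rw [Q_iff h hm.lab hd hpos hπ hj hε]
    intro k hk hf hw
    rw [hdir] at hf
    have hS := hm.startState hk hf hw
    rw [hS.cl_k]
    exact hS.btw
  · intro hP
    obtain ⟨k, hk, hf, hw⟩ := (outer_iff h hm.lab hd hj hε).1 hP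
    rw [hdir] at hf
    have hS := hm.startState hk hf hw
    have hlast : lastOf (blocks s m e) j = e (h.frame hj).z := lastOf_blocks h hj
    have hke : e (h.frame hj).z + ε = e k := by
      have := hpos k
      have := hpos (h.frame hj).z
      have := hm.lab.bd k hk
      omega
    rw [← hdir] at hS
    rw [hS.outerBody hε hd, hlast, hke]
    exact (hS.swapChain_eq hd hpos).symm

theorem elizaldeStep_blocks (h : Cuts n m s) {j : ℕ} (hj : j < m)
    (hs : Stage (Des (n + 1) π) n s m j e) (ha : Agrees n π (nxt s j) (s j) e)
    (hpos : ∀ p, 0 ≤ e p)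
    (hπ : ∀ p q : ℤ, 1 ≤ p → p ≤ n → 1 ≤ q → q ≤ n → π p = π q → p = q) :
    elizaldeStep n π (blocks s m e) j = forStep n π (blocks s m e) j := by
  have hr := hs.ready h hj
  have hlast : lastOf (blocks s m e) j = e (h.frame hj).z := lastOf_blocks h hj
  have hzb := hs.lab.bd _ (h.frame hj).lt
  have hzp := hpos (h.frame hj).z
  have hQ : ∀ ε : ℤ, ε = 1 ∨ ε = -1 → (Q n π (cycleVal (blocks s m e)) (lastOf (blocks s m e) j)
      (lastOf (blocks s m e) j + ε) = true ↔
    P n π (cycleVal (blocks s m e)) (lastOf (blocks s m e) j).natAbs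
      (lastOf (blocks s m e) j + ε).natAbs = true) := by
    intro ε hε
    refine Q_iff h hs.lab hs.heads hpos hπ hj hε fun k hk _ hw => ?_
    obtain ⟨h1, h2, -⟩ := hr.wrong hk hw
    rwa [(h.frame hj).cl_succ (by have := (h.frame hj).le; omega) (by omega)]
  have a1 : |lastOf (blocks s m e) j + 1| = lastOf (blocks s m e) j + 1 :=
    abs_of_nonneg (by omega)
  have a2 : |lastOf (blocks s m e) j + -1| = lastOf (blocks s m e) j + -1 :=
    abs_of_nonneg (by omega)
  unfold elizaldeStep forStep
  simp only [sub_eq_add_neg, hQ 1 (by omega), hQ (-1) (by omega), a1, a2]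
  split_ifs with h1 h2
  · refine elizaldeLoop_blocks h hj (by omega) (hr.mid (direction_unit (by omega))
      (hr.choice h hj (by omega) hs.heads ha fun _ h3 => ?_)) hs.heads hpos hπ
    rw [a1, a2]
    exact (h1.2 h3).not_gt
  · refine elizaldeLoop_blocks h hj (by omega) (hr.mid (direction_unit (by omega))
      (hr.choice h hj (by omega) hs.heads ha fun _ h4 h5 => h1 ⟨h4, fun _ => ?_⟩)) hs.heads hpos hπ
    rw [neg_neg, a1, a2] at h5
    exact h5
  · rfl

theorem foldl_elizaldeStep_blocks (h : Cuts n m s) (hs : Stage (Des (n + 1) π) n s m 0 e)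
    (ha : Agrees n π (nxt s 0) (s 0) e) (hpos : ∀ p, 0 ≤ e p)
    (hπ : ∀ p q : ℤ, 1 ≤ p → p ≤ n → 1 ≤ q → q ≤ n → π p = π q → p = q) {j : ℕ} (hj : j ≤ m) :
    (List.range j).foldl (elizaldeStep n π) (blocks s m e) =
      (List.range j).foldl (forStep n π) (blocks s m e) := by
  induction j with
  | zero => rfl
  | succ j ih =>
    obtain ⟨f, h1, h2, h3⟩ := foldl_forStep_blocks h hs ha (j := j) (by omega)
    obtain ⟨h4, h5, -⟩ := h2.spec hs
    rw [List.range_succ, List.foldl_append, List.foldl_append, ih (by omega), h1, List.foldl_cons,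
      List.foldl_cons, List.foldl_nil, List.foldl_nil]
    refine elizaldeStep_blocks h (by omega) h4 h3 (fun p => ?_) hπ
    have := h5 p
    have := hpos p
    omega

end

/-! ### Signed permutations and their values -/

section

variable {n : ℕ}

theorem values_neg (σ : SignedPerm n) (k : ℤ) : values σ (-k) = -values σ k := σ.2.1 k

theorem values_zero (σ : SignedPerm n) : values σ 0 = 0 := by
  have := values_neg σ 0
  rw [neg_zero] at this
  omega

theorem values_mul (σ τ : SignedPerm n) (k : ℤ) : values (σ * τ) k = values σ (values τ k) := rfl

theorem values_injective (σ : SignedPerm n) : Function.Injective (values σ) :=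
  (σ : Equiv.Perm ℤ).injective

theorem values_of_lt (σ : SignedPerm n) {k : ℤ} (hk : n < k.natAbs) : values σ k = k :=
  σ.2.2 k (by rw [Int.abs_eq_natAbs]; omega)

theorem values_ne_zero (σ : SignedPerm n) {k : ℤ} (hk : k ≠ 0) : values σ k ≠ 0 := fun h =>
  hk (values_injective σ (h.trans (values_zero σ).symm))

theorem natAbs_values_le (σ : SignedPerm n) {k : ℤ} (hk : k.natAbs ≤ n) :
    (values σ k).natAbs ≤ n := by
  by_contra h
  have h1 := values_injective σ (values_of_lt σ (k := values σ k) (by omega))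
  rw [h1] at h
  omega

theorem natAbs_values_inj (σ : SignedPerm n) {k l : ℤ}
    (h : (values σ k).natAbs = (values σ l).natAbs) : k.natAbs = l.natAbs := by
  rcases Int.natAbs_eq_natAbs_iff.1 h with h | h
  · rw [values_injective σ h]
  · rw [← values_neg] at h
    rw [values_injective σ h, Int.natAbs_neg]

theorem signedPerm_ext {σ τ : SignedPerm n}
    (h : ∀ i : ℕ, 1 ≤ i → i ≤ n → values σ i = values τ i) : σ = τ := by
  refine Subtype.ext (Equiv.ext fun k => ?_)
  change values σ k = values τ k
  by_cases h1 : n < k.natAbs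
  · rw [values_of_lt σ h1, values_of_lt τ h1]
  by_cases h2 : k = 0
  · rw [h2, values_zero, values_zero]
  have h3 := h k.natAbs (by omega) (by omega)
  rcases Int.natAbs_eq k with h4 | h4
  · rw [h4]; exact h3
  · rw [h4, values_neg, values_neg, h3]

/-- A signed permutation may be prescribed by its one-line notation. -/
theorem exists_signedPerm {v : ℕ → ℤ} (hv : ∀ i, 1 ≤ i → i ≤ n → 1 ≤ (v i).natAbs ∧ (v i).natAbs ≤ n)
    (hinj : ∀ i j, 1 ≤ i → i ≤ n → 1 ≤ j → j ≤ n → (v i).natAbs = (v j).natAbs → i = j) :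
    ∃ σ : SignedPerm n, ∀ i : ℕ, 1 ≤ i → i ≤ n → values σ i = v i := by
  obtain ⟨F, hF⟩ : ∃ F : ℤ → ℤ, ∀ k : ℤ, F k =
    if 1 ≤ k.natAbs ∧ k.natAbs ≤ n then k.sign * v k.natAbs else k := ⟨_, fun _ => rfl⟩
  have habs : ∀ k : ℤ, 1 ≤ k.natAbs → k.natAbs ≤ n → (F k).natAbs = (v k.natAbs).natAbs := by
    intro k h1 h2
    rw [hF, if_pos ⟨h1, h2⟩, Int.natAbs_mul, Int.natAbs_sign_of_ne_zero (by omega), one_mul]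
  have hodd : ∀ k, F (-k) = -F k := by
    intro k
    rw [hF, hF, Int.natAbs_neg, Int.sign_neg]
    split_ifs <;> ring
  have hFinj : Function.Injective F := by
    intro k l hkl
    by_cases hk : 1 ≤ k.natAbs ∧ k.natAbs ≤ n
    · by_cases hl : 1 ≤ l.natAbs ∧ l.natAbs ≤ n
      · have h1 := habs k hk.1 hk.2
        rw [hkl, habs l hl.1 hl.2] at h1
        have h2 := hinj _ _ hl.1 hl.2 hk.1 hk.2 h1
        have h3 := hv _ hk.1 hk.2
        rw [hF k, hF l, if_pos hk, if_pos hl, h2] at hkl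
        have h4 := mul_right_cancel₀ (by omega) hkl
        rw [← Int.sign_mul_natAbs k, ← Int.sign_mul_natAbs l, h4, h2]
      · have h1 := habs k hk.1 hk.2
        have h2 := hv _ hk.1 hk.2
        rw [hkl, hF, if_neg hl] at h1
        omega
    · by_cases hl : 1 ≤ l.natAbs ∧ l.natAbs ≤ n
      · have h1 := habs l hl.1 hl.2
        have h2 := hv _ hl.1 hl.2
        rw [← hkl, hF, if_neg hk] at h1
        omega
      · rwa [hF k, hF l, if_neg hk, if_neg hl] at hkl
  have himage : (Finset.Icc (-n : ℤ) n).image F = Finset.Icc (-n : ℤ) n := by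
    refine Finset.eq_of_subset_of_card_le ?_ (Finset.card_image_of_injective _ hFinj).ge
    intro y hy
    obtain ⟨k, hk, rfl⟩ := Finset.mem_image.1 hy
    rw [Finset.mem_Icc] at hk ⊢
    by_cases h1 : 1 ≤ k.natAbs
    · have h2 := habs k h1 (by omega)
      have h3 := hv k.natAbs h1 (by omega)
      omega
    · rw [hF, if_neg (by omega)]
      exact hk
  have hsurj : Function.Surjective F := by
    intro y
    by_cases hy : y ∈ Finset.Icc (-n : ℤ) n
    · rw [← himage] at hy
      obtain ⟨k, -, hk⟩ := Finset.mem_image.1 hy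
      exact ⟨k, hk⟩
    · rw [Finset.mem_Icc] at hy
      exact ⟨y, by rw [hF, if_neg (by omega)]⟩
  refine ⟨⟨Equiv.ofBijective F ⟨hFinj, hsurj⟩, hodd, fun k hk => ?_⟩, fun i h1 h2 => ?_⟩
  · change F k = k
    rw [Int.abs_eq_natAbs] at hk
    rw [hF, if_neg (by omega)]
  · change F i = v i
    rw [hF, if_pos (by simpa using ⟨h1, h2⟩), Int.natAbs_natCast, Int.sign_eq_one_of_pos (by omega),
      one_mul]

/-- A signed permutation may be prescribed by its entries and their successors. -/
theorem exists_signedPerm_of_succ {e : ℕ → ℤ} {u : ℕ → ℕ}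
    (hb : ∀ p < n, 1 ≤ (e p).natAbs ∧ (e p).natAbs ≤ n)
    (hi : ∀ p q, p < n → q < n → (e p).natAbs = (e q).natAbs → p = q)
    (hu : ∀ p < n, u p < n) (hui : ∀ p q, p < n → q < n → u p = u q → p = q) :
    ∃ σ : SignedPerm n, ∀ p < n, values σ (e p).natAbs = e (u p) := by
  have h1 : ∀ r : ℕ, ∃ p, 1 ≤ r → r ≤ n → p < n ∧ (e p).natAbs = r := by
    intro r
    by_cases h : 1 ≤ r ∧ r ≤ n
    · obtain ⟨p, hp, hpr⟩ := exists_natAbs_eq hb hi h.1 h.2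
      exact ⟨p, fun _ _ => ⟨hp, hpr⟩⟩
    · exact ⟨0, fun h2 h3 => absurd ⟨h2, h3⟩ h⟩
  choose g hg using h1
  obtain ⟨σ, hσ⟩ := exists_signedPerm (n := n) (v := fun i => e (u (g i)))
    (fun i h1 h2 => hb _ (hu _ (hg i h1 h2).1)) (fun i j h1 h2 h3 h4 h5 => by
      have h6 := hui _ _ (hg i h1 h2).1 (hg j h3 h4).1
        (hi _ _ (hu _ (hg i h1 h2).1) (hu _ (hg j h3 h4).1) h5)
      rw [← (hg i h1 h2).2, ← (hg j h3 h4).2, h6])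
  refine ⟨σ, fun p hp => ?_⟩
  have h2 := hb p hp
  have h3 := hg _ h2.1 h2.2
  rw [hσ _ h2.1 h2.2, hi _ _ h3.1 hp h3.2]

theorem values_ofValues {f : ℤ → ℤ}
    (h : ∃ σ : SignedPerm n, ∀ i : ℤ, 1 ≤ i → i ≤ n → values σ i = f i) {i : ℤ} (h1 : 1 ≤ i)
    (h2 : i ≤ n) : values (ofValues n f) i = f i := by
  rw [ofValues, dif_pos h]
  exact h.choose_spec i h1 h2

instance : Finite (SignedPerm n) := by
  refine Finite.of_injective (β := Fin n → Fin (2 * n + 1))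
    (fun σ i => ⟨(values σ ((i : ℕ) + 1 : ℤ) + n).toNat, ?_⟩) ?_
  · have := natAbs_values_le σ (k := ((i : ℕ) + 1 : ℤ)) (by omega)
    omega
  · intro σ τ h
    refine signedPerm_ext fun i h1 h2 => ?_
    have h3 := congrArg Fin.val (congrFun h ⟨i - 1, by omega⟩)
    simp only at h3
    rw [show ((i - 1 : ℕ) : ℤ) + 1 = (i : ℤ) by omega] at h3
    have h4 := natAbs_values_le σ (k := (i : ℤ)) (by omega)
    have h5 := natAbs_values_le τ (k := (i : ℤ)) (by omega)
    omega

/-! ### The cycle of a cyclic signed permutation -/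

/-- `f` is the cycle `(e 0, …, e n)`, which ends in `n + 1`. -/
structure IsCycle (n : ℕ) (f : ℤ → ℤ) (e : ℕ → ℤ) : Prop where
  lab : IsLabeling n e
  succ : ∀ p < n, f (e p).natAbs = e (p + 1)
  first : f ((n : ℤ) + 1) = e 0

theorem exists_isCycle {π : SignedPerm (n + 1)} (hπ : π ∈ cyclicB (n + 1)) (ht : HasPosTop n π) :
    ∃ e, IsCycle n (values π) e := by
  obtain ⟨l, hlen, hnd, hb, hrot⟩ := hπ
  have hinj : ∀ i j (hi : i < l.length) (hj : j < l.length), l[i].natAbs = l[j].natAbs → i = j := by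
    intro i j hi hj hij
    have h1 := (List.Nodup.getElem_inj_iff hnd (i := i) (j := j) (hi := by simpa using hi)
      (hj := by simpa using hj)).1
    refine h1 ?_
    simp only [List.getElem_map, Int.abs_eq_natAbs, hij]
  have hnext : ∀ i (hi : i < l.length),
      values π |l[i]| = l[(i + 1) % l.length]'(Nat.mod_lt _ (by omega)) := by
    intro i hi
    have h1 : (l.map fun a => values π |a|)[i]'(by simpa using hi) =
        (l.rotate 1)[i]'(by simpa using hi) := by simp only [hrot]
    rwa [List.getElem_map, List.getElem_rotate] at h1
  obtain ⟨x, hx1, hx2, hx⟩ := ht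
  obtain ⟨k, hk, hkx⟩ := exists_natAbs_eq (n := n + 1) (e := fun p => l.getD p 0) (r := x.natAbs)
    (fun p hp => by
      have hp' : p < l.length := by omega
      have := hb l[p] (List.getElem_mem _)
      rw [Int.abs_eq_natAbs] at this
      simp only [List.getD_eq_getElem l 0 hp']
      omega)
    (fun p q hp hq hpq => by
      simp only [List.getD_eq_getElem l 0 (show p < l.length by omega),
        List.getD_eq_getElem l 0 (show q < l.length by omega)] at hpq
      exact hinj p q (by omega) (by omega) hpq) (by omega) (by omega)
  have hk' : k < l.length := by omega
  simp only [List.getD_eq_getElem l 0 hk'] at hkx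
  have htop := hnext k hk'
  rw [Int.abs_eq_natAbs, hkx, show (x.natAbs : ℤ) = x by omega, hx] at htop
  have hmod : ∀ i, i % l.length < l.length := fun i => Nat.mod_lt _ (by omega)
  obtain ⟨e, he⟩ : ∃ e : ℕ → ℤ, ∀ p, e p = if p ≤ n then l[(k + 1 + 1 + p) % l.length]'(hmod _)
    else 0 := ⟨_, fun _ => rfl⟩
  have heq : ∀ p, p ≤ n → e p = l[(k + 1 + 1 + p) % l.length]'(hmod _) := fun p hp => by
    rw [he, if_pos hp]
  have key : ∀ a b, a % l.length = b % l.length → l[a % l.length]'(hmod _) =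
      l[b % l.length]'(hmod _) := by
    intro a b hab
    simp only [hab]
  have htop' : e n = n + 1 := by
    rw [heq n le_rfl, htop]
    refine key _ _ ?_
    rw [show k + 1 + 1 + n = k + 1 + l.length by omega, Nat.add_mod_right]
  have hei : ∀ p q, p ≤ n → q ≤ n → (e p).natAbs = (e q).natAbs → p = q := by
    intro p q hp hq hpq
    rw [heq p hp, heq q hq] at hpq
    have h1 : p % l.length = q % l.length :=
      Nat.ModEq.add_left_cancel' (k + 1 + 1) (hinj _ _ (hmod _) (hmod _) hpq)
    rwa [Nat.mod_eq_of_lt (by omega), Nat.mod_eq_of_lt (by omega)] at h1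
  refine ⟨e, ⟨htop', fun p hp => by rw [he, if_neg (by omega)], fun p hp => ?_, hei⟩, ?_, ?_⟩
  · have h1 := hb (e p) (by rw [heq p hp.le]; exact List.getElem_mem _)
    have h2 : (e p).natAbs ≠ (e n).natAbs := fun h' => by
      have := hei _ _ hp.le le_rfl h'
      omega
    rw [Int.abs_eq_natAbs] at h1
    rw [htop'] at h2
    omega
  · intro p hp
    have h1 := hnext _ (hmod (k + 1 + 1 + p))
    rw [← heq p hp.le, Int.abs_eq_natAbs] at h1
    rw [h1, heq (p + 1) hp]
    refine key _ _ ?_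
    rw [Nat.mod_add_mod, add_assoc]
  · have h1 := hnext _ (hmod (k + 1))
    rw [← htop, Int.abs_eq_natAbs, show (((n : ℤ) + 1).natAbs : ℤ) = n + 1 by omega] at h1
    rw [h1, heq 0 (by omega)]
    refine key _ _ ?_
    rw [Nat.mod_add_mod, add_zero]

/-- Every labeling is the cycle of a cyclic signed permutation. -/
theorem IsLabeling.exists_cyclic {e : ℕ → ℤ} (h : IsLabeling n e) :
    ∃ π ∈ cyclicB (n + 1), HasPosTop n π ∧ IsCycle n (values π) e := by
  have hb : ∀ p < n + 1, 1 ≤ (e p).natAbs ∧ (e p).natAbs ≤ n + 1 := by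
    intro p hp
    rcases (Nat.lt_succ_iff.1 hp).lt_or_eq with hp | rfl
    · have := h.bd p hp; omega
    · rw [h.top]; omega
  obtain ⟨π, hπ⟩ := exists_signedPerm_of_succ (n := n + 1) (e := e)
    (u := fun p => if p = n then 0 else p + 1) hb
    (fun p q hp hq => h.inj p q (by omega) (by omega)) (fun p hp => by split_ifs <;> omega)
    (fun p q hp hq hpq => by split_ifs at hpq <;> omega)
  have hfirst : values π ((n : ℤ) + 1) = e 0 := by
    have := hπ n (by omega)
    rwa [if_pos rfl, h.top, show (((n : ℤ) + 1).natAbs : ℤ) = n + 1 by omega] at this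
  have hsucc : ∀ p < n, values π (e p).natAbs = e (p + 1) := fun p hp => by
    rw [hπ p (by omega), if_neg (by omega)]
  refine ⟨π, ⟨(List.range (n + 1)).map e, by simp, ?_, ?_, ?_⟩, ?_, h, hsucc, hfirst⟩
  · rw [List.map_map]
    refine List.Nodup.map_on (fun p hp q hq hpq => ?_) List.nodup_range
    simp only [Function.comp, Int.abs_eq_natAbs, Nat.cast_inj] at hpq
    exact h.inj p q (by simpa [Nat.lt_succ_iff] using hp) (by simpa [Nat.lt_succ_iff] using hq) hpq
  · intro a ha
    obtain ⟨p, hp, rfl⟩ := List.mem_map.1 ha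
    have := hb p (by simpa using hp)
    simp only [Int.abs_eq_natAbs]
    omega
  · refine List.ext_getElem (by simp) fun i h1 h2 => ?_
    have hi : i < n + 1 := by simpa using h1
    simp only [List.getElem_map, List.getElem_range, List.getElem_rotate, List.length_map,
      List.length_range, Int.abs_eq_natAbs]
    rw [hπ i hi]
    split_ifs with h3
    · rw [h3, Nat.mod_self]
    · rw [Nat.mod_eq_of_lt (by omega)]
  · rcases Nat.eq_zero_or_pos n with rfl | hn
    · exact ⟨1, by omega, by omega, by
        have := h.top
        rw [← this]; simpa using hfirst⟩
    · refine ⟨(e (n - 1)).natAbs, ?_, ?_, ?_⟩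
      · have := h.bd (n - 1) (by omega); omega
      · have := h.bd (n - 1) (by omega); omega
      · rw [hsucc _ (by omega), show n - 1 + 1 = n by omega, h.top]

theorem IsCycle.signedPerm_ext {π π' : SignedPerm (n + 1)} {e : ℕ → ℤ}
    (h : IsCycle n (values π) e) (h' : IsCycle n (values π') e) : π = π' := by
  refine CyclicDescents.signedPerm_ext fun i h1 h2 => ?_
  rcases h2.lt_or_eq with h2 | rfl
  · obtain ⟨p, hp, rfl⟩ := h.lab.surj h1 (by omega)
    rw [h.succ p hp, h'.succ p hp]
  · push_cast
    rw [h.first, h'.first]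

end

/-! ### Cutting a cycle before its left-to-right maxima -/

section

variable {n : ℕ} {e : ℕ → ℤ} {f : ℤ → ℤ}

theorem IsCycle.cycleList_eq (h : IsCycle n f e) :
    cycleList n f = (List.range (n + 1)).map e := by
  have key : ∀ r ≤ n, (fun a => f |a|)^[r] (f ((n : ℤ) + 1)) = e r := by
    intro r hr
    induction r with
    | zero => exact h.first
    | succ r ih =>
      rw [Function.iterate_succ_apply', ih (by omega), Int.abs_eq_natAbs, h.succ r (by omega)]
  refine List.ext_getElem (by simp [cycleList]) fun i h1 h2 => ?_
  have h3 : i < n + 1 := by simpa using h2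
  simp only [cycleList, List.getElem_iterate, List.getElem_map, List.getElem_range]
  exact key i (by omega)

theorem blocks_succ {m : ℕ} {s s' : ℕ → ℕ} (hs : ∀ j, s (j + 1) = s' j) :
    blocks s (m + 1) e = (List.range' (s 0) (s' 0 - s 0)).map e :: blocks s' m e := by
  rw [blocks, List.range_succ_eq_map, List.map_cons, List.map_map]
  simp only [blocks, hs, Function.comp_def]

/-- Cutting the entries at the places `a, …, N - 1` before their left-to-right maxima. -/
theorem exists_cutAtMaxima {N : ℕ} (hinj : ∀ p q, p < N → q < N → e p = e q → p = q) {a : ℕ}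
    (ha : a ≤ N) : ∃ (m : ℕ) (s : ℕ → ℕ), s 0 = a ∧ (∀ j, m ≤ j → s j = N) ∧
      (∀ j < m, s j < s (j + 1)) ∧ (∀ l < m, ∀ p, s l < p → p < s (l + 1) → e p < e (s l)) ∧
      (∀ l, l + 1 < m → e (s l) < e (s (l + 1))) ∧
      cutAtMaxima ((List.range' a (N - a)).map e) = blocks s m e := by
  obtain ⟨d, hd⟩ : ∃ d, d = N - a := ⟨_, rfl⟩
  induction d using Nat.strong_induction_on generalizing a with
  | _ d ih =>
  rcases ha.lt_or_eq with ha | rfl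
  · obtain ⟨t, ht, htmin⟩ : ∃ t, (a < t ∧ t ≤ N ∧ (t = N ∨ ¬ e t < e a)) ∧
        ∀ p, a < p → p < t → e p < e a := by
      have hex : ∃ t, a < t ∧ t ≤ N ∧ (t = N ∨ ¬ e t < e a) := ⟨N, ha, le_rfl, Or.inl rfl⟩
      refine ⟨Nat.find hex, Nat.find_spec hex, fun p h1 h2 => ?_⟩
      have h3 := Nat.find_min hex h2
      have h4 := (Nat.find_spec hex).2.1
      by_contra h5
      exact h3 ⟨h1, by omega, Or.inr h5⟩
    obtain ⟨m, s, h0, hN, hlt, hmax, hhead, hcut⟩ := ih (N - t) (by omega) (a := t) ht.2.1 rfl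
    have hsplit : (List.range' a (N - a)).map e =
        e a :: ((List.range' (a + 1) (t - (a + 1))).map e ++ (List.range' t (N - t)).map e) := by
      rw [show N - a = (N - a - 1) + 1 by omega, List.range'_succ, List.map_cons, ← List.map_append]
      congr 2
      have h1 := List.range'_append_1 (s := a + 1) (m := t - (a + 1)) (n := N - t)
      rw [show a + 1 + (t - (a + 1)) = t by omega] at h1
      rw [h1]
      congr 1
      omega
    have hfirst : ∀ b ∈ (List.range' (a + 1) (t - (a + 1))).map e, decide (b < e a) = true := by
      intro b hb
      obtain ⟨p, hp, rfl⟩ := List.mem_map.1 hb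
      have := List.mem_range'_1.1 hp
      exact decide_eq_true (htmin p (by omega) (by omega))
    have hrest : ((List.range' t (N - t)).map e).takeWhile (fun b => decide (b < e a)) = [] ∧
        ((List.range' t (N - t)).map e).dropWhile (fun b => decide (b < e a)) =
          (List.range' t (N - t)).map e := by
      rcases ht.2.2 with h1 | h1
      · rw [h1]; simp
      · by_cases h2 : t = N
        · rw [h2]; simp
        · rw [show N - t = (N - t - 1) + 1 by omega, List.range'_succ, List.map_cons]
          constructor
          · rw [List.takeWhile_cons_of_neg (by simpa using h1)]
          · rw [List.dropWhile_cons_of_neg (by simpa using h1)]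
    refine ⟨m + 1, fun j => Nat.casesOn j a s, rfl, ?_, ?_, ?_, ?_, ?_⟩
    · rintro (_ | j) hj
      · omega
      · exact hN j (by omega)
    · rintro (_ | j) hj
      · change a < s 0
        omega
      · exact hlt j (by omega)
    · rintro (_ | l) hl p h1 h2
      · change a < p at h1
        change p < s 0 at h2
        exact htmin p h1 (by omega)
      · exact hmax l (by omega) p h1 h2
    · rintro (_ | l) hl
      · change e a < e (s 0)
        have h1 := hlt 0 (by omega)
        have h2 : s 0 < N := by
          by_contra h3
          have h4 : ∀ j ≤ m, s 0 ≤ s j := by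
            intro j hj
            induction j with
            | zero => rfl
            | succ j ih' => exact (ih' (by omega)).trans (hlt j (by omega)).le
          have h5 := h4 1 (by omega)
          have h6 : ∀ j, 1 ≤ j → j ≤ m → s 0 < s j := fun j h6 h7 => by
            induction j with
            | zero => omega
            | succ j ih' =>
              rcases Nat.eq_zero_or_pos j with rfl | h8
              · exact h1
              · exact (ih' h8 (by omega)).trans (hlt j (by omega))
          have := h6 m (by omega) le_rfl
          have := hN m le_rfl
          omega
        rw [h0] at h2 ⊢
        have h3 : ¬ e t < e a := by
          rcases ht.2.2 with h4 | h4
          · omega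
          · exact h4
        refine lt_of_le_of_ne (not_lt.1 h3) fun h4 => ?_
        have := hinj _ _ ha h2 h4
        omega
      · exact hhead l (by omega)
    · rw [blocks_succ (s := fun j => Nat.casesOn j a s) (s' := s) fun _ => rfl, hsplit, cutAtMaxima,
        List.takeWhile_append_of_pos hfirst, List.dropWhile_append_of_pos hfirst, hrest.1, hrest.2,
        hcut, List.append_nil]
      congr 1
      change _ = (List.range' a (s 0 - a)).map e
      rw [h0, show t - a = (t - (a + 1)) + 1 by omega, List.range'_succ, List.map_cons]
  · exact ⟨0, fun _ => a, rfl, fun _ _ => rfl, by simp, by simp, by simp, by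
      simp [blocks, cutAtMaxima]⟩

/-- The cycles from which the algorithm starts, as blocks of places. -/
theorem IsCycle.startCycles_eq (h : IsCycle n f e) :
    ∃ m s, Cuts n m s ∧ Heads s m e ∧ startCycles n f = blocks s m e := by
  have hle : ∀ p < n, e p < e n := by
    intro p hp
    have := h.lab.bd p hp
    rw [h.lab.top]
    omega
  obtain ⟨m, s, h0, hN, hlt, hmax, hhead, hcut⟩ := exists_cutAtMaxima (N := n + 1) (e := e)
    (fun p q hp hq hpq => h.lab.inj p q (by omega) (by omega) (congrArg _ hpq)) (Nat.zero_le _)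
  obtain ⟨m, rfl⟩ : ∃ m', m = m' + 1 := by
    rcases m with _ | m
    · have := hN 0 le_rfl; omega
    · exact ⟨m, rfl⟩
  have hm := hlt m (by omega)
  rw [hN (m + 1) le_rfl] at hm
  have hlast : s m = n := by
    by_contra hne
    have h1 := hmax m (by omega) n (by omega) (by rw [hN (m + 1) le_rfl]; omega)
    have h2 := hle (s m) (by omega)
    omega
  refine ⟨m, s, ⟨h0, hlast, fun j hj => hlt j (by omega), fun j hj => hN j (by omega)⟩,
    ⟨fun l hl => hmax l (by omega), fun l hl => hhead l (by omega)⟩, ?_⟩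
  rw [startCycles, h.cycleList_eq, List.range_eq_range']
  have h3 : blocks s (m + 1) e = blocks s m e ++ [(List.range' (s m) (s (m + 1) - s m)).map e] := by
    simp [blocks, List.range_succ]
  rw [Nat.sub_zero] at hcut
  rw [hcut, h3, List.dropLast_concat]

/-- Before any cycle is closed, the values are those of `π`, so that no position is wrong. -/
theorem IsCycle.stage {m : ℕ} {s : ℕ → ℕ} (h : IsCycle n f e) (hd : Heads s m e) :
    Stage (Des (n + 1) f) n s m 0 e := by
  refine ⟨h.lab, hd, fun p q hp hq hadj => ?_⟩
  change e (p + 1) < e (q + 1) ↔ _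
  have hne : e (p + 1) ≠ e (q + 1) := fun h' => by
    have := h.lab.inj _ _ hp hq (congrArg Int.natAbs h')
    obtain rfl : p = q := by omega
    exact hadj.ne rfl
  have h1 := h.lab.bd p hp
  have h2 := h.lab.bd q hq
  rw [Target, Des, Finset.mem_filter, Finset.mem_filter, Finset.mem_range, Finset.mem_range]
  unfold Adj at hadj
  rcases hadj with h3 | h3
  · rw [if_pos (by omega), show ((e p).natAbs : ℤ) + 1 = (e q).natAbs by omega, h.succ p hp,
      h.succ q hq]
    omega
  · rw [if_neg (by omega), show ((e q).natAbs : ℤ) + 1 = (e p).natAbs by omega, h.succ p hp,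
      h.succ q hq]
    omega

theorem IsCycle.agrees (h : IsCycle n f e) (s : ℕ → ℕ) : Agrees n f (nxt s 0) (s 0) e := by
  intro p q hp hq _ _
  change e (p + 1) < e (q + 1) ↔ _
  rw [Int.abs_eq_natAbs, Int.abs_eq_natAbs, h.succ p hp, h.succ q hq]

/-- The algorithm reaches a state in which all cycles are closed. -/
theorem IsCycle.algorithm_eq (h : IsCycle n f e) : ∃ (m : ℕ) (s : ℕ → ℕ) (hc : Cuts n m s)
    (g : ℕ → ℤ), Heads s m e ∧ startCycles n f = blocks s m e ∧
      algorithm n f = blocks s m g ∧ Reaches (Des (n + 1) f) hc e m g := by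
  obtain ⟨m, s, hc, hd, hstart⟩ := h.startCycles_eq
  obtain ⟨g, h1, h2, -⟩ := foldl_forStep_blocks hc (h.stage hd) (h.agrees s) le_rfl
  refine ⟨m, s, hc, g, hd, hstart, ?_, h2⟩
  rw [algorithm, hstart, show (blocks s m e).length = m by simp [blocks], h1]

end

/-! ### The map `φ` on the level of places -/

section

variable {n m m' : ℕ} {s s' : ℕ → ℕ} {e e' : ℕ → ℤ}

theorem Cuts.nxt_lt_n (h : Cuts n m s) {p : ℕ} (hp : p < n) : nxt s m p < n := by
  have := h.nxt_lt le_rfl (p := p) (by rwa [h.last])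
  rwa [h.last] at this

theorem Cuts.nxt_inj_n (h : Cuts n m s) {p q : ℕ} (hp : p < n) (hq : q < n)
    (heq : nxt s m p = nxt s m q) : p = q :=
  h.nxt_inj le_rfl (by rwa [h.last]) (by rwa [h.last]) heq

/-- The end of a cycle can be recognized by the entries: it is followed by a left-to-right maximum,
and the entry after it in the cycle is the largest one so far. -/
theorem Heads.nxt_cases (hd : Heads s m e) (h : Cuts n m s) {p : ℕ} (hp : p < n) :
    ((∀ q ≤ p, e q < e (p + 1)) ∧ nxt s m p ≤ p ∧ ∀ q ≤ p, e q ≤ e (nxt s m p)) ∨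
      (∃ q ≤ p, e (p + 1) < e q) ∧ nxt s m p = p + 1 := by
  obtain ⟨l, hl, h1, h2⟩ := h.exists_block hp
  rw [h.nxt_block le_rfl hl h1 h2]
  by_cases h3 : p + 1 = s (l + 1)
  · have hmax := hd.headMax h hl
    have hz := h.frame_z hl
    have h4 : ∀ q ≤ p, e q ≤ e (s l) := fun q hq => hmax.le (p := q) (by omega)
    rw [if_pos h3, h3]
    exact Or.inl ⟨fun q hq => (h4 q hq).trans_lt (hd.lt l hl), h1, h4⟩
  · rw [if_neg h3]
    exact Or.inr ⟨⟨s l, h1, hd.max l hl _ (by omega) (by omega)⟩, rfl⟩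

theorem Heads.cuts_le (hd : Heads s m e) (hd' : Heads s' m' e) (h : Cuts n m s)
    (h' : Cuts n m' s') {j : ℕ} (hj : j ≤ m) : j ≤ m' ∧ s j = s' j := by
  induction j with
  | zero => exact ⟨Nat.zero_le _, h.zero.trans h'.zero.symm⟩
  | succ j ih =>
    obtain ⟨h1, h2⟩ := ih (by omega)
    have h3 := h.lt j (by omega)
    have h4 := h.le_n hj
    have h5 : j < m' := by
      rcases h1.lt_or_eq with h5 | h5
      · exact h5
      · rw [h5, h'.last] at h2
        rw [h5] at h3 h4
        omega
    have h6 := h'.lt j h5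
    refine ⟨h5, ?_⟩
    rcases lt_trichotomy (s (j + 1)) (s' (j + 1)) with h7 | h7 | h7
    · have h8 := hd'.max j h5 _ (by omega) h7
      rw [← h2] at h8
      exact absurd (hd.lt j (by omega)) h8.not_gt
    · exact h7
    · have h8 := hd.max j (by omega) _ (by omega) h7
      rw [h2] at h8
      exact absurd (hd'.lt j h5) h8.not_gt

/-- The places where cycles begin are determined by the entries. -/
theorem Heads.cuts_unique (hd : Heads s m e) (hd' : Heads s' m' e) (h : Cuts n m s)
    (h' : Cuts n m' s') : m = m' ∧ s = s' := by
  obtain rfl : m = m' := le_antisymm (hd.cuts_le hd' h h' le_rfl).1 (hd'.cuts_le hd h' h le_rfl).1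
  refine ⟨rfl, funext fun j => ?_⟩
  by_cases hj : j ≤ m
  · exact (hd.cuts_le hd' h h' hj).2
  · rw [h.tail j (by omega), h'.tail j (by omega)]

/-- The notation in which each cycle begins with its largest entry, and these increase, is
determined by the signed permutation. The entries are compared from the last place backwards. -/
theorem Heads.entries_unique (hd : Heads s m e) (hd' : Heads s' m' e') (h : Cuts n m s)
    (h' : Cuts n m' s') (hl : IsLabeling n e) (hl' : IsLabeling n e')
    (heq : ∀ p q, p < n → q < n → (e p).natAbs = (e' q).natAbs →
      e (nxt s m p) = e' (nxt s' m' q)) : e = e' := by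
  have hmatch : ∀ p < n, ∃ q < n, (e' q).natAbs = (e p).natAbs := fun p hp =>
    hl'.surj (hl.bd p hp).1 (hl.bd p hp).2
  have hmatch' : ∀ q < n, ∃ p < n, (e p).natAbs = (e' q).natAbs := fun q hq =>
    hl.surj (hl'.bd q hq).1 (hl'.bd q hq).2
  have hpred : ∀ p < n, ∃ q < n, nxt s m q = p := fun p hp => by
    obtain ⟨l, hl, h1, h2⟩ := h.exists_block hp
    obtain ⟨q, -, h3, h4⟩ := h.exists_pred hl h1 h2
    have := h.le_n (j := l + 1) hl
    exact ⟨q, by omega, h4⟩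
  have hsame : ∀ p q, p < n → q < n → (e p).natAbs = (e' q).natAbs → e p = e' q := by
    intro p q hp hq hpq
    obtain ⟨r, hr, rfl⟩ := hpred p hp
    obtain ⟨t, ht, hrt⟩ := hmatch r hr
    have h1 := heq r t hr ht hrt.symm
    rw [h1] at hpq ⊢
    rw [hl'.inj _ _ (h'.nxt_lt_n ht).le hq.le hpq]
  suffices H : ∀ d ≤ n, ∀ p, n - d ≤ p → e p = e' p from
    funext fun p => H n le_rfl p (by omega)
  intro d
  induction d with
  | zero =>
    intro _ p hp
    rcases Nat.lt_or_eq_of_le hp with h1 | h1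
    · rw [hl.out p (by omega), hl'.out p (by omega)]
    · rw [← h1, Nat.sub_zero, hl.top, hl'.top]
  | succ d ih =>
    intro hdn p hp
    have ih := ih (by omega)
    by_cases hpd : n - d ≤ p
    · exact ih p hpd
    have hpn : p < n := by omega
    have hsucc := ih (p + 1) (by omega)
    -- The same entries stand at the places up to `p`.
    have hlow : ∀ q ≤ p, ∃ r ≤ p, e' r = e q := by
      intro q hq
      obtain ⟨r, hr, hrq⟩ := hmatch q (by omega)
      refine ⟨r, ?_, (hsame q r (by omega) hr hrq.symm).symm⟩
      by_contra hrp
      rw [← ih r (by omega)] at hrq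
      have := hl.inj _ _ (by omega) (by omega) hrq
      omega
    have hlow' : ∀ q ≤ p, ∃ r ≤ p, e r = e' q := by
      intro q hq
      obtain ⟨r, hr, hrq⟩ := hmatch' q (by omega)
      refine ⟨r, ?_, hsame r q hr (by omega) hrq⟩
      by_contra hrp
      rw [ih r (by omega)] at hrq
      have := hl'.inj _ _ (by omega) (by omega) hrq
      omega
    -- So `p` ends a cycle in both notations, which then begins with the largest of these, or in none.
    have hnxt : e (nxt s m p) = e' (nxt s' m' p) := by
      rcases hd.nxt_cases h hpn with ⟨h1, h2, h3⟩ | ⟨⟨q, hq, h1⟩, h2⟩ <;>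
      rcases hd'.nxt_cases h' hpn with ⟨h1', h2', h3'⟩ | ⟨⟨q', hq', h1'⟩, h2'⟩
      · obtain ⟨r, hr, hre⟩ := hlow _ h2
        obtain ⟨r', hr', hre'⟩ := hlow' _ h2'
        refine le_antisymm ?_ ?_
        · rw [← hre]; exact h3' r hr
        · rw [← hre']; exact h3 r' hr'
      · obtain ⟨r, hr, hre⟩ := hlow' _ hq'
        have := h1 r hr
        omega
      · obtain ⟨r, hr, hre⟩ := hlow _ hq
        have := h1' r hr
        omega
      · rw [h2, h2', hsucc]
    obtain ⟨q, hq, hqp⟩ := hmatch p hpn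
    have h1 := heq p q hpn hq hqp.symm
    rw [hnxt] at h1
    have h2 := hl'.inj _ _ (h'.nxt_lt_n hpn).le (h'.nxt_lt_n hq).le (congrArg _ h1)
    rw [← h'.nxt_inj_n hpn hq h2] at hqp
    exact hsame p p hpn hpn hqp.symm

/-! ### Only the descents at `1, …, n - 1` matter -/

variable {D D' : Finset ℕ}

theorem IsLabeling.ok_congr (hl : IsLabeling n e) (hD : ∀ r, 1 ≤ r → r < n → (r ∈ D ↔ r ∈ D'))
    {u : ℕ → ℕ} {p q : ℕ} (hp : p < n) (hq : q < n) : Ok D u e p q ↔ Ok D' u e p q := by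
  unfold Ok
  refine forall_congr' fun hadj => ?_
  have h1 := hl.bd p hp
  have h2 := hl.bd q hq
  have h3 : Target D (e p).natAbs (e q).natAbs ↔ Target D' (e p).natAbs (e q).natAbs := by
    unfold Adj at hadj
    unfold Target
    split_ifs
    · rw [hD _ (by omega) (by omega)]
    · rw [hD _ (by omega) (by omega)]
  rw [h3]

theorem Closes.congr {F : Frame n} {f : ℕ → ℤ} (hc : Closes D F e f) (hr : Ready D F e)
    (hD : ∀ r, 1 ≤ r → r < n → (r ∈ D ↔ r ∈ D')) : Closes D' F e f := by
  have hl := (hc.spec hr).2.1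
  obtain ⟨δ, hδ, hch, hrun, hok⟩ := hc
  have hz := F.lt
  refine ⟨δ, hδ, ?_, ?_, fun p q hp hq => (hl.ok_congr hD hp hq).1 (hok p q hp hq)⟩
  · intro k q hk hq h1 h2 h3 h4
    rw [← hr.lab.ok_congr hD (by omega) (by omega)] at h3 h4
    exact hch k q hk hq h1 h2 h3 h4
  · clear hok hl
    induction hrun with
    | refl => exact .refl
    | step h k hk hf hw ih =>
      have hl := (h.mid hδ hr hch).2.1.lab
      rw [hl.ok_congr hD (by omega) (by omega)] at hw
      exact ih.step k hk hf hw

theorem Reaches.congr {h : Cuts n m s} {j : ℕ} {g : ℕ → ℤ} (hr : Reaches D h e j g)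
    (hs : Stage D n s m 0 e) (hD : ∀ r, 1 ≤ r → r < n → (r ∈ D ↔ r ∈ D')) :
    Reaches D' h e j g := by
  induction hr with
  | zero => exact .zero
  | succ hr hj hc ih => exact .succ ih hj (hc.congr ((hr.spec hs).1.ready h hj) hD)

theorem Stage.congr {j : ℕ} (hs : Stage D n s m j e)
    (hD : ∀ r, 1 ≤ r → r < n → (r ∈ D ↔ r ∈ D')) : Stage D' n s m j e :=
  ⟨hs.lab, hs.heads, fun p q hp hq => (hs.lab.ok_congr hD hp hq).1 (hs.ok p q hp hq)⟩

/-! ### The map `φ` -/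

/-- The entries `g` of the cycle notation of `φ(π)`, where `e` is the cycle `π`. -/
structure PhiData (n : ℕ) (π : SignedPerm (n + 1)) (e : ℕ → ℤ) (m : ℕ) (s : ℕ → ℕ) (g : ℕ → ℤ) :
    Prop where
  cuts : Cuts n m s
  start : Stage (Des (n + 1) (values π)) n s m 0 e
  reaches : Reaches (Des (n + 1) (values π)) cuts e m g
  startCycles_eq : startCycles n (values π) = blocks s m e
  algorithm_eq : algorithm n (values π) = blocks s m g
  values_eq : ∀ p < n, values (phi n π) (g p).natAbs = g (nxt s m p)

variable {π π' : SignedPerm (n + 1)} {g g' : ℕ → ℤ}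

theorem IsCycle.exists_phiData (h : IsCycle n (values π) e) : ∃ m s g, PhiData n π e m s g := by
  obtain ⟨m, s, hc, g, hd, h1, h2, h3⟩ := h.algorithm_eq
  have hs := h.stage hd
  have hg := (h3.spec hs).1
  refine ⟨m, s, g, hc, hs, h3, h1, h2, fun p hp => ?_⟩
  have hb := hg.lab.bd p hp
  rw [phi, values_ofValues ?_ (by omega) (by omega), h2, cycleVal_blocks_natAbs hc hg.lab hp]
  obtain ⟨σ, hσ⟩ := exists_signedPerm_of_succ (n := n) (e := g) (u := nxt s m) hg.lab.bd
    (fun p q hp hq => hg.lab.inj p q hp.le hq.le) (fun p => hc.nxt_lt_n) (fun p q => hc.nxt_inj_n)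
  refine ⟨σ, fun i h4 h5 => ?_⟩
  obtain ⟨q, hq, hqi⟩ := hg.lab.surj (r := i.natAbs) (by omega) (by omega)
  rw [h2, show i = ((g q).natAbs : ℤ) by omega, hσ q hq, cycleVal_blocks_natAbs hc hg.lab hq]

theorem PhiData.final (h : PhiData n π e m s g) : Stage (Des (n + 1) (values π)) n s m m g :=
  (h.reaches.spec h.start).1

/-- `φ` preserves descents at positive positions. -/
theorem PhiData.mem_des_iff (h : PhiData n π e m s g) {r : ℕ} (h1 : 1 ≤ r) (h2 : r < n) :
    r ∈ Des (n + 1) (values π) ↔ r ∈ Des n (values (phi n π)) := by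
  have hf := h.final
  obtain ⟨p, hp, hpr⟩ := hf.lab.surj h1 h2.le
  obtain ⟨q, hq, hqr⟩ := hf.lab.surj (r := r + 1) (by omega) h2
  have h3 := hf.ok p q hp hq (Or.inl (by omega))
  rw [Target, if_pos (by omega), hpr, ← h.values_eq p hp, ← h.values_eq q hq, hpr, hqr] at h3
  have h4 : values (phi n π) (r : ℤ) ≠ values (phi n π) ((r + 1 : ℕ) : ℤ) := fun h' => by
    have := values_injective _ h'
    omega
  rw [Des, Des, Finset.mem_filter (s := Finset.range n), Finset.mem_range, ← Des]
  push_cast at h3 h4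
  have h5 : r ∈ Des (n + 1) (values π) ↔
      ¬ values (phi n π) (r : ℤ) < values (phi n π) ((r : ℤ) + 1) := by
    tauto
  rw [h5]
  omega

/-- The final notation is determined by `φ(π)`, and the algorithm can be traced back from it, since it
uses `π` only through the descents that `φ(π)` shares with `π`. -/
theorem PhiData.injective (h : PhiData n π e m s g) (h' : PhiData n π' e' m' s' g')
    (heq : phi n π = phi n π') : e = e' := by
  have hD : ∀ r, 1 ≤ r → r < n →
      (r ∈ Des (n + 1) (values π') ↔ r ∈ Des (n + 1) (values π)) := fun r h1 h2 => by
    rw [h.mem_des_iff h1 h2, h'.mem_des_iff h1 h2, heq]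
  have hg : g = g' := by
    refine h.final.heads.entries_unique h'.final.heads h.cuts h'.cuts h.final.lab h'.final.lab ?_
    intro p q hp hq hpq
    rw [← h.values_eq p hp, ← h'.values_eq q hq, heq, hpq]
  subst hg
  obtain ⟨rfl, rfl⟩ := h.final.heads.cuts_unique h'.final.heads h.cuts h'.cuts
  exact h.reaches.injective (h'.reaches.congr h'.start hD) h.start (h'.start.congr hD)

theorem phi_injective (h : IsCycle n (values π) e) (h' : IsCycle n (values π') e')
    (heq : phi n π = phi n π') : π = π' := by
  obtain ⟨m, s, g, hg⟩ := h.exists_phiData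
  obtain ⟨m', s', g', hg'⟩ := h'.exists_phiData
  obtain rfl := hg.injective hg' heq
  exact h.signedPerm_ext h'

/-- The number of negatives can be counted in the cycle notation. -/
theorem card_neg {N : ℕ} (σ : SignedPerm N) {u : ℕ → ℕ}
    (hb : ∀ p < N, 1 ≤ (e p).natAbs ∧ (e p).natAbs ≤ N)
    (hi : ∀ p q, p < N → q < N → (e p).natAbs = (e q).natAbs → p = q)
    (hu : ∀ p < N, u p < N) (hui : ∀ p q, p < N → q < N → u p = u q → p = q)
    (hσ : ∀ p < N, values σ (e p).natAbs = e (u p)) :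
    ((Finset.Icc 1 N).filter fun i : ℕ => values σ i < 0).card =
      ((Finset.range N).filter fun p => e p < 0).card := by
  have h1 : (Finset.range N).image (fun p => (e p).natAbs) = Finset.Icc 1 N := by
    ext x
    rw [Finset.mem_image, Finset.mem_Icc]
    constructor
    · rintro ⟨p, hp, rfl⟩
      exact hb p (Finset.mem_range.1 hp)
    · rintro ⟨h1, h2⟩
      obtain ⟨p, hp, hpx⟩ := exists_natAbs_eq hb hi h1 h2
      exact ⟨p, Finset.mem_range.2 hp, hpx⟩
  have h2 : Set.InjOn u (Finset.range N) := fun p hp q hq =>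
    hui p q (Finset.mem_range.1 hp) (Finset.mem_range.1 hq)
  have h3 : (Finset.range N).image u = Finset.range N := by
    refine Finset.eq_of_subset_of_card_le ?_ (Finset.card_image_of_injOn h2).ge
    intro x hx
    obtain ⟨p, hp, rfl⟩ := Finset.mem_image.1 hx
    exact Finset.mem_range.2 (hu p (Finset.mem_range.1 hp))
  conv_rhs => rw [← h3]
  rw [← h1, Finset.filter_image, Finset.filter_image, Finset.card_image_of_injOn,
    Finset.card_image_of_injOn]
  · congr 1
    refine Finset.filter_congr fun p hp => ?_
    rw [hσ p (Finset.mem_range.1 hp)]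
  · exact h2.mono (Finset.coe_subset.2 (Finset.filter_subset _ _))
  · intro p hp q hq
    have hp := (Finset.mem_filter.1 hp).1
    have hq := (Finset.mem_filter.1 hq).1
    exact hi p q (Finset.mem_range.1 hp) (Finset.mem_range.1 hq)

theorem IsCycle.card_neg (h : IsCycle n (values π) e) :
    ((Finset.Icc 1 (n + 1)).filter fun i : ℕ => values π i < 0).card =
      ((Finset.range n).filter fun p => e p < 0).card := by
  have htop := h.lab.top
  rw [CyclicDescents.card_neg π (e := e) (u := fun p => if p = n then 0 else p + 1)]
  · rw [Finset.range_add_one, Finset.filter_insert, if_neg (by omega)]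
  · intro p hp
    rcases (Nat.lt_succ_iff.1 hp).lt_or_eq with hp | rfl
    · have := h.lab.bd p hp; omega
    · omega
  · exact fun p q hp hq => h.lab.inj p q (by omega) (by omega)
  · intro p hp; split_ifs <;> omega
  · intro p q hp hq hpq; split_ifs at hpq <;> omega
  · intro p hp
    split_ifs with h1
    · rw [h1, htop, show (((n : ℤ) + 1).natAbs : ℤ) = n + 1 by omega, h.first]
    · exact h.succ p (by omega)

/-- `φ` preserves the number of negatives. -/
theorem PhiData.card_neg (h : PhiData n π e m s g) (hc : IsCycle n (values π) e) :
    ((Finset.Icc 1 n).filter fun i : ℕ => values (phi n π) i < 0).card =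
      ((Finset.Icc 1 (n + 1)).filter fun i : ℕ => values π i < 0).card := by
  have hl := h.final.lab
  rw [hc.card_neg, CyclicDescents.card_neg (phi n π) hl.bd
    (fun p q hp hq => hl.inj p q hp.le hq.le) (fun p => h.cuts.nxt_lt_n)
    (fun p q => h.cuts.nxt_inj_n) h.values_eq]
  congr 1
  exact Finset.filter_congr fun p _ => (h.reaches.spec h.start).2.1 p

/-- The first value of `φ(π)` has the same sign as that of `π`, unless it is `-1`. -/
theorem PhiData.first_iff (h : PhiData n π e m s g) (hc : IsCycle n (values π) e) (hn : 1 ≤ n) :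
    0 < values π 1 ↔ -1 ≤ values (phi n π) 1 := by
  have h1 := (h.reaches.spec h.start).2.2
  obtain ⟨p, hp, hp1⟩ := hc.lab.surj le_rfl hn
  obtain ⟨q, hq, hq1⟩ := h.final.lab.surj le_rfl hn
  have h2 : values π 1 = e (p + 1) := by
    have := hc.succ p hp
    rwa [hp1, Nat.cast_one] at this
  have h3 : values (phi n π) 1 = g (nxt s m q) := by
    have := h.values_eq q hq
    rwa [hq1, Nat.cast_one] at this
  have h4 : AtLeastNegOne n (nxt s 0) e ↔ -1 ≤ e (p + 1) := by
    constructor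
    · exact fun h' => h' p hp hp1
    · intro h' r hr hr1
      rw [hc.lab.inj r p hr.le hp.le (by omega)]
      exact h'
  have h5 : AtLeastNegOne n (nxt s m) g ↔ -1 ≤ g (nxt s m q) := by
    constructor
    · exact fun h' => h' q hq hq1
    · intro h' r hr hr1
      rw [h.final.lab.inj r q hr.le hq.le (by omega)]
      exact h'
  have h6 := hc.lab.ne_zero (p := p + 1) hp
  -- The value `-1` at the position `1` would be a fixed point up to sign of a long cycle.
  have h7 : (e (p + 1)).natAbs ≠ 1 := fun h' => by
    have := hc.lab.inj (p + 1) p hp hp.le (by omega)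
    omega
  rw [h2, h3, ← h5, h1, h4]
  omega

end

section

variable {n : ℕ}

theorem IsCycle.entries_unique {f : ℤ → ℤ} {e e' : ℕ → ℤ} (h : IsCycle n f e)
    (h' : IsCycle n f e') : e = e' := by
  funext p
  by_cases hp : p ≤ n
  · induction p with
    | zero => rw [← h.first, ← h'.first]
    | succ p ih => rw [← h.succ p hp, ← h'.succ p hp, ih (by omega)]
  · rw [h.lab.out p (by omega), h'.lab.out p (by omega)]

theorem phi_injOn {π π' : SignedPerm (n + 1)} (hπ : π ∈ cyclicB (n + 1)) (ht : HasPosTop n π)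
    (hπ' : π' ∈ cyclicB (n + 1)) (ht' : HasPosTop n π') (heq : phi n π = phi n π') : π = π' := by
  obtain ⟨e, he⟩ := exists_isCycle hπ ht
  obtain ⟨e', he'⟩ := exists_isCycle hπ' ht'
  exact phi_injective he he' heq

/-- The one-line notation of `σ`, followed by `n + 1` and written in parentheses, is a cycle. This
gives as many `π` as there are elements of `B_n`, so that the injective map `φ` is surjective. -/
theorem phi_surjective (σ : SignedPerm n) :
    ∃ π ∈ cyclicB (n + 1), HasPosTop n π ∧ phi n π = σ := by
  obtain ⟨E, hE⟩ : ∃ E : SignedPerm n → ℕ → ℤ, ∀ σ p, E σ p =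
      if p < n then values σ ((p : ℤ) + 1) else if p = n then (n : ℤ) + 1 else 0 :=
    ⟨_, fun _ _ => rfl⟩
  have hlab : ∀ σ, IsLabeling n (E σ) := by
    intro σ
    have hb : ∀ p < n, 1 ≤ (E σ p).natAbs ∧ (E σ p).natAbs ≤ n := by
      intro p hp
      rw [hE, if_pos hp]
      have h1 := values_ne_zero σ (k := (p : ℤ) + 1) (by omega)
      have h2 := natAbs_values_le σ (k := (p : ℤ) + 1) (by omega)
      omega
    have htop : E σ n = n + 1 := by rw [hE, if_neg (by omega), if_pos rfl]
    refine ⟨htop, fun p hp => by rw [hE, if_neg (by omega), if_neg (by omega)], hb, ?_⟩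
    intro p q hp hq hpq
    rcases hp.lt_or_eq with hp | rfl <;> rcases hq.lt_or_eq with hq | rfl
    · rw [hE, hE, if_pos hp, if_pos hq] at hpq
      have := natAbs_values_inj σ hpq
      omega
    · have := hb p hp; omega
    · have := hb q hq; omega
    · rfl
  choose ψ hψ1 hψ2 hψ3 using fun σ => (hlab σ).exists_cyclic
  have hinj : Function.Injective fun σ => phi n (ψ σ) := by
    intro σ τ hστ
    have h1 : ψ σ = ψ τ := phi_injective (hψ3 σ) (hψ3 τ) hστ
    have h2 := hψ3 σ
    rw [h1] at h2
    have h3 := h2.entries_unique (hψ3 τ)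
    refine signedPerm_ext fun i hi1 hi2 => ?_
    have h4 := congrFun h3 (i - 1)
    rw [hE, hE, if_pos (by omega), if_pos (by omega),
      show ((i - 1 : ℕ) : ℤ) + 1 = (i : ℤ) by omega] at h4
    exact h4
  obtain ⟨τ, hτ⟩ := Finite.surjective_of_injective hinj σ
  exact ⟨ψ τ, hψ1 τ, hψ2 τ, hτ⟩

/-! ### Sign changes -/

theorem values_negAll {k : ℤ} (hk : k.natAbs ≤ n) : values (negAll n) k = -k := by
  change signChangeFun n (Finset.Icc 1 n) k = -k
  simp only [signChangeFun, Finset.mem_Icc]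
  split_ifs <;> omega

theorem values_negOne (hn : 1 ≤ n) (k : ℤ) :
    values (negOne n) k = if k.natAbs = 1 then -k else k := by
  change signChangeFun n {1} k = _
  simp only [signChangeFun, Finset.mem_singleton]
  split_ifs <;> omega

theorem values_negAll_mul (σ : SignedPerm n) {k : ℤ} (hk : k.natAbs ≤ n) :
    values (negAll n * σ) k = -values σ k := by
  rw [values_mul, values_negAll (natAbs_values_le σ hk)]

theorem negAll_mul_negAll_mul (σ : SignedPerm n) : negAll n * (negAll n * σ) = σ :=
  signedPerm_ext fun i _ h2 => by
    rw [values_negAll_mul _ (by omega), values_negAll_mul _ (by omega), neg_neg]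

theorem values_negOne_mul (hn : 1 ≤ n) (σ : SignedPerm n) (k : ℤ) :
    values (negOne n * σ) k =
      if (values σ k).natAbs = 1 then -values σ k else values σ k := by
  rw [values_mul, values_negOne hn]

theorem negOne_mul_negOne_mul (hn : 1 ≤ n) (σ : SignedPerm n) :
    negOne n * (negOne n * σ) = σ :=
  signedPerm_ext fun i _ h2 => by
    rw [values_negOne_mul hn, values_negOne_mul hn]
    split_ifs <;> omega

theorem zero_mem_des_iff (hn : 1 ≤ n) (σ : SignedPerm n) :
    0 ∈ Des n (values σ) ↔ values σ 1 < 0 := by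
  rw [Des, Finset.mem_filter, Finset.mem_range, Nat.cast_zero, zero_add, values_zero]
  exact ⟨fun h => h.2, fun h => ⟨hn, h⟩⟩

theorem mem_des_iff (σ : SignedPerm n) {r : ℕ} (hr : r < n) :
    r ∈ Des n (values σ) ↔ values σ ((r : ℤ) + 1) < values σ r := by
  rw [Des, Finset.mem_filter, Finset.mem_range]
  exact ⟨fun h => h.2, fun h => ⟨hr, h⟩⟩

theorem mem_des_negAll_mul (σ : SignedPerm n) {r : ℕ} (hr : r < n) :
    r ∈ Des n (values (negAll n * σ)) ↔ r ∉ Des n (values σ) := by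
  have h1 : values σ ((r : ℤ) + 1) ≠ values σ r := fun h => by
    have := values_injective σ h
    omega
  rw [mem_des_iff _ hr, mem_des_iff _ hr, values_negAll_mul _ (by omega),
    values_negAll_mul _ (by omega)]
  omega

theorem mem_des_negOne_mul (hn : 1 ≤ n) (σ : SignedPerm n) {r : ℕ} (h1 : 1 ≤ r) (hr : r < n) :
    r ∈ Des n (values (negOne n * σ)) ↔ r ∈ Des n (values σ) := by
  have h2 : (values σ ((r : ℤ) + 1)).natAbs ≠ (values σ r).natAbs := fun h => by
    have := natAbs_values_inj σ h
    omega
  have h3 := values_ne_zero σ (k := (r : ℤ) + 1) (by omega)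
  have h4 := values_ne_zero σ (k := (r : ℤ)) (by omega)
  rw [mem_des_iff _ hr, mem_des_iff _ hr, values_negOne_mul hn, values_negOne_mul hn]
  split_ifs <;> omega

theorem negAll_mul_mem_typeD (σ : SignedPerm n) :
    negAll n * σ ∈ typeD n ↔ (Even n ↔ σ ∈ typeD n) := by
  have h1 := Finset.card_filter_add_card_filter_not (s := Finset.Icc 1 n)
    (fun i : ℕ => values σ i < 0)
  have h2 : (Finset.Icc 1 n).filter (fun i : ℕ => ¬ values σ i < 0) =
      (Finset.Icc 1 n).filter fun i : ℕ => values (negAll n * σ) i < 0 := by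
    refine Finset.filter_congr fun i hi => ?_
    rw [Finset.mem_Icc] at hi
    have h3 := values_ne_zero σ (k := (i : ℤ)) (by omega)
    rw [values_negAll_mul _ (by omega)]
    omega
  rw [h2, Nat.card_Icc, Nat.add_sub_cancel] at h1
  change Even _ ↔ (Even n ↔ Even _)
  have h3 := congrArg Even h1
  rw [Nat.even_add] at h3
  tauto

theorem negOne_mul_mem_typeD (hn : 1 ≤ n) (σ : SignedPerm n) :
    negOne n * σ ∈ typeD n ↔ σ ∉ typeD n := by
  -- It suffices to add a negative; the other case follows by exchanging the two elements.
  have key : ∀ (τ : SignedPerm n) (i : ℕ), 1 ≤ i → i ≤ n → values τ i = 1 →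
      (negOne n * τ ∈ typeD n ↔ τ ∉ typeD n) := by
    intro τ i h1 h2 h3
    have h4 : (Finset.Icc 1 n).filter (fun k : ℕ => values (negOne n * τ) k < 0) =
        insert i ((Finset.Icc 1 n).filter fun k : ℕ => values τ k < 0) := by
      ext k
      simp only [Finset.mem_insert, Finset.mem_filter, Finset.mem_Icc]
      rw [values_negOne_mul hn]
      by_cases hk : k = i
      · subst hk
        rw [h3]
        simp [h1, h2]
      · have h5 : (values τ k).natAbs ≠ (values τ i).natAbs := fun h => by
          have := natAbs_values_inj τ h
          omega
        rw [if_neg (by omega)]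
        tauto
    change Even _ ↔ ¬ Even _
    rw [h4, Finset.card_insert_of_notMem, Nat.even_add_one]
    intro h5
    have := (Finset.mem_filter.1 h5).2
    omega
  obtain ⟨p, hp, hp1⟩ := exists_natAbs_eq (n := n) (e := fun p => values σ ((p : ℤ) + 1)) (r := 1)
    (fun p hp => by
      have h1 := values_ne_zero σ (k := (p : ℤ) + 1) (by omega)
      have h2 := natAbs_values_le σ (k := (p : ℤ) + 1) (by omega)
      omega)
    (fun p q _ _ hpq => by
      have := natAbs_values_inj σ hpq
      omega) le_rfl hn
  rcases Int.natAbs_eq (values σ ((p : ℤ) + 1)) with h1 | h1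
  · exact key σ (p + 1) (by omega) hp (by push_cast; omega)
  · have h2 := key (negOne n * σ) (p + 1) (by omega) hp (by
      rw [values_negOne_mul hn]
      push_cast
      rw [if_pos hp1]
      omega)
    rw [negOne_mul_negOne_mul hn] at h2
    tauto

/-! ### The elements of `C_{B,n+1}` whose cycle notation contains `-(n + 1)` -/

theorem negAll_mul_mem_cyclicB {N : ℕ} {π : SignedPerm N} (hπ : π ∈ cyclicB N) :
    negAll N * π ∈ cyclicB N := by
  obtain ⟨l, hlen, hnd, hb, hrot⟩ := hπ
  refine ⟨l.map fun a => -a, by simpa using hlen, ?_, ?_, ?_⟩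
  · simpa [List.map_map, Function.comp_def] using hnd
  · intro a ha
    obtain ⟨b, hb', rfl⟩ := List.mem_map.1 ha
    rw [abs_neg]
    exact hb b hb'
  · rw [← List.map_rotate, ← hrot, List.map_map, List.map_map]
    refine List.map_congr_left fun a ha => ?_
    simp only [Function.comp, abs_neg]
    refine values_negAll_mul π ?_
    have := (hb a ha).2
    rw [Int.abs_eq_natAbs] at this ⊢
    omega

theorem hasPosTop_negAll_mul (π : SignedPerm (n + 1)) :
    HasPosTop n (negAll (n + 1) * π) ↔ ¬ HasPosTop n π := by
  constructor
  · rintro ⟨i, hi1, hi2, hi⟩ ⟨j, hj1, hj2, hj⟩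
    rw [values_negAll_mul _ (by omega)] at hi
    have := natAbs_values_inj π (k := i) (l := j) (by omega)
    rw [show i = j by omega] at hi
    omega
  · intro h
    obtain ⟨i, hi⟩ : ∃ i, values π i = (n : ℤ) + 1 :=
      (π : Equiv.Perm ℤ).surjective ((n : ℤ) + 1)
    have h1 : i.natAbs ≤ n + 1 := by
      by_contra h1
      have := values_of_lt π (k := i) (by omega)
      omega
    have h2 : i ≠ 0 := by
      rintro rfl
      rw [values_zero] at hi
      omega
    have h3 : ¬ 1 ≤ i := fun h3 => h ⟨i, h3, by omega, hi⟩
    refine ⟨-i, by omega, by omega, ?_⟩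
    rw [values_negAll_mul _ (by omega), values_neg, hi, neg_neg]

end

section

variable {n : ℕ}

/-! ### The map `Φ` -/

/-- The properties of `φ(π)` from which those of `Φ` follow. -/
theorem phi_spec (hn : 1 ≤ n) {π : SignedPerm (n + 1)} (hπ : π ∈ cyclicB (n + 1))
    (ht : HasPosTop n π) :
    (∀ r, 1 ≤ r → r < n → (r ∈ Des (n + 1) (values π) ↔ r ∈ Des n (values (phi n π)))) ∧
      (phi n π ∈ typeD n ↔ π ∈ typeD (n + 1)) ∧
      (0 < values π 1 ↔ -1 ≤ values (phi n π) 1) := by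
  obtain ⟨e, he⟩ := exists_isCycle hπ ht
  obtain ⟨m, s, g, hg⟩ := he.exists_phiData
  refine ⟨fun r => hg.mem_des_iff, ?_, hg.first_iff he hn⟩
  change Even _ ↔ Even _
  rw [hg.card_neg he]

open Classical in
/-- Replace the value at position `1` by `1` if it is `-1`. -/
noncomputable def fixFirst (n : ℕ) (σ : SignedPerm n) : SignedPerm n :=
  if values σ 1 = -1 then negOne n * σ else σ

theorem zero_mem_symmDiff_iff (hn : 1 ≤ n) (π : SignedPerm (n + 1)) (σ : SignedPerm n) :
    0 ∈ symmDiff (Des (n + 1) (values π)) (Des n (values σ)) ↔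
      ¬ (0 < values π 1 ↔ 0 < values σ 1) := by
  have h1 := values_ne_zero π (k := 1) one_ne_zero
  have h2 := values_ne_zero σ (k := 1) one_ne_zero
  rw [Finset.mem_symmDiff, zero_mem_des_iff (by omega), zero_mem_des_iff hn]
  omega

theorem Phi_of_hasPosTop (hn : 1 ≤ n) (π : cyclicB (n + 1)) (ht : HasPosTop n π) :
    Phi n π = fixFirst n (phi n π) := by
  obtain ⟨-, -, h1⟩ := phi_spec hn π.2 ht
  have h2 := values_ne_zero (phi n π) (k := 1) one_ne_zero
  have h3 : 0 ∈ symmDiff (Des (n + 1) (values (π : SignedPerm (n + 1))))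
      (Des n (values (phi n π))) ↔ values (phi n π) 1 = -1 := by
    rw [zero_mem_symmDiff_iff hn]
    omega
  simp only [Phi, fixFirst, if_pos ht, h3]

theorem Phi_of_not_hasPosTop (hn : 1 ≤ n) (π : cyclicB (n + 1)) (ht : ¬ HasPosTop n π) :
    Phi n π = negAll n * fixFirst n (phi n (negAll (n + 1) * π)) := by
  obtain ⟨-, -, h1⟩ := phi_spec hn (negAll_mul_mem_cyclicB π.2) ((hasPosTop_negAll_mul _).2 ht)
  have h0 := values_ne_zero (π : SignedPerm (n + 1)) (k := 1) one_ne_zero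
  rw [values_negAll_mul _ (by omega)] at h1
  obtain ⟨σ, hσ⟩ : ∃ σ, σ = phi n (negAll (n + 1) * π) := ⟨_, rfl⟩
  rw [← hσ] at h1
  have h2 := values_ne_zero σ (k := 1) one_ne_zero
  have h3 : 0 ∈ symmDiff (Des (n + 1) (values (π : SignedPerm (n + 1))))
      (Des n (values (negAll n * σ))) ↔ values σ 1 = -1 := by
    rw [zero_mem_symmDiff_iff hn, values_negAll_mul _ (by omega)]
    omega
  simp only [Phi, fixFirst, if_neg ht, ← hσ, h3, mul_ite]

theorem mem_des_fixFirst (hn : 1 ≤ n) (σ : SignedPerm n) {r : ℕ} (h1 : 1 ≤ r) (hr : r < n) :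
    r ∈ Des n (values (fixFirst n σ)) ↔ r ∈ Des n (values σ) := by
  unfold fixFirst
  split_ifs
  · exact mem_des_negOne_mul hn σ h1 hr
  · rfl

theorem fixFirst_pos_iff (hn : 1 ≤ n) (σ : SignedPerm n) :
    0 < values (fixFirst n σ) 1 ↔ -1 ≤ values σ 1 := by
  have h2 := values_ne_zero σ (k := 1) one_ne_zero
  unfold fixFirst
  split_ifs with h1
  · rw [values_negOne_mul hn, h1]
    decide
  · omega

/-- `Φ` preserves descents. -/
theorem des_Phi (hn : 1 ≤ n) (π : cyclicB (n + 1)) :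
    Des (n + 1) (values (π : SignedPerm (n + 1))) ∩ Finset.range n = Des n (values (Phi n π)) := by
  have h0 := values_ne_zero (π : SignedPerm (n + 1)) (k := 1) one_ne_zero
  have key : ∀ r < n, (r ∈ Des (n + 1) (values (π : SignedPerm (n + 1))) ↔
      r ∈ Des n (values (Phi n π))) := by
    intro r hr
    by_cases ht : HasPosTop n π
    · obtain ⟨h1, -, h2⟩ := phi_spec hn π.2 ht
      rw [Phi_of_hasPosTop hn π ht]
      rcases Nat.eq_zero_or_pos r with rfl | hr0
      · have h3 := fixFirst_pos_iff hn (phi n π)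
        have h4 := values_ne_zero (fixFirst n (phi n π)) (k := 1) one_ne_zero
        rw [zero_mem_des_iff (by omega), zero_mem_des_iff hn]
        omega
      · rw [h1 r hr0 hr, mem_des_fixFirst hn _ hr0 hr]
    · obtain ⟨h1, -, h2⟩ :=
        phi_spec hn (negAll_mul_mem_cyclicB π.2) ((hasPosTop_negAll_mul _).2 ht)
      rw [Phi_of_not_hasPosTop hn π ht, mem_des_negAll_mul _ hr]
      rcases Nat.eq_zero_or_pos r with rfl | hr0
      · have h3 := fixFirst_pos_iff hn (phi n (negAll (n + 1) * π))
        have h4 := values_ne_zero (fixFirst n (phi n (negAll (n + 1) * π))) (k := 1) one_ne_zero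
        rw [values_negAll_mul _ (by omega)] at h2
        rw [zero_mem_des_iff (by omega), zero_mem_des_iff hn]
        omega
      · rw [mem_des_fixFirst hn _ hr0 hr, ← h1 r hr0 hr, mem_des_negAll_mul _ (by omega), not_not]
  ext r
  rw [Finset.mem_inter, Finset.mem_range]
  constructor
  · exact fun h => (key r h.2).1 h.1
  · intro h
    have hr : r < n := Finset.mem_range.1 (Finset.mem_filter.1 h).1
    exact ⟨(key r hr).2 h, hr⟩

/-- `σ` can be recovered from `fixFirst n σ` and the parity of its number of negatives. -/
theorem fixFirst_spec (hn : 1 ≤ n) (σ : SignedPerm n) :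
    (fixFirst n σ = σ ∧ (fixFirst n σ ∈ typeD n ↔ σ ∈ typeD n) ∧ values (fixFirst n σ) 1 ≠ -1) ∨
      (negOne n * fixFirst n σ = σ ∧ (fixFirst n σ ∈ typeD n ↔ σ ∉ typeD n) ∧
        values (fixFirst n σ) 1 = 1) := by
  unfold fixFirst
  split_ifs with h
  · exact Or.inr ⟨negOne_mul_negOne_mul hn σ, negOne_mul_mem_typeD hn σ, by
      rw [values_negOne_mul hn, h]; decide⟩
  · exact Or.inl ⟨rfl, Iff.rfl, h⟩

theorem fixFirst_of_ne {σ : SignedPerm n} (h : values σ 1 ≠ -1) : fixFirst n σ = σ := by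
  rw [fixFirst, if_neg h]

theorem fixFirst_negOne_mul (hn : 1 ≤ n) {σ : SignedPerm n} (h : values σ 1 = 1) :
    fixFirst n (negOne n * σ) = σ := by
  rw [fixFirst, if_pos (by rw [values_negOne_mul hn, h]; decide), negOne_mul_negOne_mul hn]

/-- Where `Φ(π) = ρ` comes from can be read off from `ρ 1` and from the parities of `π` and `ρ`. -/
theorem Phi_spec (hn : 1 ≤ n) (π : cyclicB (n + 1)) :
    (HasPosTop n π ∧
      ((((Phi n π ∈ typeD n ↔ (π : SignedPerm (n + 1)) ∈ typeD (n + 1)) ∧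
          values (Phi n π) 1 ≠ -1) ∧ phi n π = Phi n π) ∨
        ((¬ (Phi n π ∈ typeD n ↔ (π : SignedPerm (n + 1)) ∈ typeD (n + 1)) ∧
          values (Phi n π) 1 = 1) ∧ phi n π = negOne n * Phi n π))) ∨
    (¬ HasPosTop n π ∧
      (((¬ (Phi n π ∈ typeD n ↔ (π : SignedPerm (n + 1)) ∈ typeD (n + 1)) ∧
          values (Phi n π) 1 ≠ 1) ∧ phi n (negAll (n + 1) * π) = negAll n * Phi n π) ∨
        (((Phi n π ∈ typeD n ↔ (π : SignedPerm (n + 1)) ∈ typeD (n + 1)) ∧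
          values (Phi n π) 1 = -1) ∧
          phi n (negAll (n + 1) * π) = negOne n * (negAll n * Phi n π)))) := by
  by_cases ht : HasPosTop n π
  · refine Or.inl ⟨ht, ?_⟩
    obtain ⟨-, h1, -⟩ := phi_spec hn π.2 ht
    rw [Phi_of_hasPosTop hn π ht]
    rcases fixFirst_spec hn (phi n π) with ⟨h2, h3, h4⟩ | ⟨h2, h3, h4⟩
    · exact Or.inl ⟨⟨h3.trans h1, h4⟩, h2.symm⟩
    · refine Or.inr ⟨⟨?_, h4⟩, h2.symm⟩
      rw [h3, h1]
      tauto
  · refine Or.inr ⟨ht, ?_⟩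
    obtain ⟨-, h1, -⟩ := phi_spec hn (negAll_mul_mem_cyclicB π.2) ((hasPosTop_negAll_mul _).2 ht)
    rw [Phi_of_not_hasPosTop hn π ht, negAll_mul_negAll_mul, values_negAll_mul _ (by omega),
      negAll_mul_mem_typeD]
    rw [negAll_mul_mem_typeD, Nat.even_add_one] at h1
    rcases fixFirst_spec hn (phi n (negAll (n + 1) * π)) with ⟨h2, h3, h4⟩ | ⟨h2, h3, h4⟩
    · refine Or.inl ⟨⟨?_, by omega⟩, h2.symm⟩
      rw [h3]
      tauto
    · refine Or.inr ⟨⟨?_, by omega⟩, h2.symm⟩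
      rw [h3]
      tauto

theorem Phi_injective (hn : 1 ≤ n) {π π' : cyclicB (n + 1)}
    (hD : (π : SignedPerm (n + 1)) ∈ typeD (n + 1) ↔ (π' : SignedPerm (n + 1)) ∈ typeD (n + 1))
    (heq : Phi n π = Phi n π') : π = π' := by
  have h1 := Phi_spec hn π
  have h2 := Phi_spec hn π'
  rw [heq, hD] at h1
  have hpos : HasPosTop n π → HasPosTop n π' → phi n π = phi n π' → π = π' := fun h h' h'' =>
    Subtype.ext (phi_injOn π.2 h π'.2 h' h'')
  have hneg : ¬ HasPosTop n π → ¬ HasPosTop n π' →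
      phi n (negAll (n + 1) * π) = phi n (negAll (n + 1) * π') → π = π' := fun h h' h'' =>
    Subtype.ext (mul_left_cancel (phi_injOn (negAll_mul_mem_cyclicB π.2)
      ((hasPosTop_negAll_mul _).2 h) (negAll_mul_mem_cyclicB π'.2)
      ((hasPosTop_negAll_mul _).2 h') h''))
  rcases h1 with ⟨ht, ⟨⟨h3, h4⟩, h5⟩ | ⟨⟨h3, h4⟩, h5⟩⟩ | ⟨ht, ⟨⟨h3, h4⟩, h5⟩ | ⟨⟨h3, h4⟩, h5⟩⟩ <;>
  rcases h2 with ⟨ht', ⟨⟨h3', h4'⟩, h5'⟩ | ⟨⟨h3', h4'⟩, h5'⟩⟩ |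
    ⟨ht', ⟨⟨h3', h4'⟩, h5'⟩ | ⟨⟨h3', h4'⟩, h5'⟩⟩ <;>
  first
    | exact absurd h3 h3'
    | exact absurd h3' h3
    | omega
    | exact hpos ht ht' (h5.trans h5'.symm)
    | exact hneg ht ht' (h5.trans h5'.symm)

/-- The four cases correspond to those of `Phi_spec`. -/
theorem Phi_surjective (hn : 1 ≤ n) (ρ : SignedPerm n) (b : Prop) :
    ∃ π : cyclicB (n + 1), ((π : SignedPerm (n + 1)) ∈ typeD (n + 1) ↔ b) ∧ Phi n π = ρ := by
  have hpos : ∀ σ : SignedPerm n, ∃ π : cyclicB (n + 1),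
      ((π : SignedPerm (n + 1)) ∈ typeD (n + 1) ↔ σ ∈ typeD n) ∧ Phi n π = fixFirst n σ := by
    intro σ
    obtain ⟨π, hπ, ht, rfl⟩ := phi_surjective σ
    exact ⟨⟨π, hπ⟩, (phi_spec hn hπ ht).2.1.symm, Phi_of_hasPosTop hn ⟨π, hπ⟩ ht⟩
  have hneg : ∀ σ : SignedPerm n, ∃ π : cyclicB (n + 1),
      ((π : SignedPerm (n + 1)) ∈ typeD (n + 1) ↔ (Even (n + 1) ↔ σ ∈ typeD n)) ∧
        Phi n π = negAll n * fixFirst n σ := by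
    intro σ
    obtain ⟨π, hπ, ht, rfl⟩ := phi_surjective σ
    refine ⟨⟨negAll (n + 1) * π, negAll_mul_mem_cyclicB hπ⟩, ?_, ?_⟩
    · rw [negAll_mul_mem_typeD, (phi_spec hn hπ ht).2.1]
    · rw [Phi_of_not_hasPosTop hn]
      · simp only [negAll_mul_negAll_mul]
      · intro ht'
        exact (hasPosTop_negAll_mul π).1 ht' ht
  by_cases hb : ρ ∈ typeD n ↔ b
  · by_cases h1 : values ρ 1 = -1
    · obtain ⟨π, h2, h3⟩ := hneg (negOne n * (negAll n * ρ))
      rw [fixFirst_negOne_mul hn (by rw [values_negAll_mul _ (by omega)]; omega),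
        negAll_mul_negAll_mul] at h3
      rw [negOne_mul_mem_typeD hn, negAll_mul_mem_typeD, Nat.even_add_one] at h2
      exact ⟨π, by tauto, h3⟩
    · obtain ⟨π, h2, h3⟩ := hpos ρ
      rw [fixFirst_of_ne h1] at h3
      exact ⟨π, h2.trans hb, h3⟩
  · by_cases h1 : values ρ 1 = 1
    · obtain ⟨π, h2, h3⟩ := hpos (negOne n * ρ)
      rw [fixFirst_negOne_mul hn h1] at h3
      rw [negOne_mul_mem_typeD hn] at h2
      exact ⟨π, by tauto, h3⟩
    · obtain ⟨π, h2, h3⟩ := hneg (negAll n * ρ)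
      rw [fixFirst_of_ne (by rw [values_negAll_mul _ (by omega)]; omega),
        negAll_mul_negAll_mul] at h3
      rw [negAll_mul_mem_typeD, Nat.even_add_one] at h2
      exact ⟨π, by tauto, h3⟩

/-! ### Elizalde's map -/

theorem values_unsigned {N : ℕ} (w : Equiv.Perm (Fin N)) (i : Fin N) :
    values (unsigned w) ((i : ℕ) + 1 : ℤ) = (w i : ℕ) + 1 := by
  change unsignedFun w _ = _
  have h1 : 1 ≤ ((i : ℕ) + 1 : ℤ).natAbs ∧ ((i : ℕ) + 1 : ℤ).natAbs ≤ N := by omega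
  have h2 : (⟨((i : ℕ) + 1 : ℤ).natAbs - 1, by omega⟩ : Fin N) = i := Fin.ext (by simp; omega)
  rw [unsignedFun, dif_pos h1, h2, Int.sign_eq_one_of_pos (by omega), one_mul]

theorem values_unsigned_pos {N : ℕ} (w : Equiv.Perm (Fin N)) {i : ℤ} (h1 : 1 ≤ i) (h2 : i ≤ N) :
    0 < values (unsigned w) i := by
  have h3 := values_unsigned w ⟨(i - 1).toNat, by omega⟩
  simp only at h3
  rw [show ((i - 1).toNat : ℤ) + 1 = i by omega] at h3
  omega

theorem unsigned_injective {N : ℕ} : Function.Injective (unsigned (n := N)) := by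
  intro w v h
  refine Equiv.ext fun i => Fin.ext ?_
  have h1 := values_unsigned w i
  rw [h, values_unsigned] at h1
  omega

theorem exists_unsigned {N : ℕ} {σ : SignedPerm N} (h : ∀ i : ℤ, 1 ≤ i → i ≤ N → 0 < values σ i) :
    ∃ v, unsigned v = σ := by
  have hb : ∀ i : Fin N, 0 < values σ ((i : ℕ) + 1 : ℤ) ∧ values σ ((i : ℕ) + 1 : ℤ) ≤ N := by
    intro i
    have h1 := h ((i : ℕ) + 1 : ℤ) (by omega) (by omega)
    have h2 := natAbs_values_le σ (k := ((i : ℕ) + 1 : ℤ)) (by omega)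
    omega
  obtain ⟨V, hV⟩ : ∃ V : Fin N → Fin N, ∀ i, ((V i : ℕ) + 1 : ℤ) = values σ ((i : ℕ) + 1 : ℤ) := by
    refine ⟨fun i => ⟨(values σ ((i : ℕ) + 1 : ℤ) - 1).toNat, ?_⟩, fun i => ?_⟩
    · have := hb i; omega
    · have := hb i
      dsimp only
      omega
  have hinj : Function.Injective V := by
    intro i j hij
    have h1 := hV i
    rw [hij, hV j] at h1
    have := values_injective σ h1
    exact Fin.ext (by omega)
  refine ⟨Equiv.ofBijective V (Finite.injective_iff_bijective.1 hinj), signedPerm_ext ?_⟩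
  intro i h1 h2
  have h3 := values_unsigned (Equiv.ofBijective V (Finite.injective_iff_bijective.1 hinj))
    ⟨i - 1, by omega⟩
  rw [Equiv.ofBijective_apply, hV] at h3
  simp only at h3
  rwa [show ((i - 1 : ℕ) : ℤ) + 1 = (i : ℤ) by omega] at h3

theorem unsigned_mem_cyclicB {N : ℕ} (hN : 2 ≤ N) {w : Equiv.Perm (Fin N)} (hw : w ∈ cyclicS N) :
    unsigned w ∈ cyclicB N := by
  have hcyc : w.IsCycle := by
    rw [← Equiv.Perm.card_cycleType_eq_one, show w.cycleType = {N} from hw, Multiset.card_singleton]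
  have hcard : w.support.card = N := by
    have h1 := hcyc.cycleType
    rw [show w.cycleType = {N} from hw] at h1
    exact (Multiset.singleton_inj.1 h1).symm
  have hsupp : w.support = Finset.univ := by
    rw [← Finset.card_eq_iff_eq_univ, hcard, Fintype.card_fin]
  obtain ⟨x, hx⟩ : ∃ x : Fin N, x ∈ w.support := ⟨⟨0, by omega⟩, by rw [hsupp]; simp⟩
  have hlen : (w.toList x).length = N := by
    rw [Equiv.Perm.length_toList, hcyc.cycleOf_eq (Equiv.Perm.mem_support.1 hx), hcard]
  have hmap : (w.toList x).map w = (w.toList x).rotate 1 := by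
    rw [← Equiv.Perm.toList_pow_apply_eq_rotate, pow_one]
    have h1 : (w.toList (w x)).length = (w.toList x).length := by
      have := Equiv.Perm.toList_pow_apply_eq_rotate w x 1
      rw [pow_one] at this
      rw [this, List.length_rotate]
    refine List.ext_getElem (by rw [List.length_map, h1]) fun i h2 h3 => ?_
    rw [List.getElem_map, Equiv.Perm.getElem_toList, Equiv.Perm.getElem_toList,
      ← Equiv.Perm.mul_apply, ← Equiv.Perm.mul_apply, ← pow_succ, ← pow_succ']
  refine ⟨(w.toList x).map fun i : Fin N => ((i : ℕ) + 1 : ℤ), by rw [List.length_map, hlen], ?_, ?_, ?_⟩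
  · rw [List.map_map]
    refine List.Nodup.map (fun i j hij => ?_) (Equiv.Perm.nodup_toList w x)
    simp only [Function.comp, Int.abs_eq_natAbs] at hij
    exact Fin.ext (by omega)
  · intro a ha
    obtain ⟨i, -, rfl⟩ := List.mem_map.1 ha
    rw [Int.abs_eq_natAbs]
    omega
  · rw [← List.map_rotate, ← hmap, List.map_map, List.map_map]
    refine List.map_congr_left fun i _ => ?_
    simp only [Function.comp]
    rw [abs_of_pos (by omega), values_unsigned]

theorem hasPosTop_unsigned (w : Equiv.Perm (Fin (n + 1))) : HasPosTop n (unsigned w) := by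
  refine ⟨((w⁻¹ (Fin.last n) : Fin (n + 1)) : ℕ) + 1, by omega, by omega, ?_⟩
  rw [values_unsigned]
  simp

/-- On the entries of a positive cycle, Elizalde's algorithm makes the same steps as the algorithm for
signed permutations. -/
theorem unsigned_elizalde (hn : 1 ≤ n) {w : Equiv.Perm (Fin (n + 1))} (hw : w ∈ cyclicS (n + 1)) :
    unsigned (elizalde n w) = phi n (unsigned w) := by
  have hcyc := unsigned_mem_cyclicB (by omega) hw
  obtain ⟨e, he⟩ := exists_isCycle hcyc (hasPosTop_unsigned w)
  obtain ⟨m, s, g, hg⟩ := he.exists_phiData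
  have hpos : ∀ p, 0 ≤ e p := by
    intro p
    by_cases hp : p ≤ n
    · rcases p with _ | p
      · rw [← he.first]
        exact (values_unsigned_pos w (by omega) (by push_cast; rfl)).le
      · rw [← he.succ p hp]
        have := he.lab.bd p hp
        exact (values_unsigned_pos w (by omega) (by omega)).le
    · rw [he.lab.out p (by omega)]
  have halg : elizaldeAlgorithm n (values (unsigned w)) = algorithm n (values (unsigned w)) := by
    have hlen : (blocks s m e).length = m := by simp [blocks]
    rw [elizaldeAlgorithm, algorithm, hg.startCycles_eq, hlen]
    exact foldl_elizaldeStep_blocks hg.cuts hg.start (he.agrees s) hpos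
      (fun p q _ _ _ _ h => values_injective _ h) le_rfl
  have hval : ∀ i : ℤ, 1 ≤ i → i ≤ n →
      values (phi n (unsigned w)) i = cycleVal (elizaldeAlgorithm n (values (unsigned w))) i ∧
        0 < values (phi n (unsigned w)) i := by
    intro i h1 h2
    obtain ⟨p, hp, hpi⟩ := hg.final.lab.surj (r := i.natAbs) (by omega) (by omega)
    have h3 := hg.values_eq p hp
    have h4 := hg.cuts.nxt_lt_n hp
    have h5 := hg.final.lab.ne_zero h4.le
    have h6 := (hg.reaches.spec hg.start).2.1 (nxt s m p)
    have h7 := hpos (nxt s m p)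
    rw [hpi, show (i.natAbs : ℤ) = i by omega] at h3
    have h8 := cycleVal_blocks_natAbs hg.cuts hg.final.lab hp
    rw [hpi, show (i.natAbs : ℤ) = i by omega] at h8
    rw [halg, hg.algorithm_eq, h3, h8]
    exact ⟨rfl, by omega⟩
  obtain ⟨v, hv⟩ := exists_unsigned fun i h1 h2 => (hval i h1 h2).2
  have hex : ∃ v : Equiv.Perm (Fin n), ∀ i : ℤ, 1 ≤ i → i ≤ n →
      values (unsigned v) i = cycleVal (elizaldeAlgorithm n (values (unsigned w))) i :=
    ⟨v, fun i h1 h2 => by rw [hv]; exact (hval i h1 h2).1⟩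
  refine signedPerm_ext fun i h1 h2 => ?_
  rw [elizalde, dif_pos hex, hex.choose_spec i (by omega) (by omega),
    (hval i (by omega) (by omega)).1]

theorem Phi_unsigned (hn : 1 ≤ n) {w : Equiv.Perm (Fin (n + 1))} (hw : w ∈ cyclicS (n + 1)) :
    Phi n ⟨unsigned w, unsigned_mem_cyclicB (by omega) hw⟩ = unsigned (elizalde n w) := by
  rw [Phi_of_hasPosTop hn _ (hasPosTop_unsigned w), ← unsigned_elizalde hn hw]
  refine fixFirst_of_ne ?_
  have := values_unsigned_pos (elizalde n w) (i := 1) le_rfl (by omega)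
  omega

/-- Elizalde's map is injective because `φ` is, and there are `n!` cycles of length `n + 1`. -/
theorem elizalde_bijOn (hn : 1 ≤ n) : Set.BijOn (elizalde n) (cyclicS (n + 1)) Set.univ := by
  have hinj : Set.InjOn (elizalde n) (cyclicS (n + 1)) := by
    intro w hw v hv heq
    have h1 := unsigned_elizalde hn hw
    rw [heq, unsigned_elizalde hn hv] at h1
    exact unsigned_injective (phi_injOn (unsigned_mem_cyclicB (by omega) hw) (hasPosTop_unsigned w)
      (unsigned_mem_cyclicB (by omega) hv) (hasPosTop_unsigned v) h1.symm)
  refine ⟨fun _ _ => Set.mem_univ _, hinj, ?_⟩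
  classical
  have h1 := Equiv.Perm.card_of_cycleType_singleton (α := Fin (n + 1)) (n := n + 1) (by omega)
    (by rw [Fintype.card_fin])
  rw [Fintype.card_fin, Nat.choose_self, mul_one, Nat.add_sub_cancel] at h1
  have h2 : (({g | g.cycleType = {n + 1}} : Finset (Equiv.Perm (Fin (n + 1)))) :
      Set (Equiv.Perm (Fin (n + 1)))) = cyclicS (n + 1) := by
    ext g
    simp [cyclicS]
  rw [← h2] at hinj ⊢
  have h3 := Finset.card_image_of_injOn hinj
  rw [h1] at h3
  have h4 := (Finset.card_eq_iff_eq_univ _).1 (h3.trans (by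
    rw [Fintype.card_perm, Fintype.card_fin] : n.factorial = Fintype.card (Equiv.Perm (Fin n))))
  intro v _
  have h5 := Finset.mem_univ v
  rw [← h4] at h5
  exact Finset.mem_image.1 h5

end

end CyclicDescents
open CyclicDescents in
theorem theorem1p2 (n : ℕ) (hn : 1 ≤ n) :
    (∀ π : cyclicB (n + 1),
      Des (n + 1) (values (π : SignedPerm (n + 1))) ∩ Finset.range n =
        Des n (values (Phi n π))) ∧
    Set.BijOn (Phi n) {π | (π : SignedPerm (n + 1)) ∈ typeD (n + 1)} Set.univ ∧
    Set.BijOn (Phi n) {π | (π : SignedPerm (n + 1)) ∉ typeD (n + 1)} Set.univ ∧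
    (∀ w ∈ cyclicS (n + 1), ∃ hw : unsigned w ∈ cyclicB (n + 1),
      Phi n ⟨unsigned w, hw⟩ = unsigned (elizalde n w)) ∧
    Set.BijOn (elizalde n) (cyclicS (n + 1)) Set.univ := by
  refine ⟨des_Phi hn, ⟨fun _ _ => Set.mem_univ _, ?_, ?_⟩, ⟨fun _ _ => Set.mem_univ _, ?_, ?_⟩,
    fun w hw => ⟨unsigned_mem_cyclicB (by omega) hw, Phi_unsigned hn hw⟩, elizalde_bijOn hn⟩
  · intro π hπ π' hπ' heq
    exact Phi_injective hn (iff_of_true hπ hπ') heq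
  · intro ρ _
    obtain ⟨π, h1, h2⟩ := Phi_surjective hn ρ True
    exact ⟨π, h1.2 trivial, h2⟩
  · intro π hπ π' hπ' heq
    exact Phi_injective hn (iff_of_false hπ hπ') heq
  · intro ρ _
    obtain ⟨π, h1, h2⟩ := Phi_surjective hn ρ False
    exact ⟨π, h1.1, h2⟩
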